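/- Let $d$ be a natural number and write points of $\mathbb R^{2d}$ as $z=(x,\xi)$ with $x,\xi\in\mathbb R^d$. Let $\sigma((x,\xi),(x',\xi'))=x'\cdot\xi-x\cdot\xi'$, and let $\mathcal F_\sigma$ be the symplectic Fourier transform, $\mathcal F_\sigma f(\zeta)=\int_{\mathbb R^{2d}}e^{-2\pi i\sigma(\zeta,z)}f(z)\,dz$, extended to tempered distributions by $\langle\mathcal F_\sigma\tau,\psi\rangle=\langle\tau,\mathcal F_\sigma\psi\rangle$, where $\langle\tau,\psi\rangle=\tau(\overline\psi)$. Let $\rho(x,\xi)f(t)=e^{-\pi i x\cdot\xi}e^{2\pi i\xi\cdot t}f(t-x)$ and $\mathcal A(\varphi,\psi)(z)=\langle\varphi,\rho(z)\psi\rangle_{L^2(\mathbb R^d)}$. The Fourier–Wigner transform of a continuous linear operator $T:\mathscr S(\mathbb R^d)\to\mathscr S'(\mathbb R^d)$ is the tempered distribution $\mathcal F_W(T)$ on $\mathbb R^{2d}$ with $\langle T\psi,\varphi\rangle=\langle\mathcal F_W(T),\mathcal A(\varphi,\psi)\rangle$ for all $\varphi,\psi\in\mathscr S(\mathbb R^d)$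 (for trace class $T$ this is the function $z\mapsto\mathrm{tr}(T\rho(-z))$). For $1\le p<\infty$ let $\|T\|_{\mathcal S^p}$ be the $\ell^p$ norm of the singular values of $T$ as an operator on $L^2(\mathbb R^d)$, and let $\|T\|_{\mathcal S^\infty}$ be its operator norm on $L^2(\mathbb R^d)$; norms are $\infty$ for objects outside the corresponding space. Let $\mathcal P_\Omega$ be a partition of a set $\Omega\subset\mathbb R^{2d}$. For $1\le p,q\le\infty$ let $\mathcal D^{\mathscr C}_{p,q}(\mathcal P_\Omega)\in[0,\infty]$ be the smallest constant $D$ such that $$\Big\|\sum_{\theta\in\mathcal P_\Omega}f_\theta\Big\|_{L^p(\mathbb R^{2d})}\le D\Big(\sum_{\theta\in\mathcal P_\Omega}\|f_\theta\|_{L^p(\mathbb R^{2d})}^q\Big)^{1/q}$$ for all families with $\mathrm{supp}\,\mathcal F_\sigma(f_\theta)\subseteq\theta$ for every $\theta\in\mathcal P_\Omega$, and let $\mathcal D^{\mathscr Q}_{p,q}(\mathcal P_\Omega)\in[0,\infty]$ be the smallest constant $D$ such that $$\Big\|\sum_{\theta\in\mathcal P_\Omega}T_\theta\Big\|_{\mathcal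 S^p}\le D\Big(\sum_{\theta\in\mathcal P_\Omega}\|T_\theta\|_{\mathcal S^p}^q\Big)^{1/q}$$ for all families of continuous linear operators $T_\theta:\mathscr S(\mathbb R^d)\to\mathscr S'(\mathbb R^d)$ with $\mathrm{supp}\,\mathcal F_W(T_\theta)\subseteq\theta$ for every $\theta\in\mathcal P_\Omega$. (For $q=\infty$ the right-hand sides are suprema. If $\mathcal P_\Omega$ is infinite, the families are those whose sum converges unconditionally in $\mathscr S'(\mathbb R^{2d})$, respectively, tested against any two Schwartz functions, as an operator from $\mathscr S(\mathbb R^d)$ to $\mathscr S'(\mathbb R^d)$.) **Theorem.** Let $\Omega\subset\mathbb R^{2d}$ be bounded. There is a constant $1\le C<\infty$, depending only on $\Omega$, such that for every partition $\mathcal P_\Omega$ of $\Omega$ and all $1\le p,q\le\infty$, $$C^{-1}\,\mathcal D^{\mathscr C}_{p,q}(\mathcal P_\Omega)\le\mathcal D^{\mathscr Q}_{p,q}(\mathcal P_\Omega)\le C\,\mathcal D^{\mathscr C}_{p,q}(\mathcal P_\Omega).$$ -/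

import Mathlib

open scoped SchwartzMap ENNReal NNReal
open MeasureTheory Filter

noncomputable section
namespace QuantumDecoupling

/-- Configuration space `ℝ^d`. -/
abbrev Conf (d : ℕ) : Type := EuclideanSpace ℝ (Fin d)
/-- Phase space `ℝ^{2d}`; a point `z = (x, ξ)` has position coordinates `z (Sum.inl i)` and
momentum coordinates `z (Sum.inr i)`. -/
abbrev Phase (d : ℕ) : Type := EuclideanSpace ℝ (Fin d ⊕ Fin d)

/-- The position `x` of `z = (x, ξ)`. -/
def pos {d : ℕ} : Phase d →L[ℝ] Conf d :=
  LinearMap.toContinuousLinearMap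
    { toFun := fun z => WithLp.toLp 2 fun i => z (Sum.inl i)
      map_add' := fun _ _ => rfl
      map_smul' := fun _ _ => rfl }

/-- The momentum `ξ` of `z = (x, ξ)`. -/
def mom {d : ℕ} : Phase d →L[ℝ] Conf d :=
  LinearMap.toContinuousLinearMap
    { toFun := fun z => WithLp.toLp 2 fun i => z (Sum.inr i)
      map_add' := fun _ _ => rfl
      map_smul' := fun _ _ => rfl }

theorem pos_apply {d : ℕ} (z : Phase d) (i : Fin d) : pos z i = z (Sum.inl i) := rfl

theorem mom_apply {d : ℕ} (z : Phase d) (i : Fin d) : mom z i = z (Sum.inr i) := rfl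

theorem norm_sq_phase {d : ℕ} (z : Phase d) : ‖z‖ ^ 2 = ‖pos z‖ ^ 2 + ‖mom z‖ ^ 2 := by
  simp [EuclideanSpace.norm_sq_eq, pos_apply, mom_apply]

theorem norm_pos_le {d : ℕ} (z : Phase d) : ‖pos z‖ ≤ ‖z‖ := by
  refine abs_le_of_sq_le_sq' ?_ (norm_nonneg _) |>.2
  rw [norm_sq_phase]
  nlinarith [sq_nonneg ‖mom z‖]

theorem norm_mom_le {d : ℕ} (z : Phase d) : ‖mom z‖ ≤ ‖z‖ := by
  refine abs_le_of_sq_le_sq' ?_ (norm_nonneg _) |>.2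
  rw [norm_sq_phase]
  nlinarith [sq_nonneg ‖pos z‖]


/-- The symmetric time-frequency shift
`(ρ(x, ξ) f)(t) = e^{-π i x·ξ} e^{2π i ξ·t} f(t - x)`. -/
def tfShift {d : ℕ} (z : Phase d) (f : Conf d → ℂ) (t : Conf d) : ℂ :=
  Complex.exp (-(Real.pi * inner ℝ (pos z) (mom z) : ℝ) * Complex.I) *
    Complex.exp ((2 * Real.pi * inner ℝ (mom z) t : ℝ) * Complex.I) * f (t - (pos z))

/-- The cross-ambiguity function `A(φ, ψ)(z) = ⟨φ, ρ(z) ψ⟩`. -/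
def ambiguityFun {d : ℕ} (φ ψ : Conf d → ℂ) (z : Phase d) : ℂ :=
  ∫ t, φ t * star (tfShift z ψ t)

/-! ### The cross-ambiguity function of two Schwartz functions is a Schwartz function -/

theorem integral_clm_apply {V X : Type*} [NormedAddCommGroup V] [NormedSpace ℝ V]
    [MeasurableSpace X] {μ : Measure X} (F : X → V →L[ℝ] ℂ) (hF : Integrable F μ) (m : V) :
    (∫ t, F t ∂μ) m = ∫ t, F t m ∂μ :=
  ContinuousLinearMap.integral_apply hF m

theorem integral_comb {X : Type*} [MeasurableSpace X] {μ : Measure X} {f₁ f₂ f₃ f₄ : X → ℂ}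
    (h₁ : Integrable f₁ μ) (h₂ : Integrable f₂ μ) (h₃ : Integrable f₃ μ) (h₄ : Integrable f₄ μ)
    {c₁ c₂ c₃ c₄ : ℂ} :
    ∫ t, c₁ * f₁ t + (c₂ * f₂ t + (c₃ * f₃ t + c₄ * f₄ t)) ∂μ =
      c₁ * ∫ t, f₁ t ∂μ + (c₂ * ∫ t, f₂ t ∂μ + (c₃ * ∫ t, f₃ t ∂μ + c₄ * ∫ t, f₄ t ∂μ)) := by
  have h34 : Integrable (fun t => c₃ * f₃ t + c₄ * f₄ t) μ :=
    (h₃.const_mul c₃).add (h₄.const_mul c₄)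
  have h234 : Integrable (fun t => c₂ * f₂ t + (c₃ * f₃ t + c₄ * f₄ t)) μ :=
    (h₂.const_mul c₂).add h34
  rw [integral_add (h₁.const_mul c₁) h234, integral_add (h₂.const_mul c₂) h34,
    integral_add (h₃.const_mul c₃) (h₄.const_mul c₄)]
  simp only [integral_const_mul]

theorem fderiv_apply_eq {V : Type*} [NormedAddCommGroup V] [NormedSpace ℝ V] {f : V → ℂ}
    {f' : V →L[ℝ] ℂ} {z : V} (h : HasFDerivAt f f' z) (m : V) : fderiv ℝ f z m = f' m := by
  rw [h.fderiv]

theorem schwartz_of_submodule {V : Type*} [NormedAddCommGroup V] [NormedSpace ℝ V]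
    [FiniteDimensional ℝ V] (S : Submodule ℂ (V → ℂ))
    (hb : ∀ f ∈ S, ∀ k : ℕ, ∃ C, ∀ z, ‖z‖ ^ k * ‖f z‖ ≤ C)
    (hd : ∀ f ∈ S, Differentiable ℝ f ∧ ∀ m : V, (fun z => fderiv ℝ f z m) ∈ S) (n : ℕ) :
    ∀ f ∈ S, ContDiff ℝ n f ∧ ∀ k : ℕ, ∃ C, ∀ z, ‖z‖ ^ k * ‖iteratedFDeriv ℝ n f z‖ ≤ C := by
  induction n with
  | zero =>
    intro f hf
    refine ⟨?_, fun k => ?_⟩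
    · simpa [contDiff_zero] using (hd f hf).1.continuous
    · simpa using hb f hf k
  | succ n ih =>
    intro f hf
    let b := Module.finBasis ℝ V
    let ℓ : Fin (Module.finrank ℝ V) → (ℂ →L[ℝ] (V →L[ℝ] ℂ)) := fun i =>
      (ContinuousLinearMap.smulRightL ℝ V ℂ) (LinearMap.toContinuousLinearMap (b.coord i))
    have hfd : fderiv ℝ f = fun z => ∑ i, (ℓ i ∘ fun z => fderiv ℝ f z (b i)) z := by
      funext z
      ext m
      have hm := congrArg (fderiv ℝ f z) (b.sum_repr m)
      rw [map_sum] at hm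
      rw [← hm]
      simp [ℓ]
    have hg : ∀ i, _ := fun i => ih _ ((hd f hf).2 (b i))
    have hc : ∀ i, ContDiff ℝ n (ℓ i ∘ fun z => fderiv ℝ f z (b i)) := fun i =>
      (ℓ i).contDiff.comp (hg i).1
    constructor
    · push_cast
      rw [contDiff_succ_iff_fderiv]
      refine ⟨(hd f hf).1, by simp, ?_⟩
      rw [hfd]
      exact ContDiff.sum fun i _ => hc i
    · intro k
      choose C hC using fun i => (hg i).2 k
      refine ⟨∑ i, ‖ℓ i‖ * C i, fun z => ?_⟩
      rw [← norm_iteratedFDeriv_fderiv, hfd, iteratedFDeriv_sum fun i _ => hc i,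
        Finset.sum_apply]
      calc _ ≤ ‖z‖ ^ k * ∑ i, ‖iteratedFDeriv ℝ n (ℓ i ∘ fun z => fderiv ℝ f z (b i)) z‖ := by
            gcongr; exact norm_sum_le _ _
        _ = ∑ i, ‖z‖ ^ k * ‖iteratedFDeriv ℝ n (ℓ i ∘ fun z => fderiv ℝ f z (b i)) z‖ :=
            Finset.mul_sum _ _ _
        _ ≤ _ := by
            refine Finset.sum_le_sum fun i _ => ?_
            have h1 := (ℓ i).norm_iteratedFDeriv_comp_left (x := z) (hg i).1.contDiffAt le_rfl
            calc _ ≤ ‖z‖ ^ k * (‖ℓ i‖ * ‖iteratedFDeriv ℝ n (fun z => fderiv ℝ f z (b i)) z‖) := by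
                  gcongr
              _ = ‖ℓ i‖ * (‖z‖ ^ k * ‖iteratedFDeriv ℝ n (fun z => fderiv ℝ f z (b i)) z‖) := by
                  ring
              _ ≤ _ := by gcongr; exact hC i z

section

variable {d : ℕ}

/-- The phase of the complex conjugate of a time-frequency shift. -/
def phaseFactor (z : Phase d) (t : Conf d) : ℝ :=
  Real.pi * inner ℝ (pos z) (mom z) - 2 * Real.pi * inner ℝ (mom z) t

theorem star_tfShift (z : Phase d) (f : Conf d → ℂ) (t : Conf d) :
    star (tfShift z f t) = Complex.exp (phaseFactor z t * Complex.I) * star (f (t - (pos z))) := by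
  simp only [tfShift, phaseFactor, ← Complex.exp_add, star_mul', Complex.star_def,
    ← Complex.exp_conj]
  congr 2
  simp only [map_add, map_mul, Complex.conj_ofReal, Complex.conj_I, map_neg]
  push_cast
  ring

theorem norm_tfShift (z : Phase d) (f : Conf d → ℂ) (t : Conf d) :
    ‖tfShift z f t‖ = ‖f (t - (pos z))‖ := by
  rw [← norm_star, star_tfShift, norm_mul, Complex.norm_exp_ofReal_mul_I, norm_star, one_mul]

theorem continuous_star_tfShift (z : Phase d) (ψ : 𝓢(Conf d, ℂ)) :
    Continuous fun t => star (tfShift z ψ t) := by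
  simp only [star_tfShift, phaseFactor]
  have := ψ.continuous
  fun_prop

theorem integrable_amb (φ ψ : 𝓢(Conf d, ℂ)) (z : Phase d) :
    Integrable (fun t => φ t * star (tfShift z ψ t)) := by
  refine φ.integrable.mul_bdd (c := SchwartzMap.seminorm ℝ 0 0 ψ)
    (continuous_star_tfShift z ψ).aestronglyMeasurable (Filter.Eventually.of_forall fun t => ?_)
  rw [norm_star, norm_tfShift]
  exact SchwartzMap.norm_le_seminorm ℝ ψ _

/-- Multiplication of a Schwartz function by the linear function `t ↦ w·t`. -/
def mulCoord (w : Conf d) : 𝓢(Conf d, ℂ) →L[ℂ] 𝓢(Conf d, ℂ) :=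
  SchwartzMap.smulLeftCLM ℂ (fun t => ((inner ℝ w t : ℝ) : ℂ))

theorem mulCoord_apply (w : Conf d) (φ : 𝓢(Conf d, ℂ)) (t : Conf d) :
    mulCoord w φ t = ((inner ℝ w t : ℝ) : ℂ) * φ t := by
  rw [mulCoord, SchwartzMap.smulLeftCLM_apply_apply, smul_eq_mul]
  exact (Complex.ofRealCLM.comp (innerSL ℝ w)).hasTemperateGrowth

theorem amb_mul_fst (φ ψ : 𝓢(Conf d, ℂ)) (w : Conf d) (z : Phase d) :
    ((inner ℝ w (pos z) : ℝ) : ℂ) * ambiguityFun φ ψ z =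
      ambiguityFun (mulCoord w φ) ψ z - ambiguityFun φ (mulCoord w ψ) z := by
  simp only [ambiguityFun]
  rw [← integral_const_mul, ← integral_sub (integrable_amb _ _ z) (integrable_amb _ _ z)]
  congr 1
  funext t
  simp only [star_tfShift, mulCoord_apply, inner_sub_right]
  simp
  ring

open LineDeriv in
theorem amb_mul_snd (φ ψ : 𝓢(Conf d, ℂ)) (v : Conf d) (z : Phase d) :
    (2 * Real.pi * Complex.I) * ((inner ℝ v (mom z) : ℝ) : ℂ) * ambiguityFun φ ψ z =
      ambiguityFun (∂_{v} φ : 𝓢(Conf d, ℂ)) ψ z + ambiguityFun φ (∂_{v} ψ : 𝓢(Conf d, ℂ)) z := by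
  have h := integral_bilinear_hasLineDerivAt_right_eq_neg_left_of_integrable
    (μ := (volume : Measure (Conf d)))
    (f := φ) (f' := (∂_{v} φ : 𝓢(Conf d, ℂ)))
    (g := fun t => star (tfShift z ψ t))
    (g' := fun t => -(2 * Real.pi * Complex.I) * ((inner ℝ v (mom z) : ℝ) : ℂ) *
      star (tfShift z ψ t) + star (tfShift z (∂_{v} ψ : 𝓢(Conf d, ℂ)) t))
    (v := v) (B := ContinuousLinearMap.mul ℝ ℂ) (by simpa using integrable_amb (∂_{v} φ) ψ z)
    (by
      have := ((integrable_amb φ ψ z).const_mul 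
        (-(2 * Real.pi * Complex.I) * ((inner ℝ v (mom z) : ℝ) : ℂ))).add
          (integrable_amb φ (∂_{v} ψ) z)
      refine this.congr (Filter.Eventually.of_forall fun t => ?_)
      simp
      ring)
    (by simpa using integrable_amb φ ψ z)
    (fun t _ => by
      rw [SchwartzMap.lineDerivOp_apply_eq_fderiv]
      exact (φ.differentiableAt.hasFDerivAt).hasLineDerivAt v)
    (fun t _ => by
      simp only [star_tfShift, SchwartzMap.lineDerivOp_apply_eq_fderiv]
      have h1 : HasFDerivAt (fun t : Conf d => phaseFactor z t)
          (-((2 * Real.pi) • innerSL ℝ (mom z))) t := by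
        unfold phaseFactor
        have := ((innerSL ℝ (mom z)).hasFDerivAt (x := t)).const_smul (2 * Real.pi)
        simpa using (this.const_sub (Real.pi * inner ℝ (pos z) (mom z)))
      have h2 : HasFDerivAt (fun t : Conf d => ψ (t - (pos z))) (fderiv ℝ ψ (t - (pos z))) t := by
        exact ((ψ.differentiableAt (x := t - (pos z))).hasFDerivAt.comp t
          ((hasFDerivAt_id t).sub_const (pos z))).congr_fderiv (by ext; simp)
      have h3 := (((Complex.ofRealCLM.hasFDerivAt (x := phaseFactor z t)).comp t h1).mul_const
        Complex.I).cexp.mul h2.star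
      have h4 := h3.hasLineDerivAt v
      refine Eq.mp (congrArg (fun c => HasLineDerivAt ℝ _ c t v) ?_) h4
      simp [real_inner_comm v]
      ring)
  simp only [ContinuousLinearMap.mul_apply'] at h
  simp only [ambiguityFun]
  have h5 : ∫ t, φ t * (-(2 * Real.pi * Complex.I) * ((inner ℝ v (mom z) : ℝ) : ℂ) *
      star (tfShift z ψ t) + star (tfShift z (∂_{v} ψ : 𝓢(Conf d, ℂ)) t)) =
      -(2 * Real.pi * Complex.I) * ((inner ℝ v (mom z) : ℝ) : ℂ) *
        (∫ t, φ t * star (tfShift z ψ t)) +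
        ∫ t, φ t * star (tfShift z (∂_{v} ψ : 𝓢(Conf d, ℂ)) t) := by
    rw [← integral_const_mul, ← integral_add ((integrable_amb φ ψ z).const_mul _)
      (integrable_amb _ _ z)]
    congr 1
    funext t
    ring
  rw [h5] at h
  linear_combination -h

theorem amb_bound (φ ψ : 𝓢(Conf d, ℂ)) : ∃ C, ∀ z, ‖ambiguityFun φ ψ z‖ ≤ C := by
  refine ⟨∫ t, ‖φ t‖ * SchwartzMap.seminorm ℝ 0 0 ψ, fun z => ?_⟩
  refine (norm_integral_le_integral_norm _).trans
    (integral_mono (integrable_amb φ ψ z).norm (φ.integrable.norm.mul_const _) fun t => ?_)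
  simp only [norm_mul, norm_star, norm_tfShift]
  gcongr
  exact SchwartzMap.norm_le_seminorm ℝ ψ _

theorem norm_phase_le (z : Phase d) :
    ‖z‖ ≤ ∑ i, (|inner ℝ (EuclideanSpace.single i (1 : ℝ)) (pos z)| +
      |inner ℝ (EuclideanSpace.single i (1 : ℝ)) (mom z)|) := by
  have hE : ∀ x : Conf d, ‖x‖ ≤ ∑ i, |inner ℝ (EuclideanSpace.single i (1 : ℝ)) x| := by
    intro x
    calc ‖x‖ = ‖∑ i, x i • EuclideanSpace.single i (1 : ℝ)‖ := by
          congr 1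
          ext j
          simp [Pi.single_apply]
      _ ≤ ∑ i, ‖x i • EuclideanSpace.single i (1 : ℝ)‖ := norm_sum_le _ _
      _ = _ := by simp [norm_smul, EuclideanSpace.inner_single_left]
  rw [Finset.sum_add_distrib]
  refine le_trans ?_ (add_le_add (hE (pos z)) (hE (mom z)))
  have := norm_sq_phase z
  nlinarith [norm_nonneg z, norm_nonneg (pos z), norm_nonneg (mom z)]

open LineDeriv in
theorem amb_decay (k : ℕ) : ∀ φ ψ : 𝓢(Conf d, ℂ), ∃ C, ∀ z,
    ‖z‖ ^ k * ‖ambiguityFun φ ψ z‖ ≤ C := by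
  induction k with
  | zero => simpa using amb_bound
  | succ k ih =>
    intro φ ψ
    let e : Fin d → Conf d := fun i => EuclideanSpace.single i (1 : ℝ)
    choose C₁ h₁ using fun i => ih (mulCoord (e i) φ) ψ
    choose C₂ h₂ using fun i => ih φ (mulCoord (e i) ψ)
    choose C₃ h₃ using fun i => ih (∂_{e i} φ) ψ
    choose C₄ h₄ using fun i => ih φ (∂_{e i} ψ)
    refine ⟨∑ i, ((C₁ i + C₂ i) + (C₃ i + C₄ i)), fun z => ?_⟩
    have hx : ∀ i, ‖z‖ ^ k * (|inner ℝ (e i) (pos z)| * ‖ambiguityFun φ ψ z‖) ≤ C₁ i + C₂ i := by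
      intro i
      have h : |inner ℝ (e i) (pos z)| * ‖ambiguityFun φ ψ z‖ =
          ‖((inner ℝ (e i) (pos z) : ℝ) : ℂ) * ambiguityFun φ ψ z‖ := by simp
      rw [h, amb_mul_fst]
      calc _ ≤ ‖z‖ ^ k * (‖ambiguityFun (mulCoord (e i) φ) ψ z‖ +
            ‖ambiguityFun φ (mulCoord (e i) ψ) z‖) := by gcongr; exact norm_sub_le _ _
        _ ≤ _ := by rw [mul_add]; exact add_le_add (h₁ i z) (h₂ i z)
    have hξ : ∀ i, ‖z‖ ^ k * (|inner ℝ (e i) (mom z)| * ‖ambiguityFun φ ψ z‖) ≤ C₃ i + C₄ i := by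
      intro i
      have h : |inner ℝ (e i) (mom z)| * ‖ambiguityFun φ ψ z‖ ≤
          ‖(2 * Real.pi * Complex.I) * ((inner ℝ (e i) (mom z) : ℝ) : ℂ) * ambiguityFun φ ψ z‖ := by
        simp only [norm_mul, Complex.norm_real, Real.norm_eq_abs, Complex.norm_I,
          Complex.norm_ofNat, abs_of_pos Real.pi_pos, mul_one]
        have : 1 ≤ 2 * Real.pi := by linarith [Real.pi_gt_three]
        rw [mul_assoc]
        exact le_mul_of_one_le_left (by positivity) this
      rw [amb_mul_snd] at h
      calc _ ≤ ‖z‖ ^ k * (‖ambiguityFun (∂_{e i} φ : 𝓢(Conf d, ℂ)) ψ z‖ +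
            ‖ambiguityFun φ (∂_{e i} ψ : 𝓢(Conf d, ℂ)) z‖) := by
              gcongr; exact h.trans (norm_add_le _ _)
        _ ≤ _ := by rw [mul_add]; exact add_le_add (h₃ i z) (h₄ i z)
    calc ‖z‖ ^ (k + 1) * ‖ambiguityFun φ ψ z‖
        = ‖z‖ ^ k * ‖ambiguityFun φ ψ z‖ * ‖z‖ := by ring
      _ ≤ ‖z‖ ^ k * ‖ambiguityFun φ ψ z‖ * ∑ i, (|inner ℝ (e i) (pos z)| + |inner ℝ (e i) (mom z)|) := by
          gcongr; exact norm_phase_le z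
      _ = ∑ i, (‖z‖ ^ k * (|inner ℝ (e i) (pos z)| * ‖ambiguityFun φ ψ z‖) +
            ‖z‖ ^ k * (|inner ℝ (e i) (mom z)| * ‖ambiguityFun φ ψ z‖)) := by
          rw [Finset.mul_sum]; congr 1; funext i; ring
      _ ≤ _ := Finset.sum_le_sum fun i _ => add_le_add (hx i) (hξ i)

/-- The derivative in `z` of the phase factor. -/
def dPhase (z : Phase d) (t : Conf d) : Phase d →L[ℝ] ℝ :=
  Real.pi • ((innerSL ℝ (pos z)).comp mom +
    (innerSL ℝ (mom z)).comp pos) -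
  (2 * Real.pi) • (innerSL ℝ t).comp mom

theorem hasFDerivAt_phaseFactor (z : Phase d) (t : Conf d) :
    HasFDerivAt (fun z => phaseFactor z t) (dPhase z t) z := by
  unfold phaseFactor dPhase
  have hf := pos.hasFDerivAt (x := z)
  have hs := mom.hasFDerivAt (x := z)
  have h1 := (hf.inner ℝ hs).const_smul Real.pi
  have h2 := (((innerSL ℝ t).hasFDerivAt (x := (mom z))).comp z hs).const_smul (2 * Real.pi)
  have e : (fun z : Phase d => Real.pi * inner ℝ (pos z) (mom z) - 2 * Real.pi * inner ℝ (mom z) t) =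
      fun z : Phase d => Real.pi • (inner ℝ (pos z)
        (mom z) : ℝ) - (2 * Real.pi) • innerSL ℝ t (mom z) := by
    funext z
    simp [real_inner_comm t]
  rw [e]
  refine (h1.sub h2).congr_fderiv ?_
  ext m
  simp [real_inner_comm (mom z)]
  ring

/-- The derivative in `z` of the integrand of the cross-ambiguity function. -/
def dAmb (φ ψ : 𝓢(Conf d, ℂ)) (z : Phase d) (t : Conf d) : Phase d →L[ℝ] ℂ :=
  φ t • ((Complex.exp (phaseFactor z t * Complex.I) * star (ψ (t - (pos z)))) •
      (Complex.I • (Complex.ofRealCLM.comp (dPhase z t))) -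
    Complex.exp (phaseFactor z t * Complex.I) •
      ((Complex.conjCLE : ℂ →L[ℝ] ℂ).comp ((fderiv ℝ ψ (t - (pos z))).comp
        pos)))

theorem hasFDerivAt_integrand (φ ψ : 𝓢(Conf d, ℂ)) (z : Phase d) (t : Conf d) :
    HasFDerivAt (fun z => φ t * star (tfShift z ψ t)) (dAmb φ ψ z t) z := by
  simp only [star_tfShift]
  have hf := pos.hasFDerivAt (x := z)
  have h2 : HasFDerivAt (fun z : Phase d => ψ (t - (pos z))) _ z :=
    (ψ.differentiableAt (x := t - (pos z))).hasFDerivAt.comp z (hf.const_sub t)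
  have h3 := ((((Complex.ofRealCLM.hasFDerivAt (x := phaseFactor z t)).comp z
    (hasFDerivAt_phaseFactor z t)).mul_const Complex.I).cexp.mul h2.star).const_mul (φ t)
  refine h3.congr_fderiv ?_
  ext m
  simp [dAmb]
  ring

theorem continuous_dAmb (φ ψ : 𝓢(Conf d, ℂ)) (z : Phase d) :
    Continuous fun t => dAmb φ ψ z t := by
  have h1 := φ.continuous
  have h2 := ψ.continuous
  have h3 : Continuous (fderiv ℝ ψ) := (ψ.smooth 1).continuous_fderiv (by simp)
  have h4 : Continuous fun t : Conf d => dPhase z t := by unfold dPhase; fun_prop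
  have h5 : Continuous fun t : Conf d => phaseFactor z t := by unfold phaseFactor; fun_prop
  have h6 : Continuous fun t : Conf d => fderiv ℝ ψ (t - (pos z)) := by fun_prop
  unfold dAmb
  fun_prop

theorem norm_dPhase_le (z : Phase d) (t : Conf d) :
    ‖dPhase z t‖ ≤ 2 * Real.pi * (‖z‖ + ‖t‖) := by
  refine ContinuousLinearMap.opNorm_le_bound _ (by positivity) fun m => ?_
  have hf := norm_pos_le z
  have hs := norm_mom_le z
  have hmf := norm_pos_le m
  have hms := norm_mom_le m
  have e : dPhase z t m = Real.pi * (inner ℝ (pos z) (mom m) + inner ℝ (mom z) (pos m)) -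
      2 * Real.pi * inner ℝ t (mom m) := by simp [dPhase]; ring
  have h1 : |inner ℝ (pos z) (mom m)| ≤ ‖z‖ * ‖m‖ := (abs_real_inner_le_norm _ _).trans (by gcongr)
  have h2 : |inner ℝ (mom z) (pos m)| ≤ ‖z‖ * ‖m‖ := (abs_real_inner_le_norm _ _).trans (by gcongr)
  have h3 : |inner ℝ t (mom m)| ≤ ‖t‖ * ‖m‖ := (abs_real_inner_le_norm _ _).trans (by gcongr)
  rw [e, Real.norm_eq_abs]
  calc _ ≤ Real.pi * (|inner ℝ (pos z) (mom m)| + |inner ℝ (mom z) (pos m)|) +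
        2 * Real.pi * |inner ℝ t (mom m)| := by
        refine (abs_sub _ _).trans (add_le_add ?_ ?_)
        · rw [abs_mul, abs_of_pos Real.pi_pos]
          gcongr
          exact abs_add_le _ _
        · rw [abs_mul, abs_of_pos (by positivity)]
    _ ≤ Real.pi * (‖z‖ * ‖m‖ + ‖z‖ * ‖m‖) + 2 * Real.pi * (‖t‖ * ‖m‖) := by gcongr
    _ = _ := by ring

theorem norm_fderiv_le (ψ : 𝓢(Conf d, ℂ)) : ∃ C, 0 ≤ C ∧ ∀ t, ‖fderiv ℝ ψ t‖ ≤ C := by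
  obtain ⟨C, hC, h⟩ := ψ.decay 0 1
  refine ⟨C, hC.le, fun t => ?_⟩
  have := h t
  rw [← norm_iteratedFDeriv_fderiv (n := 0), norm_iteratedFDeriv_zero] at this
  simpa using this

theorem norm_dAmb_le (φ ψ : 𝓢(Conf d, ℂ)) : ∃ A B, 0 ≤ A ∧ 0 ≤ B ∧ ∀ z t,
    ‖dAmb φ ψ z t‖ ≤ ‖φ t‖ * (A * (2 * Real.pi * (‖z‖ + ‖t‖)) + B) := by
  obtain ⟨B, hB, hB'⟩ := norm_fderiv_le ψ
  refine ⟨SchwartzMap.seminorm ℝ 0 0 ψ, B, by positivity, hB, fun z t => ?_⟩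
  refine ContinuousLinearMap.opNorm_le_bound _ (by positivity) fun m => ?_
  have e : dAmb φ ψ z t m = φ t * (Complex.exp (phaseFactor z t * Complex.I) *
      star (ψ (t - (pos z))) * (Complex.I * (dPhase z t m : ℝ)) -
      Complex.exp (phaseFactor z t * Complex.I) * star (fderiv ℝ ψ (t - (pos z)) (pos m))) := by
    simp [dAmb]
  rw [e, norm_mul, mul_assoc ‖φ t‖]
  gcongr
  refine (norm_sub_le _ _).trans ?_
  rw [add_mul]
  refine add_le_add ?_ ?_
  · simp only [norm_mul, Complex.norm_exp_ofReal_mul_I, norm_star, Complex.norm_I, one_mul,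
      Complex.norm_real]
    rw [mul_assoc]
    gcongr
    · exact SchwartzMap.norm_le_seminorm ℝ ψ _
    · exact (ContinuousLinearMap.le_opNorm _ _).trans (by gcongr; exact norm_dPhase_le z t)
  · simp only [norm_mul, Complex.norm_exp_ofReal_mul_I, norm_star, one_mul]
    refine (ContinuousLinearMap.le_opNorm _ _).trans ?_
    gcongr
    · exact hB' _
    · exact norm_pos_le m

theorem hasFDerivAt_amb (φ ψ : 𝓢(Conf d, ℂ)) (z : Phase d) :
    Integrable (fun t => dAmb φ ψ z t) ∧
      HasFDerivAt (ambiguityFun φ ψ) (∫ t, dAmb φ ψ z t) z := by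
  obtain ⟨A, B, hA, hB, hAB⟩ := norm_dAmb_le φ ψ
  let bound : Conf d → ℝ := fun t =>
    (A * (2 * Real.pi * (‖z‖ + 1)) + B) * ‖φ t‖ + A * (2 * Real.pi) * (‖t‖ ^ 1 * ‖φ t‖)
  have hbi : Integrable bound :=
    (φ.integrable.norm.const_mul _).add ((φ.integrable_pow_mul volume 1).const_mul _)
  have hb : ∀ y ∈ Metric.ball z 1, ∀ t, ‖dAmb φ ψ y t‖ ≤ bound t := by
    intro y hy t
    have hyz : ‖y‖ ≤ ‖z‖ + 1 := by
      rw [Metric.mem_ball, dist_eq_norm] at hy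
      have := norm_add_le z (y - z)
      rw [add_sub_cancel] at this
      linarith
    refine (hAB y t).trans ?_
    calc _ ≤ ‖φ t‖ * (A * (2 * Real.pi * ((‖z‖ + 1) + ‖t‖)) + B) := by gcongr
      _ = bound t := by simp only [bound]; ring
  refine ⟨hbi.mono' (continuous_dAmb φ ψ z).aestronglyMeasurable
    (Filter.Eventually.of_forall (hb z (Metric.mem_ball_self one_pos))), ?_⟩
  exact hasFDerivAt_integral_of_dominated_of_fderiv_le (Metric.ball_mem_nhds z one_pos)
    (Filter.Eventually.of_forall fun y => (integrable_amb φ ψ y).aestronglyMeasurable)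
    (integrable_amb φ ψ z) (continuous_dAmb φ ψ z).aestronglyMeasurable
    (Filter.Eventually.of_forall fun t y hy => hb y hy t) hbi
    (Filter.Eventually.of_forall fun t y _ => hasFDerivAt_integrand φ ψ y t)

open LineDeriv in
theorem dAmb_apply (φ ψ : 𝓢(Conf d, ℂ)) (z m : Phase d) (t : Conf d) :
    dAmb φ ψ z t m =
      Real.pi * Complex.I * ((inner ℝ (pos m) (mom z) : ℝ) : ℂ) * (φ t * star (tfShift z ψ t)) +
      (Real.pi * Complex.I * ((inner ℝ (mom m) (pos z) : ℝ) : ℂ) * (φ t * star (tfShift z ψ t)) +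
      ((-2 * Real.pi * Complex.I) * (mulCoord (mom m) φ t * star (tfShift z ψ t)) +
      (-1) * (φ t * star (tfShift z (∂_{(pos m)} ψ : 𝓢(Conf d, ℂ)) t)))) := by
  simp only [star_tfShift, mulCoord_apply, SchwartzMap.lineDerivOp_apply_eq_fderiv]
  simp [dAmb, dPhase, real_inner_comm (pos m), real_inner_comm (mom m)]
  ring

open LineDeriv in
theorem fderiv_amb (φ ψ : 𝓢(Conf d, ℂ)) (m : Phase d) (z : Phase d) :
    fderiv ℝ (ambiguityFun φ ψ) z m =
      (1 / 2 : ℂ) * ambiguityFun (∂_{(pos m)} φ : 𝓢(Conf d, ℂ)) ψ z +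
      (-1 / 2 : ℂ) * ambiguityFun φ (∂_{(pos m)} ψ : 𝓢(Conf d, ℂ)) z +
      (-Real.pi * Complex.I) * ambiguityFun (mulCoord (mom m) φ) ψ z +
      (-Real.pi * Complex.I) * ambiguityFun φ (mulCoord (mom m) ψ) z := by
  obtain ⟨hi, hd⟩ := hasFDerivAt_amb φ ψ z
  have hint : (∫ t, dAmb φ ψ z t) m = ∫ t, dAmb φ ψ z t m :=
    integral_clm_apply _ hi m
  refine (fderiv_apply_eq hd m).trans (hint.trans ?_)
  simp_rw [dAmb_apply]
  have i1 := integrable_amb φ ψ z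
  have i2 := integrable_amb (mulCoord (mom m) φ) ψ z
  have i3 := integrable_amb φ (∂_{(pos m)} ψ) z
  rw [integral_comb i1 i1 i2 i3]
  have h1 := amb_mul_fst φ ψ (mom m) z
  have h2 := amb_mul_snd φ ψ (pos m) z
  simp only [ambiguityFun] at h1 h2 ⊢
  linear_combination (1 / 2 : ℂ) * h2 + Real.pi * Complex.I * h1

theorem ambiguityFun_schwartz (φ ψ : 𝓢(Conf d, ℂ)) (n : ℕ) :
    ContDiff ℝ n (ambiguityFun φ ψ) ∧
      ∀ k : ℕ, ∃ C, ∀ z, ‖z‖ ^ k * ‖iteratedFDeriv ℝ n (ambiguityFun φ ψ) z‖ ≤ C := by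
  let G : Set (Phase d → ℂ) :=
    {f | ∃ φ ψ : 𝓢(Conf d, ℂ), f = ambiguityFun φ ψ}
  have hG : ∀ φ ψ : 𝓢(Conf d, ℂ), ambiguityFun φ ψ ∈ Submodule.span ℂ G :=
    fun φ ψ => Submodule.subset_span ⟨φ, ψ, rfl⟩
  refine schwartz_of_submodule (Submodule.span ℂ G) ?_ ?_ n _ (hG φ ψ)
  · intro f hf k
    induction hf using Submodule.span_induction with
    | mem f hf => obtain ⟨φ, ψ, rfl⟩ := hf; exact amb_decay k φ ψ
    | zero => exact ⟨0, by simp⟩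
    | add f g _ _ hf hg =>
      obtain ⟨A, hA⟩ := hf
      obtain ⟨B, hB⟩ := hg
      refine ⟨A + B, fun z => ?_⟩
      calc _ ≤ ‖z‖ ^ k * (‖f z‖ + ‖g z‖) := by gcongr; exact norm_add_le _ _
        _ ≤ _ := by rw [mul_add]; exact add_le_add (hA z) (hB z)
    | smul c f _ hf =>
      obtain ⟨A, hA⟩ := hf
      refine ⟨‖c‖ * A, fun z => ?_⟩
      calc _ = ‖c‖ * (‖z‖ ^ k * ‖f z‖) := by simp; ring
        _ ≤ _ := by gcongr; exact hA z
  · intro f hf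
    induction hf using Submodule.span_induction with
    | mem f hf =>
      obtain ⟨φ, ψ, rfl⟩ := hf
      refine ⟨fun z => (hasFDerivAt_amb φ ψ z).2.differentiableAt, fun m => ?_⟩
      have h := Submodule.add_mem _ (Submodule.add_mem _ (Submodule.add_mem _
        (Submodule.smul_mem _ (1 / 2 : ℂ) (hG (LineDeriv.lineDerivOp (pos m) φ) ψ))
        (Submodule.smul_mem _ (-1 / 2 : ℂ) (hG φ (LineDeriv.lineDerivOp (pos m) ψ))))
        (Submodule.smul_mem _ (-Real.pi * Complex.I) (hG (mulCoord (mom m) φ) ψ)))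
        (Submodule.smul_mem _ (-Real.pi * Complex.I) (hG φ (mulCoord (mom m) ψ)))
      convert h using 1
      funext z
      simp only [fderiv_amb, Pi.add_apply, Pi.smul_apply, smul_eq_mul]
    | zero => exact ⟨differentiable_const 0, fun m => by
        convert Submodule.zero_mem _ using 1
        funext z
        simp⟩
    | add f g _ _ hf hg =>
      refine ⟨hf.1.add hg.1, fun m => ?_⟩
      convert Submodule.add_mem _ (hf.2 m) (hg.2 m) using 1
      funext z
      simp [fderiv_add (hf.1 z) (hg.1 z)]
    | smul c f _ hf =>
      refine ⟨hf.1.const_smul c, fun m => ?_⟩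
      convert Submodule.smul_mem _ c (hf.2 m) using 1
      funext z
      simp [fderiv_const_smul (hf.1 z)]

/-- The cross-ambiguity function of two Schwartz functions, as a Schwartz function on phase
space. -/
def ambiguity (φ ψ : 𝓢(Conf d, ℂ)) : 𝓢(Phase d, ℂ) where
  toFun := ambiguityFun φ ψ
  smooth' := contDiff_infty.2 fun n => (ambiguityFun_schwartz φ ψ n).1
  decay' := fun k n => (ambiguityFun_schwartz φ ψ n).2 k

/-! ### Tempered distributions and the symplectic Fourier transform -/

/-- Complex conjugation of Schwartz functions. -/
def conjS {V : Type*} [NormedAddCommGroup V] [NormedSpace ℝ V] : 𝓢(V, ℂ) →L[ℝ] 𝓢(V, ℂ) :=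
  SchwartzMap.postcompCLM (Complex.conjCLE : ℂ →L[ℝ] ℂ)

/-- The sesquilinear dual pairing `⟨τ, ψ⟩ = τ(conj ψ)` of tempered distributions and Schwartz
functions. -/
def pairing {V : Type*} [NormedAddCommGroup V] [NormedSpace ℝ V] (τ : 𝓢'(V, ℂ)) (ψ : 𝓢(V, ℂ)) : ℂ :=
  τ (conjS ψ)

/-- The symplectic form `σ((x, ξ), (x', ξ')) = x'·ξ - x·ξ'`. -/
def sympForm (z w : Phase d) : ℝ := inner ℝ (pos w) (mom z) - inner ℝ (pos z) (mom w)

/-- The linear isomorphism `(x, ξ) ↦ (ξ, -x)`, for which `σ(z, w) = (J z)·w`. -/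
def sympJ : Phase d ≃L[ℝ] Phase d :=
  LinearEquiv.toContinuousLinearEquiv
    { toFun := fun z => WithLp.toLp 2 (Sum.elim (fun i => z (Sum.inr i)) fun i => -z (Sum.inl i))
      invFun := fun z => WithLp.toLp 2 (Sum.elim (fun i => -z (Sum.inr i)) fun i => z (Sum.inl i))
      map_add' := fun z w => by ext i; cases i <;> simp [add_comm]
      map_smul' := fun c z => by ext i; cases i <;> simp
      left_inv := fun z => by ext i; cases i <;> simp
      right_inv := fun z => by ext i; cases i <;> simp }

theorem inner_sympJ (z w : Phase d) : inner ℝ w (sympJ z) = sympForm z w := by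
  simp [sympJ, sympForm, PiLp.inner_apply, pos_apply, mom_apply, mul_comm, sub_eq_add_neg]

/-- The symplectic Fourier transform on Schwartz functions; its defining integral is
`sympFourier_apply`. -/
def sympFourier : 𝓢(Phase d, ℂ) →L[ℂ] 𝓢(Phase d, ℂ) :=
  (SchwartzMap.compCLMOfContinuousLinearEquiv ℂ sympJ).comp
    (FourierTransform.fourierCLM ℂ 𝓢(Phase d, ℂ))

theorem sympFourier_apply (φ : 𝓢(Phase d, ℂ)) (ζ : Phase d) :
    sympFourier φ ζ =
      ∫ z, Complex.exp ((-2 * Real.pi * sympForm ζ z : ℝ) * Complex.I) * φ z := by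
  simp only [sympFourier, ContinuousLinearMap.comp_apply,
    SchwartzMap.compCLMOfContinuousLinearEquiv_apply, Function.comp,
    FourierTransform.fourierCLM_apply, SchwartzMap.fourier_coe, Real.fourier_eq',
    inner_sympJ, smul_eq_mul]

/-- The symplectic Fourier transform on tempered distributions,
`(F_σ τ)(φ) = τ(z ↦ (F_σ φ)(-z))`; equivalently, by `pairing_sympFourierDist`,
`⟨F_σ τ, ψ⟩ = ⟨τ, F_σ ψ⟩` for the sesquilinear pairing. -/
def sympFourierDist : 𝓢'(Phase d, ℂ) →L[ℂ] 𝓢'(Phase d, ℂ) :=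
  PointwiseConvergenceCLM.precomp ℂ
    ((SchwartzMap.compCLMOfContinuousLinearEquiv ℂ (ContinuousLinearEquiv.neg ℝ)).comp sympFourier)

theorem pairing_sympFourierDist (τ : 𝓢'(Phase d, ℂ)) (ψ : 𝓢(Phase d, ℂ)) :
    pairing (sympFourierDist τ) ψ = pairing τ (sympFourier ψ) := by
  have h : SchwartzMap.compCLMOfContinuousLinearEquiv ℂ (ContinuousLinearEquiv.neg ℝ)
      (sympFourier (conjS ψ)) = conjS (sympFourier ψ) := by
    ext z
    simp only [SchwartzMap.compCLMOfContinuousLinearEquiv_apply, Function.comp, conjS,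
      SchwartzMap.postcompCLM_apply, sympFourier_apply, ContinuousLinearEquiv.neg_apply]
    simp only [ContinuousLinearEquiv.coe_coe, Complex.conjCLE_apply]
    rw [← integral_conj]
    congr 1
    funext w
    rw [map_mul, ← Complex.exp_conj]
    congr 2
    rw [map_mul, Complex.conj_ofReal, Complex.conj_I]
    simp only [sympForm, map_neg, inner_neg_left, inner_neg_right]
    push_cast
    ring
  exact congrArg τ h

/-- The `L^p` norm of a tempered distribution on phase space: the `L^p` norm of the function that
represents it, and `∞` if it is not represented by a function in `L^p`. -/
def lpENorm (p : ℝ≥0∞) (u : 𝓢'(Phase d, ℂ)) : ℝ≥0∞ :=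
  ⨅ (g : Phase d → ℂ) (_ : MemLp g p volume ∧ ∀ φ : 𝓢(Phase d, ℂ), u φ = ∫ z, φ z * g z),
    eLpNorm g p volume

/-! ### Schatten classes and the Fourier-Wigner transform -/

/-- The `ℓ^q` norm of a family of extended non-negative numbers. -/
def lqENorm {ι : Type*} (q : ℝ≥0∞) (a : ι → ℝ≥0∞) : ℝ≥0∞ :=
  if q = ∞ then ⨆ i, a i else (∑' i, a i ^ q.toReal) ^ (1 / q.toReal)

/-- A singular value decomposition `T = ∑ₙ sₙ eₙ ⊗ ηₙ`, where `(e ⊗ η) f = ⟨f, η⟩ e`, with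
`sₙ ≥ 0`, `sₙ → 0` and orthonormal families. The vectors that belong to `sₙ = 0` play no role and
are not constrained, so that operators on a finite-dimensional space are covered too. -/
structure IsSVD {H : Type*} [NormedAddCommGroup H] [InnerProductSpace ℂ H]
    (T : H →L[ℂ] H) (s : ℕ → ℝ) (e η : ℕ → H) : Prop where
  nonneg : ∀ n, 0 ≤ s n
  tendsto_zero : Tendsto s atTop (nhds 0)
  orthonormal_left : Orthonormal ℂ fun n : {n // s n ≠ 0} => e n
  orthonormal_right : Orthonormal ℂ fun n : {n // s n ≠ 0} => η n
  hasSum : ∀ f, HasSum (fun n => ((s n : ℂ) * inner ℂ (η n) f) • e n) (T f)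

/-- The Schatten norm of a bounded operator: the `ℓ^p` norm of the singular values for `p < ∞`
(`∞` for an operator without a singular value decomposition, that is, a non-compact one), and the
operator norm for `p = ∞`. All decompositions of `T` have the same singular values up to order and
zeros, so that the infimum is over a single value. -/
def schattenENorm {H : Type*} [NormedAddCommGroup H] [InnerProductSpace ℂ H]
    (p : ℝ≥0∞) (T : H →L[ℂ] H) : ℝ≥0∞ :=
  if p = ∞ then ‖T‖ₑ
  else ⨅ (s : ℕ → ℝ) (e : ℕ → H) (η : ℕ → H) (_ : IsSVD T s e η),
    lqENorm p fun n => ENNReal.ofReal (s n)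

/-- The Hilbert space `L²(ℝ^d)`. -/
abbrev L2 (d : ℕ) : Type := Lp ℂ 2 (volume : Measure (Conf d))

/-- The continuous linear operators from Schwartz functions to tempered distributions, with the
topology of pointwise convergence (so `Tᵢ → T` iff `⟨Tᵢ ψ, φ⟩ → ⟨T ψ, φ⟩` for all `ψ`, `φ`). -/
abbrev SchwartzOp (d : ℕ) : Type := 𝓢(Conf d, ℂ) →Lₚₜ[ℂ] 𝓢'(Conf d, ℂ)

/-- `T` is the restriction to Schwartz functions of the bounded operator `B` on `L²(ℝ^d)`. -/
def IsRestriction (T : SchwartzOp d) (B : L2 d →L[ℂ] L2 d) : Prop :=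
  ∀ ψ φ : 𝓢(Conf d, ℂ), pairing (T ψ) φ = inner ℂ (φ.toLp 2) (B (ψ.toLp 2))

/-- The Schatten norm of a continuous operator from Schwartz functions to tempered distributions:
that of its bounded extension to `L²(ℝ^d)`, and `∞` if there is none. -/
def opENorm (p : ℝ≥0∞) (T : SchwartzOp d) : ℝ≥0∞ :=
  ⨅ (B : L2 d →L[ℂ] L2 d) (_ : IsRestriction T B), schattenENorm p B

/-- `τ` is the Fourier-Wigner transform of `T`: `⟨T, S⟩ = ⟨τ, F_W(S)⟩` for the rank-one operators
`S = φ ⊗ ψ`, for which `⟨T, S⟩ = ⟨T ψ, φ⟩` and `F_W(S) = A(φ, ψ)`. Their span is dense, so this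
determines `τ`. -/
def IsFourierWigner (T : SchwartzOp d) (τ : 𝓢'(Phase d, ℂ)) : Prop :=
  ∀ ψ φ : 𝓢(Conf d, ℂ), pairing (T ψ) φ = pairing τ (ambiguity φ ψ)

/-! ### Decoupling constants -/

/-- The classical decoupling constant for `ℓ^q L^p` decoupling of a partition: the smallest `D`
with `‖∑ f_θ‖_{L^p} ≤ D (∑ ‖f_θ‖_{L^p}^q)^{1/q}` whenever `supp F_σ(f_θ) ⊆ θ`. The sum over a
possibly infinite partition converges unconditionally in the tempered distributions. -/
def classicalConst {Ω : Set (Phase d)} (P : Partition Ω) (p q : ℝ≥0∞) : ℝ≥0∞ :=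
  sInf {D | ∀ (f : P.parts → 𝓢'(Phase d, ℂ)) (u : 𝓢'(Phase d, ℂ)),
    (∀ θ : P.parts, Distribution.dsupport (sympFourierDist (f θ)) ⊆ (θ : Set (Phase d))) →
    HasSum f u → lpENorm p u ≤ D * lqENorm q fun θ => lpENorm p (f θ)}

/-- The quantum decoupling constant for `ℓ^q S^p` decoupling of a partition: the smallest `D` with
`‖∑ T_θ‖_{S^p} ≤ D (∑ ‖T_θ‖_{S^p}^q)^{1/q}` whenever `supp F_W(T_θ) ⊆ θ`. The sum over a possibly
infinite partition converges unconditionally in the operators from Schwartz functions to tempered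
distributions. -/
def quantumConst {Ω : Set (Phase d)} (P : Partition Ω) (p q : ℝ≥0∞) : ℝ≥0∞ :=
  sInf {D | ∀ (T : P.parts → SchwartzOp d) (S : SchwartzOp d),
    (∀ θ : P.parts, ∃ τ, IsFourierWigner (T θ) τ ∧
      Distribution.dsupport τ ⊆ (θ : Set (Phase d))) →
    HasSum T S → opENorm p S ≤ D * lqENorm q fun θ => opENorm p (T θ)}

end
end QuantumDecoupling

end

/-!
The comparison rests on two maps between functions on phase space and operators, built from the
coherent states `coh z = ρ(z)γ` of the normalized Gaussian window `γ`: the Berezin symbol `berezin B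
z = ⟨B coh z, coh z⟩` of an operator `B`, and the Toeplitz operator `∫ f(z) ⟨·, coh z⟩ coh z dz`
with symbol `f`. Both are contractions between `L^p` and the Schatten class for all `1 ≤ p ≤ ∞`
(`eLpNorm_berezin_le`, `IsToeplitz.schattenENorm_le`): by Bessel's inequality and the frame bound
`lintegral_inner_coh_le`, which comes from Moyal's identity, the values of the symbol and the
singular values of the operator are averages of each other, with weights of mass at most one, so
that Jensen's inequality applies.

On the Fourier side both maps multiply by the same Gaussian `gaussPhase`, the ambiguity function of
the window: the Berezin symbol has the symplectic Fourier transform `gaussPhase · F_W(B)`, and the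
Toeplitz operator has the Fourier-Wigner transform `gaussPhase · F_σ(f)`
(`sympFourierDist_gaussPhase_mul_apply`, `IsToeplitz.isRestriction`). In particular, both maps
preserve the condition that the transform is supported in `θ`. On the bounded set `Ω` the Gaussian
is bounded below, so there is a Schwartz function `m` with `gaussPhase · m · gaussPhase = 1` near
`Ω` (`exists_invertsGaussOn`), and multiplication by `m` on the Fourier side costs at most the
factor `C = max 1 ‖F_σ m‖₁` in `L^p`, by Young's inequality (`lpENorm_sympFourierDist_mul_le`).

Given functions `f_θ`, quantum decoupling of their Toeplitz operators bounds the operator of the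
sum, hence its Berezin symbol, from which `∑ f_θ` is recovered by the multiplier `m`; this is
`classicalConst_le`. Given operators `T_θ`, classical decoupling of their Berezin symbols bounds the
symbol of a sum, and the multiplier `m` turns it into the Toeplitz symbol of that sum. The Berezin
symbol of an operator is only available when the operator is bounded, which is not known beforehand
for an infinite sum. The argument is therefore applied to finite partial sums, and a form of Fatou's
lemma carries the bound over to the limit (`opENorm_le_of_tendsto`); this gives `quantumConst_le`.
-/

noncomputable section
namespace QuantumDecoupling

/-! ### Jensen's inequality with a weight -/

theorem one_le_toReal {p : ℝ≥0∞} (hp : 1 ≤ p) (hpt : p ≠ ∞) : 1 ≤ p.toReal := by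
  rw [← ENNReal.toReal_one]
  exact (ENNReal.toReal_le_toReal ENNReal.one_ne_top hpt).2 hp

/-- Jensen's inequality for the measure with density `w`, which need not have mass one. -/
theorem lintegral_mul_rpow_le {X : Type*} [MeasurableSpace X] {μ : Measure X} {a w : X → ℝ≥0∞}
    (ha : AEMeasurable a μ) (hw : AEMeasurable w μ) {p : ℝ} (hp : 1 ≤ p) :
    (∫⁻ x, a x * w x ∂μ) ^ p ≤ (∫⁻ x, a x ^ p * w x ∂μ) * (∫⁻ x, w x ∂μ) ^ (p - 1) := by
  rcases hp.eq_or_lt with rfl | hp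
  · simp
  have hpq := Real.HolderConjugate.conjExponent hp
  set q := Real.conjExponent p
  have hp0 : 0 < p := by linarith
  have hsplit : ∀ x, a x * w x = (a x * w x ^ (1 / p)) * w x ^ (1 / q) := by
    intro x
    rw [mul_assoc, ← ENNReal.rpow_add_of_nonneg _ _ (by positivity) hpq.symm.one_div_nonneg]
    have : 1 / p + 1 / q = 1 := by simpa using hpq.inv_add_inv_eq_one
    rw [this, ENNReal.rpow_one]
  have h := ENNReal.lintegral_mul_le_Lp_mul_Lq μ hpq
    (f := fun x => a x * w x ^ (1 / p)) (g := fun x => w x ^ (1 / q))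
    (ha.mul (hw.pow_const _)) (hw.pow_const _)
  have h1 : ∀ x, (a x * w x ^ (1 / p)) ^ p = a x ^ p * w x := by
    intro x
    rw [ENNReal.mul_rpow_of_nonneg _ _ hp0.le, ← ENNReal.rpow_mul, one_div_mul_cancel hp0.ne',
      ENNReal.rpow_one]
  have h2 : ∀ x, (w x ^ (1 / q)) ^ q = w x := by
    intro x
    rw [← ENNReal.rpow_mul, one_div_mul_cancel hpq.symm.ne_zero, ENNReal.rpow_one]
  simp only [Pi.mul_apply, ← hsplit, h1, h2] at h
  calc (∫⁻ x, a x * w x ∂μ) ^ p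
      ≤ ((∫⁻ x, a x ^ p * w x ∂μ) ^ (1 / p) * (∫⁻ x, w x ∂μ) ^ (1 / q)) ^ p := by gcongr
    _ = _ := by
        rw [ENNReal.mul_rpow_of_nonneg _ _ hp0.le, ← ENNReal.rpow_mul, ← ENNReal.rpow_mul,
          one_div_mul_cancel hp0.ne', ENNReal.rpow_one]
        congr 2
        have := hpq.sub_one_mul_conj
        field_simp [hpq.symm.ne_zero]
        linarith

theorem tsum_mul_rpow_le {ι : Type*} (a w : ι → ℝ≥0∞) {p : ℝ} (hp : 1 ≤ p) :
    (∑' i, a i * w i) ^ p ≤ (∑' i, a i ^ p * w i) * (∑' i, w i) ^ (p - 1) := by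
  let _ : MeasurableSpace ι := ⊤
  have h := lintegral_mul_rpow_le (μ := Measure.count) (a := a) (w := w)
    (measurable_from_top).aemeasurable (measurable_from_top).aemeasurable hp
  simpa only [lintegral_count] using h

/-! ### Tempered distributions commute with integrals of Schwartz functions -/

section Exchange

variable {E Z : Type*} [NormedAddCommGroup E] [NormedSpace ℝ E] [TopologicalSpace Z]

/-- Bounded continuous functions with values in a normed space. Going through the normed structure
of `Y` lets the instances on the codomain be found when `Y` is a space of multilinear maps. -/
abbrev BddCont (E Y : Type*) [NormedAddCommGroup E] [NormedAddCommGroup Y] :=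
  BoundedContinuousFunction E Y

/-- The bounded function `x ↦ ‖x‖ ^ k D ^ n φ(x)`. -/
def weightedDerivFun (i : ℕ × ℕ) (φ : 𝓢(E, ℂ)) :
    BddCont E (E [×i.2]→L[ℝ] ℂ) :=
  BoundedContinuousFunction.ofNormedAddCommGroup
    (fun x : E => ‖x‖ ^ i.1 • iteratedFDeriv ℝ i.2 φ x)
    (by
      have := (φ.smooth i.2).continuous_iteratedFDeriv (m := i.2) le_rfl
      fun_prop)
    (SchwartzMap.seminorm ℂ i.1 i.2 φ)
    (fun x => by
      rw [norm_smul, norm_pow, norm_norm]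
      exact SchwartzMap.le_seminorm ℂ i.1 i.2 φ x)

theorem weightedDerivFun_apply (i : ℕ × ℕ) (φ : 𝓢(E, ℂ)) (x : E) :
    weightedDerivFun i φ x = ‖x‖ ^ i.1 • iteratedFDeriv ℝ i.2 φ x := rfl

theorem norm_weightedDerivFun_le (i : ℕ × ℕ) (φ : 𝓢(E, ℂ)) :
    ‖weightedDerivFun i φ‖ ≤ SchwartzMap.seminorm ℂ i.1 i.2 φ :=
  BoundedContinuousFunction.norm_ofNormedAddCommGroup_le _ (apply_nonneg _ _) _

theorem seminorm_le_norm_weightedDerivFun (i : ℕ × ℕ) (φ : 𝓢(E, ℂ)) :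
    SchwartzMap.seminorm ℂ i.1 i.2 φ ≤ ‖weightedDerivFun i φ‖ := by
  refine SchwartzMap.seminorm_le_bound ℂ i.1 i.2 φ (norm_nonneg (weightedDerivFun i φ)) fun x => ?_
  have := (weightedDerivFun i φ).norm_coe_le_norm x
  rwa [weightedDerivFun_apply, norm_smul, norm_pow, norm_norm] at this

/-- The continuous linear map `φ ↦ (x ↦ ‖x‖ ^ k D ^ n φ(x))` into the bounded continuous
functions. These maps together induce the topology of the Schwartz space. -/
def weightedDeriv (i : ℕ × ℕ) :
    𝓢(E, ℂ) →L[ℂ] BddCont E (E [×i.2]→L[ℝ] ℂ) :=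
  SchwartzMap.mkCLMtoNormedSpace (σ := RingHom.id ℂ) (D := E) (E := ℂ)
    (G := BddCont E (E [×i.2]→L[ℝ] ℂ)) (fun φ => weightedDerivFun i φ)
    (fun f g => by
      ext x : 1
      have : iteratedFDeriv ℝ i.2 (⇑(f + g)) x = _ :=
        iteratedFDeriv_add_apply (f.smooth i.2).contDiffAt (g.smooth i.2).contDiffAt
      change ‖x‖ ^ i.1 • iteratedFDeriv ℝ i.2 (⇑(f + g)) x = ‖x‖ ^ i.1 • _ + ‖x‖ ^ i.1 • _
      rw [this, smul_add])
    (fun a f => by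
      ext x : 1
      have : iteratedFDeriv ℝ i.2 (⇑(a • f)) x = _ :=
        iteratedFDeriv_const_smul_apply (f.smooth i.2).contDiffAt
      change ‖x‖ ^ i.1 • iteratedFDeriv ℝ i.2 (⇑(a • f)) x = a • ‖x‖ ^ i.1 • _
      rw [this, smul_comm])
    ⟨{i}, 1, zero_le_one, fun f => by
      rw [Finset.sup_singleton, one_mul]
      exact norm_weightedDerivFun_le i f⟩

theorem continuous_iteratedFDeriv_apply {Φ : Z → 𝓢(E, ℂ)} (hΦ : Continuous Φ) (n : ℕ) (x : E) :
    Continuous fun z => iteratedFDeriv ℝ n (Φ z) x := by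
  have h := (((weightedDeriv (0, n)).continuous.comp hΦ))
  have h2 := (continuous_eval_const (F := BddCont E (E [×n]→L[ℝ] ℂ)) x).comp h
  have e : ∀ z, weightedDeriv (0, n) (Φ z) x = iteratedFDeriv ℝ n (Φ z) x := fun z =>
    (congrArg (· • iteratedFDeriv ℝ n (Φ z) x) (pow_zero ‖x‖)).trans (one_smul ℝ _)
  exact h2.congr e

variable [MeasurableSpace Z] [OpensMeasurableSpace Z] [SecondCountableTopology Z]
  {μ : Measure Z}

omit [TopologicalSpace Z] [OpensMeasurableSpace Z] [SecondCountableTopology Z] in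
/-- Differentiation under the integral sign. The derivative is written as `e (f' z x)` with an
isometry `e`, so that it applies to iterated derivatives, where `e` is the currying isometry. -/
theorem hasFDerivAt_integral_of_norm_le {X Y : Type*} [NormedAddCommGroup X] [NormedSpace ℝ X]
    [CompleteSpace X] [NormedAddCommGroup Y] [NormedSpace ℝ Y] [CompleteSpace Y]
    (e : X ≃ₗᵢ[ℝ] (E →L[ℝ] Y)) {f : Z → E → Y} {f' : Z → E → X} {b : Z → ℝ}
    (hf : ∀ x, AEStronglyMeasurable (fun z => f z x) μ)
    (hf' : ∀ x, AEStronglyMeasurable (fun z => f' z x) μ)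
    (hfi : ∀ x, Integrable (fun z => f z x) μ) (hb : Integrable b μ)
    (hfb : ∀ x z, ‖f' z x‖ ≤ b z) (hd : ∀ z x, HasFDerivAt (f z) (e (f' z x)) x) (x : E) :
    HasFDerivAt (fun x => ∫ z, f z x ∂μ) (e (∫ z, f' z x ∂μ)) x := by
  have h := hasFDerivAt_integral_of_dominated_of_fderiv_le (𝕜 := ℝ) (μ := μ) (F := fun x z => f z x)
    (F' := fun x z => e (f' z x)) (bound := b) (s := Set.univ) (x₀ := x) (by simp)
    (Eventually.of_forall hf) (hfi x) (e.continuous.comp_aestronglyMeasurable (hf' x))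
    (Eventually.of_forall fun z y _ => (e.norm_map _).trans_le (hfb y z)) hb
    (Eventually.of_forall fun z y _ => hd z y)
  have h2 : ∫ z, e (f' z x) ∂μ = e (∫ z, f' z x ∂μ) :=
    (e.toContinuousLinearEquiv : X →L[ℝ] (E →L[ℝ] Y)).integral_comp_comm
      (hb.mono' (hf' x) (Eventually.of_forall (hfb x)))
  rwa [h2] at h

theorem iteratedFDeriv_integral {c : Z → ℂ} (hc : AEStronglyMeasurable c μ) {Φ : Z → 𝓢(E, ℂ)}
    (hΦ : Continuous Φ)
    (hint : ∀ k n, Integrable (fun z => ‖c z‖ * SchwartzMap.seminorm ℂ k n (Φ z)) μ)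
    {Ψ : 𝓢(E, ℂ)} (hΨ : ∀ w, Ψ w = ∫ z, c z * Φ z w ∂μ) (n : ℕ) (x : E) :
    iteratedFDeriv ℝ n Ψ x = ∫ z, c z • iteratedFDeriv ℝ n (Φ z) x ∂μ := by
  have hm : ∀ n x, AEStronglyMeasurable (fun z => c z • iteratedFDeriv ℝ n (Φ z) x) μ :=
    fun n x => hc.smul (continuous_iteratedFDeriv_apply hΦ n x).aestronglyMeasurable
  have hb : ∀ n x z, ‖c z • iteratedFDeriv ℝ n (Φ z) x‖ ≤
      ‖c z‖ * SchwartzMap.seminorm ℂ 0 n (Φ z) := by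
    intro n x z
    rw [norm_smul]
    gcongr
    exact SchwartzMap.norm_iteratedFDeriv_le_seminorm ℂ _ _ _
  have hi : ∀ n x, Integrable (fun z => c z • iteratedFDeriv ℝ n (Φ z) x) μ := fun n x =>
    (hint 0 n).mono' (hm n x) (Eventually.of_forall (hb n x))
  induction n generalizing x with
  | zero =>
    have h := hΨ x
    ext m
    rw [ContinuousMultilinearMap.integral_apply (hi 0 x)]
    simpa using h
  | succ n ih =>
    have hfun : (iteratedFDeriv ℝ n Ψ) = fun x => ∫ z, c z • iteratedFDeriv ℝ n (Φ z) x ∂μ :=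
      funext ih
    let e := (continuousMultilinearCurryLeftEquiv ℝ (fun _ : Fin (n + 1) => E) ℂ)
    have hs : ∀ (φ : 𝓢(E, ℂ)) y,
        fderiv ℝ (iteratedFDeriv ℝ n φ) y = e (iteratedFDeriv ℝ (n + 1) φ y) := by
      intro φ y
      rw [iteratedFDeriv_succ_eq_comp_left]
      simp [e]
    have hd := hasFDerivAt_integral_of_norm_le e (hm n) (hm (n + 1)) (hi n) (hint 0 (n + 1))
      (hb (n + 1)) (fun z y => by
        have h1 : DifferentiableAt ℝ (iteratedFDeriv ℝ n (Φ z)) y :=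
          ((Φ z).smooth (n + 1 : ℕ)).differentiable_iteratedFDeriv
            (by exact_mod_cast n.lt_succ_self) y
        have h2 := (h1.hasFDerivAt).const_smul (c z)
        rw [hs] at h2
        exact h2) x
    rw [← hfun] at hd
    exact e.injective ((hs Ψ x).symm.trans hd.fderiv)

/-- The Hahn-Banach theorem for a functional that is bounded by the seminorm `‖J v‖`. -/
theorem exists_extension_of_norm_le {V X : Type*} [AddCommGroup V] [Module ℂ V]
    [NormedAddCommGroup X] [NormedSpace ℂ X] (J : V →ₗ[ℂ] X) (τ : V →ₗ[ℂ] ℂ) {C : ℝ}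
    (hC : ∀ v, ‖τ v‖ ≤ C * ‖J v‖) : ∃ L : X →L[ℂ] ℂ, ∀ v, L (J v) = τ v := by
  have hker : LinearMap.ker J ≤ LinearMap.ker τ := by
    intro v hv
    have := hC v
    rw [LinearMap.mem_ker.1 hv, norm_zero, mul_zero] at this
    exact norm_le_zero_iff.1 this
  let g : LinearMap.range J →ₗ[ℂ] ℂ :=
    (LinearMap.ker J).liftQ τ hker ∘ₗ J.quotKerEquivRange.symm.toLinearMap
  have hg : ∀ v, g (J.rangeRestrict v) = τ v := by
    intro v
    have : J.quotKerEquivRange.symm (J.rangeRestrict v) = (LinearMap.ker J).mkQ v :=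
      J.quotKerEquivRange_symm_apply_image v _
    simp [g, this]
  let L₀ : LinearMap.range J →L[ℂ] ℂ := g.mkContinuous C (by
    rintro ⟨_, v, rfl⟩
    exact (congrArg norm (hg v)).trans_le (hC v))
  obtain ⟨L, hL, -⟩ := exists_extension_norm_eq _ L₀
  exact ⟨L, fun v => (hL (J.rangeRestrict v)).trans (hg v)⟩

theorem apply_eq_integral_of_bound {V Z ι : Type*} [AddCommGroup V] [Module ℂ V] [Fintype ι]
    [MeasurableSpace Z] {μ : Measure Z} {X : ι → Type*} [∀ i, NormedAddCommGroup (X i)]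
    [∀ i, NormedSpace ℂ (X i)] [∀ i, CompleteSpace (X i)] (D : ∀ i, V →ₗ[ℂ] X i)
    (τ : V →ₗ[ℂ] ℂ) {C : ℝ} (hC : ∀ v, ‖τ v‖ ≤ C * ‖fun i => D i v‖) {c : Z → ℂ} {Φ : Z → V}
    (hi : ∀ i, Integrable (fun z => c z • D i (Φ z)) μ) {Ψ : V}
    (hΨ : ∀ i, D i Ψ = ∫ z, c z • D i (Φ z) ∂μ) : τ Ψ = ∫ z, c z * τ (Φ z) ∂μ := by
  obtain ⟨L, hL⟩ := exists_extension_of_norm_le (LinearMap.pi D) τ hC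
  have hi' : Integrable (fun z => c z • LinearMap.pi D (Φ z)) μ := Integrable.of_eval hi
  have hJ : LinearMap.pi D Ψ = ∫ z, c z • LinearMap.pi D (Φ z) ∂μ := by
    funext i
    exact (hΨ i).trans (eval_integral (f := fun z i => c z • D i (Φ z)) hi i).symm
  rw [← hL Ψ, hJ, ← L.integral_comp_comm hi']
  simp [hL]

/-- A tempered distribution commutes with an integral `Ψ = ∫ c(z) Φ(z) dz` of Schwartz functions
that converges absolutely in every Schwartz seminorm. The Schwartz space is not normed, so `τ` is
extended by the Hahn-Banach theorem to a finite product of spaces of bounded continuous functions,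
in which the Bochner integral is available. -/
theorem apply_eq_integral (τ : 𝓢'(E, ℂ)) {c : Z → ℂ} (hc : AEStronglyMeasurable c μ)
    {Φ : Z → 𝓢(E, ℂ)} (hΦ : Continuous Φ)
    (hint : ∀ k n, Integrable (fun z => ‖c z‖ * SchwartzMap.seminorm ℂ k n (Φ z)) μ)
    {Ψ : 𝓢(E, ℂ)} (hΨ : ∀ w, Ψ w = ∫ z, c z * Φ z w ∂μ) :
    τ Ψ = ∫ z, c z * τ (Φ z) ∂μ := by
  obtain ⟨s, C, -, hC⟩ := Seminorm.bound_of_continuous (schwartz_withSeminorms ℂ E ℂ)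
    ((normSeminorm ℂ ℂ).comp τ.toLinearMap) (continuous_norm.comp τ.cont)
  have hi : ∀ i, Integrable (fun z => c z • weightedDeriv i (Φ z)) μ := fun i => by
    refine (hint i.1 i.2).mono' ?_ (Eventually.of_forall fun z => ?_)
    · exact hc.smul ((weightedDeriv i).continuous.comp hΦ).aestronglyMeasurable
    · rw [norm_smul]
      gcongr
      exact norm_weightedDerivFun_le i (Φ z)
  refine apply_eq_integral_of_bound (ι := s) (X := fun i => BddCont E (E [×i.1.2]→L[ℝ] ℂ))
    (fun i => (weightedDeriv i.1).toLinearMap) τ.toLinearMap (C := C) ?_ (fun i => hi i) ?_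
  · intro φ
    refine (hC φ).trans ?_
    rw [smul_apply, NNReal.smul_def, smul_eq_mul]
    refine mul_le_mul_of_nonneg_left ?_ C.2
    refine Seminorm.finset_sup_apply_le (norm_nonneg _) fun i hi => ?_
    exact (seminorm_le_norm_weightedDerivFun i φ).trans
      (norm_le_pi_norm (fun i : s => weightedDeriv i.1 φ) ⟨i, hi⟩)
  · intro i
    ext x : 1
    have h1 := ((BoundedContinuousFunction.evalCLM ℝ x).integral_comp_comm (hi i)).symm
    have h2 : ∀ z, BoundedContinuousFunction.evalCLM ℝ x (c z • weightedDeriv i.1 (Φ z)) =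
        ‖x‖ ^ i.1.1 • (c z • iteratedFDeriv ℝ i.1.2 (Φ z) x) := fun z =>
          smul_comm (c z) (‖x‖ ^ i.1.1) (iteratedFDeriv ℝ i.1.2 (Φ z) x)
    simp_rw [h2, integral_smul] at h1
    rw [← iteratedFDeriv_integral hc hΦ hint hΨ] at h1
    exact h1.symm

end Exchange

/-! ### Translations of Schwartz functions -/

section Translation

variable {E : Type*} [NormedAddCommGroup E] [NormedSpace ℝ E]

theorem iteratedFDeriv_translate (φ : 𝓢(E, ℂ)) (a x : E) (n : ℕ) :
    iteratedFDeriv ℝ n (φ.compSubConstCLM ℂ a) x = iteratedFDeriv ℝ n φ (x - a) :=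
  iteratedFDeriv_comp_sub (f := φ) n a x

omit [NormedSpace ℝ E] in
theorem norm_pow_le_two_pow_mul (k : ℕ) (x y : E) :
    ‖x‖ ^ k ≤ 2 ^ (k - 1) * (‖y‖ ^ k + ‖x - y‖ ^ k) := by
  refine le_trans ?_ (add_pow_le (norm_nonneg y) (norm_nonneg (x - y)) k)
  gcongr
  simpa using norm_add_le y (x - y)

theorem seminorm_translate_le (φ : 𝓢(E, ℂ)) (k n : ℕ) (a : E) :
    SchwartzMap.seminorm ℂ k n (φ.compSubConstCLM ℂ a) ≤
      2 ^ (k - 1) * (‖a‖ ^ k * SchwartzMap.seminorm ℂ 0 n φ + SchwartzMap.seminorm ℂ k n φ) := by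
  refine SchwartzMap.seminorm_le_bound ℂ _ _ _ (by positivity) fun x => ?_
  rw [iteratedFDeriv_translate]
  calc _ ≤ 2 ^ (k - 1) * (‖a‖ ^ k + ‖x - a‖ ^ k) * ‖iteratedFDeriv ℝ n φ (x - a)‖ := by
        gcongr; exact norm_pow_le_two_pow_mul k x a
    _ = 2 ^ (k - 1) * (‖a‖ ^ k * ‖iteratedFDeriv ℝ n φ (x - a)‖ +
        ‖x - a‖ ^ k * ‖iteratedFDeriv ℝ n φ (x - a)‖) := by ring
    _ ≤ _ := by
        gcongr
        · exact SchwartzMap.norm_iteratedFDeriv_le_seminorm ℂ _ _ _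
        · exact SchwartzMap.le_seminorm ℂ _ _ _ _

theorem mul_norm_image_sub_le {Y : Type*} [NormedAddCommGroup Y] [NormedSpace ℝ Y] {f : E → Y}
    (hf : Differentiable ℝ f) {c C : ℝ} (hc : 0 ≤ c) {x a : E} (ha : ‖a‖ ≤ 1)
    (h : ∀ y ∈ Metric.closedBall x 1, c * ‖fderiv ℝ f y‖ ≤ C) :
    c * ‖f (x - a) - f x‖ ≤ C * ‖a‖ := by
  have h1 := (convex_closedBall x 1).norm_image_sub_le_of_norm_fderiv_le (𝕜 := ℝ)
    (f := fun y => c • f y) (C := C) (fun y _ => (hf y).const_smul c) (fun y hy => by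
      rw [fderiv_fun_const_smul (hf y), norm_smul, Real.norm_of_nonneg hc]
      exact h y hy)
    (Metric.mem_closedBall_self zero_le_one) (y := x - a) (by simpa [dist_eq_norm] using ha)
  simpa [← smul_sub, norm_smul, abs_of_nonneg hc] using h1

theorem seminorm_translate_sub_le (φ : 𝓢(E, ℂ)) (k n : ℕ) {a : E} (ha : ‖a‖ ≤ 1) :
    SchwartzMap.seminorm ℂ k n (φ.compSubConstCLM ℂ a - φ) ≤
      2 ^ (k - 1) * (SchwartzMap.seminorm ℂ k (n + 1) φ + SchwartzMap.seminorm ℂ 0 (n + 1) φ) *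
        ‖a‖ := by
  refine SchwartzMap.seminorm_le_bound ℂ _ _ _ (by positivity) fun x => ?_
  have hsub : iteratedFDeriv ℝ n (⇑(φ.compSubConstCLM ℂ a - φ)) x =
      iteratedFDeriv ℝ n φ (x - a) - iteratedFDeriv ℝ n φ x := by
    rw [← iteratedFDeriv_translate]
    exact iteratedFDeriv_sub_apply ((φ.compSubConstCLM ℂ a).smooth n).contDiffAt
      (φ.smooth n).contDiffAt
  have hd : Differentiable ℝ (iteratedFDeriv ℝ n φ) :=
    (φ.smooth (n + 1 : ℕ)).differentiable_iteratedFDeriv (by exact_mod_cast n.lt_succ_self)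
  have hb : ∀ y ∈ Metric.closedBall x 1, ‖x‖ ^ k * ‖fderiv ℝ (iteratedFDeriv ℝ n φ) y‖ ≤
      2 ^ (k - 1) * (SchwartzMap.seminorm ℂ k (n + 1) φ + SchwartzMap.seminorm ℂ 0 (n + 1) φ) := by
    intro y hy
    rw [norm_fderiv_iteratedFDeriv]
    have hxy : ‖x - y‖ ^ k ≤ 1 := pow_le_one₀ (norm_nonneg _) (by
      rwa [← dist_eq_norm, dist_comm])
    calc _ ≤ 2 ^ (k - 1) * (‖y‖ ^ k + 1) * ‖iteratedFDeriv ℝ (n + 1) φ y‖ := by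
          gcongr
          exact (norm_pow_le_two_pow_mul k x y).trans (by gcongr)
      _ = 2 ^ (k - 1) * (‖y‖ ^ k * ‖iteratedFDeriv ℝ (n + 1) φ y‖ +
          ‖iteratedFDeriv ℝ (n + 1) φ y‖) := by ring
      _ ≤ _ := by
          gcongr
          · exact SchwartzMap.le_seminorm ℂ _ _ _ _
          · exact SchwartzMap.norm_iteratedFDeriv_le_seminorm ℂ _ _ _
  rw [hsub]
  exact mul_norm_image_sub_le hd (by positivity) ha hb

theorem continuous_translate (φ : 𝓢(E, ℂ)) : Continuous fun a : E => φ.compSubConstCLM ℂ a := by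
  have h0 : Tendsto (fun a : E => φ.compSubConstCLM ℂ a) (nhds 0) (nhds φ) := by
    rw [(schwartz_withSeminorms ℂ E ℂ).tendsto_nhds]
    rintro ⟨k, n⟩ ε hε
    set C := 2 ^ (k - 1) *
      (SchwartzMap.seminorm ℂ k (n + 1) φ + SchwartzMap.seminorm ℂ 0 (n + 1) φ)
    have hlim : Tendsto (fun a : E => C * ‖a‖) (nhds 0) (nhds 0) := by
      have : Continuous fun a : E => C * ‖a‖ := by fun_prop
      simpa using this.tendsto 0
    filter_upwards [hlim.eventually_lt_const hε, Metric.closedBall_mem_nhds (0 : E) one_pos]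
      with a ha ha1
    exact (seminorm_translate_sub_le φ k n (by simpa using ha1)).trans_lt ha
  rw [continuous_iff_continuousAt]
  intro b
  have h1 : Tendsto (fun a : E => a - b) (nhds b) (nhds 0) := by
    have : Continuous fun a : E => a - b := by fun_prop
    simpa using this.tendsto b
  have h2 := ((SchwartzMap.compSubConstCLM ℂ b).continuous.tendsto φ).comp (h0.comp h1)
  refine h2.congr fun a => ?_
  ext x
  simp

end Translation

/-! ### Multipliers that equal one near the support of a distribution -/

section Support

variable {E : Type*} [NormedAddCommGroup E] [NormedSpace ℝ E] [FiniteDimensional ℝ E]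

open scoped Manifold ContDiff in
/-- A smooth partition of unity reduces this to functions supported in open sets on which `τ`
vanishes, which is how the support is defined. -/
theorem apply_eq_zero_of_hasCompactSupport (τ : 𝓢'(E, ℂ)) {φ : 𝓢(E, ℂ)}
    (hφ : HasCompactSupport φ) (hd : Disjoint (tsupport φ) (Distribution.dsupport τ)) :
    τ φ = 0 := by
  let ι := {a : Set E // Distribution.IsVanishingOn τ a ∧ IsOpen a}
  obtain ⟨f, hf⟩ := SmoothPartitionOfUnity.exists_isSubordinate 𝓘(ℝ, E) (isClosed_tsupport φ)
    (fun i : ι => i.1) (fun i => i.2.2) (fun x hx => by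
      have := hd.subset_compl_right hx
      rw [Distribution.dsupport_compl_eq] at this
      obtain ⟨a, ha, hxa⟩ := this
      exact Set.mem_iUnion.2 ⟨⟨a, ha⟩, hxa⟩)
  have hfin := f.locallyFinite.finite_nonempty_inter_compact hφ
  have hsm : ∀ i, ContDiff ℝ ∞ fun x => ((f i x : ℝ) : ℂ) * φ x := fun i =>
    (Complex.ofRealCLM.contDiff.comp (f i).contMDiff.contDiff).mul (φ.smooth ⊤)
  have hcs : ∀ i, HasCompactSupport fun x => ((f i x : ℝ) : ℂ) * φ x := fun i => hφ.mul_left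
  have hsum : φ = ∑ i ∈ hfin.toFinset, (hcs i).toSchwartzMap (hsm i) := by
    ext x
    have hx := map_sum (TemperedDistribution.delta x)
      (fun i => (hcs i).toSchwartzMap (hsm i)) hfin.toFinset
    simp only [TemperedDistribution.delta_apply] at hx
    rw [hx]
    change φ x = ∑ i ∈ hfin.toFinset, ((f i x : ℝ) : ℂ) * φ x
    rw [← Finset.sum_mul]
    by_cases hx : x ∈ tsupport φ
    · have h1 := f.sum_eq_one hx
      rw [finsum_eq_sum_of_support_subset (s := hfin.toFinset)] at h1
      · rw [← Complex.ofReal_sum, h1]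
        simp
      · intro i hi
        simp only [Set.Finite.coe_toFinset, Set.mem_ofPred_eq]
        exact ⟨x, hi, hx⟩
    · rw [image_eq_zero_of_notMem_tsupport hx, mul_zero]
  rw [hsum, map_sum]
  refine Finset.sum_eq_zero fun i _ => i.2.1 _ ?_
  refine Set.Subset.trans ?_ (hf i)
  refine closure_mono fun x hx => ?_
  have hx' : ((f i x : ℝ) : ℂ) * φ x ≠ 0 := hx
  simpa using left_ne_zero_of_mul hx'

/-- A smooth function which is `1` on the unit ball and vanishes outside the ball of radius `2`. -/
def unitBump (E : Type*) [NormedAddCommGroup E] [NormedSpace ℝ E] [FiniteDimensional ℝ E] :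
    ContDiffBump (0 : E) := ⟨1, 2, one_pos, one_lt_two⟩

open scoped ContDiff in
/-- Smooth cutoffs of a Schwartz function at radius `N + 1` converge to it in the Schwartz space. -/
theorem tendsto_bump_smul (φ : 𝓢(E, ℂ)) {Φ : ℕ → 𝓢(E, ℂ)}
    (hΦ : ∀ N x, Φ N x = ((unitBump E ((N + 1 : ℝ)⁻¹ • x) : ℝ) : ℂ) * φ x) :
    Tendsto Φ atTop (nhds φ) := by
  let η : E → ℂ := fun x => ((unitBump E x : ℝ) : ℂ) - 1
  have hη : ContDiff ℝ ∞ η :=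
    (Complex.ofRealCLM.contDiff.comp (unitBump E).contDiff).sub contDiff_const
  have hηb : ∀ i : ℕ, ∃ B, ∀ x, ‖iteratedFDeriv ℝ i η x‖ ≤ B := by
    intro i
    have hc : HasCompactSupport fun x => ((unitBump E x : ℝ) : ℂ) :=
      (unitBump E).hasCompactSupport.comp_left (g := Complex.ofReal) rfl
    have hs : ContDiff ℝ ∞ fun x => ((unitBump E x : ℝ) : ℂ) :=
      Complex.ofRealCLM.contDiff.comp (unitBump E).contDiff
    obtain ⟨B, hB⟩ := (hs.continuous_iteratedFDeriv (m := i)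
      (by exact_mod_cast le_top)).bounded_above_of_compact_support (hc.iteratedFDeriv i)
    refine ⟨B + ‖iteratedFDeriv ℝ i (fun _ : E => (1 : ℂ)) 0‖, fun x => ?_⟩
    have h1 : iteratedFDeriv ℝ i η x = iteratedFDeriv ℝ i (fun x => ((unitBump E x : ℝ) : ℂ)) x -
        iteratedFDeriv ℝ i (fun _ : E => (1 : ℂ)) x :=
      iteratedFDeriv_sub_apply (hs.of_le (by exact_mod_cast le_top)).contDiffAt contDiffAt_const
    have h2 : iteratedFDeriv ℝ i (fun _ : E => (1 : ℂ)) x =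
        iteratedFDeriv ℝ i (fun _ : E => (1 : ℂ)) 0 := by
      rcases i with _ | i
      · ext; simp
      · simp [iteratedFDeriv_succ_const]
    rw [h1, h2]
    exact (norm_sub_le _ _).trans (by gcongr; exact hB x)
  choose B hB using hηb
  rw [(schwartz_withSeminorms ℂ E ℂ).tendsto_nhds]
  rintro ⟨k, n⟩ ε hε
  set C := ∑ i ∈ Finset.range (n + 1), (n.choose i : ℝ) * B i *
    SchwartzMap.seminorm ℂ (k + 1) (n - i) φ
  have hB0 : ∀ i, 0 ≤ B i := fun i => (norm_nonneg _).trans (hB i 0)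
  have hC : 0 ≤ C := Finset.sum_nonneg fun i _ => by have := hB0 i; positivity
  have hbound : ∀ N, SchwartzMap.seminorm ℂ k n (Φ N - φ) ≤ (N + 1 : ℝ)⁻¹ * C := by
    intro N
    have hN : (0 : ℝ) < N + 1 := by positivity
    have hηN : ContDiff ℝ ∞ fun x => η ((N + 1 : ℝ)⁻¹ • x) := hη.comp (contDiff_const_smul _)
    refine SchwartzMap.seminorm_le_bound ℂ _ _ _ (by positivity) fun x => ?_
    have hfun : (⇑(Φ N - φ)) = fun x => η ((N + 1 : ℝ)⁻¹ • x) * φ x := by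
      funext x
      simp [hΦ, η, sub_mul]
    rw [hfun]
    rcases lt_or_ge ‖x‖ (N + 1) with hx | hx
    · have hz : (fun x => η ((N + 1 : ℝ)⁻¹ • x) * φ x) =ᶠ[nhds x] fun _ => 0 := by
        have hopen : {y : E | ‖y‖ < N + 1} ∈ nhds x :=
          (isOpen_lt continuous_norm continuous_const).mem_nhds hx
        filter_upwards [hopen] with y hy
        have : unitBump E ((N + 1 : ℝ)⁻¹ • y) = 1 := by
          refine (unitBump E).one_of_mem_closedBall ?_
          rw [mem_closedBall_zero_iff, norm_smul, norm_inv, Real.norm_of_nonneg hN.le]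
          change _ ≤ (1 : ℝ)
          rw [inv_mul_le_one₀ hN]
          exact (le_of_lt hy)
        simp [η, this]
      rw [(hz.iteratedFDeriv ℝ n).eq_of_nhds]
      rcases n with _ | n
      · simp; positivity
      · simp; positivity
    · -- Here `1 ≤ ‖x‖ / (N + 1)`, so one more power of `‖x‖` pays for the decay in `N`.
      have h1 := norm_iteratedFDeriv_mul_le (n := n) (hηN) (φ.smooth ⊤) x (by exact_mod_cast le_top)
      have h2 : ∀ i, ‖iteratedFDeriv ℝ i (fun x => η ((N + 1 : ℝ)⁻¹ • x)) x‖ ≤ B i := by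
        intro i
        rw [iteratedFDeriv_comp_const_smul _ (hη.of_le (by exact_mod_cast le_top)), norm_smul,
          norm_pow, norm_inv, Real.norm_of_nonneg hN.le]
        refine (mul_le_mul_of_nonneg_left (hB i _) (by positivity)).trans ?_
        refine mul_le_of_le_one_left (hB0 i)
          (pow_le_one₀ (by positivity) (inv_le_one_of_one_le₀ ?_))
        linarith [Nat.cast_nonneg (α := ℝ) N]
      calc _ ≤ ((N + 1 : ℝ)⁻¹ * ‖x‖ ^ (k + 1)) * ∑ i ∈ Finset.range (n + 1), ((n.choose i : ℝ) *
            ‖iteratedFDeriv ℝ i (fun x => η ((N + 1 : ℝ)⁻¹ • x)) x‖ *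
              ‖iteratedFDeriv ℝ (n - i) φ x‖) := by
            gcongr
            · rw [pow_succ, ← mul_assoc, mul_comm, ← mul_assoc]
              refine le_mul_of_one_le_left (by positivity) ?_
              rw [mul_comm, ← div_eq_inv_mul]
              exact (one_le_div hN).2 hx
        _ ≤ (N + 1 : ℝ)⁻¹ * C := by
            rw [mul_assoc, Finset.mul_sum]
            refine mul_le_mul_of_nonneg_left (Finset.sum_le_sum fun i _ => ?_) (by positivity)
            calc _ = (n.choose i : ℝ) * ‖iteratedFDeriv ℝ i (fun x => η ((N + 1 : ℝ)⁻¹ • x)) x‖ *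
                  (‖x‖ ^ (k + 1) * ‖iteratedFDeriv ℝ (n - i) φ x‖) := by ring
              _ ≤ _ := by
                  gcongr
                  · have := hB0 i
                    positivity
                  · exact h2 i
                  · exact SchwartzMap.le_seminorm ℂ _ _ _ _
  have hlim : Tendsto (fun N : ℕ => (N + 1 : ℝ)⁻¹ * C) atTop (nhds 0) := by
    have := tendsto_one_div_add_atTop_nhds_zero_nat (𝕜 := ℝ)
    simpa using (this.mul_const C)
  filter_upwards [hlim.eventually_lt_const hε] with N hN
  exact (hbound N).trans_lt hN

open scoped ContDiff in
theorem apply_eq_zero_of_disjoint_dsupport (τ : 𝓢'(E, ℂ)) {φ : 𝓢(E, ℂ)}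
    (hd : Disjoint (tsupport φ) (Distribution.dsupport τ)) : τ φ = 0 := by
  have hcs : ∀ N : ℕ, HasCompactSupport
      fun x => ((unitBump E ((N + 1 : ℝ)⁻¹ • x) : ℝ) : ℂ) * φ x := fun N => by
    have h := (unitBump E).hasCompactSupport.comp_smul (c := (N + 1 : ℝ)⁻¹) (by positivity)
    exact (h.comp_left (g := Complex.ofReal) rfl).mul_right
  have hsm : ∀ N : ℕ, ContDiff ℝ ∞
      fun x => ((unitBump E ((N + 1 : ℝ)⁻¹ • x) : ℝ) : ℂ) * φ x := fun N =>
    (Complex.ofRealCLM.contDiff.comp ((unitBump E).contDiff.comp (contDiff_const_smul _))).mul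
      (φ.smooth ⊤)
  have h1 := tendsto_bump_smul φ (Φ := fun N => (hcs N).toSchwartzMap (hsm N)) fun N x => by
    simp
  have h2 := (τ.cont.tendsto φ).comp h1
  have h3 : ∀ N, τ ((hcs N).toSchwartzMap (hsm N)) = 0 := fun N =>
    apply_eq_zero_of_hasCompactSupport τ (hcs N) (hd.mono_left (closure_mono (by
      intro x hx
      have hx' : ((unitBump E ((N + 1 : ℝ)⁻¹ • x) : ℝ) : ℂ) * φ x ≠ 0 := by simpa using hx
      exact right_ne_zero_of_mul hx')))
  refine tendsto_nhds_unique h2 ?_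
  exact tendsto_const_nhds.congr fun N => (h3 N).symm

/-- It is not enough that `χ = 1` on the support itself: derivatives of `χ` matter, so `χ` has to be
`1` on a neighbourhood. -/
theorem smulLeftCLM_eq_self_of_dsupport_subset (τ : 𝓢'(E, ℂ)) {χ : E → ℂ}
    (hχ : χ.HasTemperateGrowth) {U : Set E} (hU : IsOpen U) (hχU : ∀ x ∈ U, χ x = 1)
    (hτ : Distribution.dsupport τ ⊆ U) : TemperedDistribution.smulLeftCLM ℂ χ τ = τ := by
  ext φ
  rw [TemperedDistribution.smulLeftCLM_apply_apply, ← sub_eq_zero, ← map_sub]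
  refine apply_eq_zero_of_disjoint_dsupport τ ?_
  refine Disjoint.mono_right hτ (Disjoint.closure_left ?_ hU)
  rw [Set.disjoint_left]
  intro x hx hxU
  refine hx ?_
  simp [SchwartzMap.smulLeftCLM_apply_apply hχ, hχU x hxU]

end Support

/-! ### Compact operators have a singular value decomposition -/

section SVD

universe u v

variable {H : Type v} [NormedAddCommGroup H] [InnerProductSpace ℂ H] [CompleteSpace H]

omit [CompleteSpace H] in
theorem span_sigma_orthogonal_eq_bot {κ : Type*} {w : κ → Type*} (G : κ → Submodule ℂ H)
    (hbot : (⨆ k, G k)ᗮ = ⊥) (b : ∀ k, HilbertBasis (w k) ℂ (G k)) :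
    (Submodule.span ℂ (Set.range fun a : Σ k, w k => ((b a.1 a.2 : G a.1) : H)))ᗮ = ⊥ := by
  rw [eq_bot_iff, ← hbot]
  intro x hx
  rw [← Submodule.iInf_orthogonal, Submodule.mem_iInf]
  intro k
  have hker : (⊤ : Submodule ℂ (G k)) ≤
      LinearMap.ker ((innerSL ℂ x : H →ₗ[ℂ] ℂ) ∘ₗ (G k).subtype) := by
    rw [← (b k).dense_span]
    refine Submodule.topologicalClosure_minimal _ ?_ ?_
    · rw [Submodule.span_le]
      rintro _ ⟨i, rfl⟩
      have := (Submodule.mem_orthogonal' _ _).1 hx _ (Submodule.subset_span ⟨⟨k, i⟩, rfl⟩)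
      simpa using this
    · exact isClosed_singleton.preimage
        ((innerSL ℂ x).continuous.comp continuous_subtype_val)
  rw [Submodule.mem_orthogonal']
  intro u hu
  simpa using hker (Submodule.mem_top (x := ⟨u, hu⟩))

theorem exists_hilbertBasis_of_orthogonalFamily {κ : Type u} (G : κ → Submodule ℂ H)
    (hG : ∀ k, IsClosed (G k : Set H))
    (horth : OrthogonalFamily ℂ (fun k => G k) fun k => (G k).subtypeₗᵢ)
    (hbot : (⨆ k, G k)ᗮ = ⊥) :
    ∃ (ι : Type (max u v)) (b : HilbertBasis ι ℂ H), ∀ i, ∃ k, b i ∈ G k := by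
  have hcomp : ∀ k, CompleteSpace (G k) := fun k => (hG k).completeSpace_coe
  have hex : ∀ k, ∃ (w : Set (G k)), Nonempty (HilbertBasis w ℂ (G k)) := fun k =>
    let ⟨w, b, _⟩ := exists_hilbertBasis ℂ (G k)
    ⟨w, ⟨b⟩⟩
  choose w hw using hex
  let b : ∀ k, HilbertBasis (w k) ℂ (G k) := fun k => (hw k).some
  have ho : Orthonormal ℂ fun a : Σ k, w k => ((b a.1 a.2 : G a.1) : H) :=
    horth.orthonormal_sigma_orthonormal (fun k => (b k).orthonormal)
  have hspan := span_sigma_orthogonal_eq_bot G hbot b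
  refine ⟨(Σ k, w k), HilbertBasis.mkOfOrthogonalEqBot ho hspan, fun a => ⟨a.1, ?_⟩⟩
  rw [HilbertBasis.coe_mkOfOrthogonalEqBot]
  exact (b a.1 a.2).2

theorem exists_hilbertBasis_eigenvectors {A : H →L[ℂ] H} (hA : IsCompactOperator A)
    (hsymm : (A : H →ₗ[ℂ] H).IsSymmetric) :
    ∃ (ι : Type v) (b : HilbertBasis ι ℂ H), ∀ i, ∃ μ : ℂ, A (b i) = μ • b i := by
  obtain ⟨ι, b, hb⟩ := exists_hilbertBasis_of_orthogonalFamily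
    (fun μ : ℂ => Module.End.eigenspace (A : H →ₗ[ℂ] H) μ) (fun μ => by
      have : (Module.End.eigenspace (A : H →ₗ[ℂ] H) μ : Set H) = {x | A x = μ • x} := by
        ext x
        exact Module.End.mem_eigenspace_iff
      rw [this]
      exact isClosed_eq A.continuous (continuous_const_smul μ))
    hsymm.orthogonalFamily_eigenspaces
    (ContinuousLinearMap.orthogonalComplement_iSup_eigenspaces_eq_bot hA hsymm)
  refine ⟨ι, b, fun i => ?_⟩
  obtain ⟨μ, hμ⟩ := hb i
  exact ⟨μ, Module.End.mem_eigenspace_iff.1 hμ⟩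

omit [CompleteSpace H] in
/-- The images `T bᵢ` with `‖T bᵢ‖ ≥ ε` are orthogonal, hence `ε`-separated, in a relatively compact
set. -/
theorem finite_setOf_le_norm_of_isCompactOperator {T : H →L[ℂ] H} (hT : IsCompactOperator T)
    {ι : Type*} {b : ι → H} (hb : Orthonormal ℂ b)
    (horth : ∀ i j, i ≠ j → inner ℂ (T (b i)) (T (b j)) = 0) {ε : ℝ} (hε : 0 < ε) :
    {i | ε ≤ ‖T (b i)‖}.Finite := by
  by_contra hinf
  let f := Set.Infinite.natEmbedding _ hinf
  obtain ⟨K, hK, hKs⟩ := hT.image_closedBall_subset_compact (f := (T : H →ₗ[ℂ] H)) 1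
  have hmem : ∀ n, T (b (f n)) ∈ K := fun n => hKs ⟨b (f n), by simp [hb.1], rfl⟩
  obtain ⟨x, -, φ, hφ, hlim⟩ := hK.tendsto_subseq hmem
  obtain ⟨N, hN⟩ := Metric.cauchySeq_iff.1 hlim.cauchySeq ε hε
  have h1 := hN N le_rfl (N + 1) (Nat.le_succ N)
  have hne : (f (φ N) : ι) ≠ f (φ (N + 1)) := fun h =>
    (hφ (Nat.lt_succ_self N)).ne (f.injective (Subtype.ext h))
  have h2 : ε ≤ ‖T (b (f (φ N)))‖ := (f (φ N)).2
  have h3 := norm_sub_sq (𝕜 := ℂ) (T (b (f (φ N)))) (T (b (f (φ (N + 1)))))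
  rw [horth _ _ hne] at h3
  simp only [Function.comp_apply, dist_eq_norm] at h1
  simp at h3
  nlinarith [norm_nonneg (T (b (f (φ N))) - T (b (f (φ (N + 1))))),
    sq_nonneg ‖T (b (f (φ (N + 1))))‖]

omit [CompleteSpace H] in
/-- An orthonormal basis that a compact operator maps to an orthogonal family gives a singular value
decomposition: the singular values are the norms of the images. -/
theorem exists_isSVD_of_hilbertBasis {T : H →L[ℂ] H} (hT : IsCompactOperator T) {ι : Type*}
    (b : HilbertBasis ι ℂ H) (horth : ∀ i j, i ≠ j → inner ℂ (T (b i)) (T (b j)) = 0) :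
    ∃ (s : ℕ → ℝ) (e η : ℕ → H), IsSVD T s e η := by
  have hfin : ∀ ε : ℝ, 0 < ε → {i | ε ≤ ‖T (b i)‖}.Finite := fun ε hε =>
    finite_setOf_le_norm_of_isCompactOperator hT b.orthonormal horth hε
  let ι' := {i // T (b i) ≠ 0}
  have hcount : {i | T (b i) ≠ 0}.Countable := by
    refine (Set.countable_iUnion fun n : ℕ =>
      (hfin (1 / (n + 1)) (by positivity)).countable).mono ?_
    intro i hi
    obtain ⟨n, hn⟩ := exists_nat_one_div_lt (norm_pos_iff.2 hi)
    exact Set.mem_iUnion.2 ⟨n, hn.le⟩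
  have : Countable ι' := hcount
  obtain ⟨c, hc⟩ := Countable.exists_injective_nat ι'
  let s : ℕ → ℝ := Function.extend c (fun i => ‖T (b i.1)‖) 0
  let η : ℕ → H := Function.extend c (fun i => b i.1) 0
  let e : ℕ → H := Function.extend c (fun i => (‖T (b i.1)‖⁻¹ : ℂ) • T (b i.1)) 0
  have hsr : ∀ n, s n ≠ 0 → ∃ i, c i = n := by
    intro n hn
    by_contra h
    exact hn (Function.extend_apply' _ _ _ h)
  have hs : ∀ i, s (c i) = ‖T (b i.1)‖ := fun i => hc.extend_apply _ _ i
  have hη : ∀ i, η (c i) = b i.1 := fun i => hc.extend_apply _ _ i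
  have he : ∀ i, e (c i) = (‖T (b i.1)‖⁻¹ : ℂ) • T (b i.1) := fun i => hc.extend_apply _ _ i
  choose r hr using fun n : {n // s n ≠ 0} => hsr n.1 n.2
  have hrinj : Function.Injective r := fun m n h => Subtype.ext (by rw [← hr m, ← hr n, h])
  refine ⟨s, e, η, ?_, ?_, ?_, ?_, ?_⟩
  · intro n
    by_cases h : s n = 0
    · exact h.ge
    · obtain ⟨i, rfl⟩ := hsr n h
      rw [hs]; positivity
  · rw [← Nat.cofinite_eq_atTop, Metric.tendsto_nhds]
    intro ε hε
    have hf : (c '' {i : ι' | ε ≤ ‖T (b i.1)‖}).Finite :=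
      ((hfin ε hε).preimage (Subtype.val_injective.injOn)).image c
    refine (hf.subset ?_)
    intro n hn
    have hn' : ¬ dist (s n) 0 < ε := hn
    have h0 : s n ≠ 0 := by
      rintro h
      exact hn' (by simpa [h] using hε)
    obtain ⟨i, rfl⟩ := hsr n h0
    rw [hs] at hn'
    exact ⟨i, by simpa using hn', rfl⟩
  · have : Orthonormal ℂ fun i : ι' => (‖T (b i.1)‖⁻¹ : ℂ) • T (b i.1) := by
      refine ⟨fun i => ?_, fun i j hij => ?_⟩
      · rw [norm_smul, norm_inv, Complex.norm_real, norm_norm,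
          inv_mul_cancel₀ (norm_ne_zero_iff.2 i.2)]
      · simp only [inner_smul_left, inner_smul_right]
        rw [horth _ _ fun h => hij (Subtype.ext h)]
        simp
    convert this.comp r hrinj using 2 with n
    rw [Function.comp_apply, ← he, hr]
  · have : Orthonormal ℂ fun i : ι' => b i.1 := b.orthonormal.comp _ Subtype.val_injective
    convert this.comp r hrinj using 2 with n
    rw [Function.comp_apply, ← hη, hr]
  · intro f
    have h1 : HasSum (fun i => (inner ℂ (b i) f) • T (b i)) (T f) := by
      have := T.hasSum (b.hasSum_repr f)
      simpa only [Function.comp_def, map_smul, b.repr_apply_apply] using this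
    have h2 : HasSum (fun i : ι' => (inner ℂ (b i.1) f) • T (b i.1)) (T f) := by
      refine (hasSum_subtype_iff_of_support_subset (s := {i | T (b i) ≠ 0}) ?_).2 h1
      intro i hi h
      exact hi (by simp only [h, smul_zero])
    refine (hc.hasSum_iff ?_).1 ?_
    · intro n hn
      have : s n = 0 := by
        by_contra h
        exact hn (hsr n h)
      simp [this]
    · refine h2.congr_fun fun i => ?_
      have hi : (‖T (b i.1)‖ : ℂ) ≠ 0 := by simpa using i.2
      simp only [Function.comp_apply]
      rw [hs, hη, he, smul_smul]
      congr 1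
      field_simp

/-- The basis consists of eigenvectors of the compact self-adjoint operator `T* T`. -/
theorem exists_isSVD {T : H →L[ℂ] H} (hT : IsCompactOperator T) :
    ∃ (s : ℕ → ℝ) (e η : ℕ → H), IsSVD T s e η := by
  let A := (ContinuousLinearMap.adjoint T).comp T
  have hA : IsCompactOperator A := hT.clm_comp (ContinuousLinearMap.adjoint T)
  have hsymm : (A : H →ₗ[ℂ] H).IsSymmetric := fun x y => by
    simp [A, ContinuousLinearMap.adjoint_inner_left, ContinuousLinearMap.adjoint_inner_right]
  obtain ⟨ι, b, hb⟩ := exists_hilbertBasis_eigenvectors hA hsymm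
  have horth : ∀ i j, i ≠ j → inner ℂ (T (b i)) (T (b j)) = 0 := by
    intro i j hij
    obtain ⟨μ, hμ⟩ := hb j
    have : inner ℂ (T (b i)) (T (b j)) = inner ℂ (b i) (A (b j)) := by
      simp [A, ContinuousLinearMap.adjoint_inner_right]
    rw [this, hμ, inner_smul_right, b.orthonormal.2 hij, mul_zero]
  exact exists_isSVD_of_hilbertBasis hT b horth

end SVD

/-! ### Exponentials of functions of temperate growth -/

section Exponential

variable {E : Type*} [NormedAddCommGroup E] [NormedSpace ℝ E]

theorem iteratedDeriv_cexp_mul_ofReal (c : ℂ) (n : ℕ) :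
    iteratedDeriv n (fun s : ℝ => Complex.exp (c * s)) =
      fun s : ℝ => c ^ n * Complex.exp (c * s) := by
  induction n with
  | zero => simp
  | succ n ih =>
    rw [iteratedDeriv_succ, ih]
    funext s
    have h := ((Complex.ofRealCLM.hasDerivAt (x := s)).const_mul c).cexp.const_mul (c ^ n)
    simp only [Complex.ofRealCLM_apply, Complex.ofReal_one, mul_one] at h
    rw [h.deriv]
    ring

theorem contDiff_cexp_mul_ofReal (c : ℂ) {n : WithTop ℕ∞} :
    ContDiff ℝ n fun s : ℝ => Complex.exp (c * s) :=
  (contDiff_const.mul Complex.ofRealCLM.contDiff).cexp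

/-- The derivatives of `exp (c f)` are bounded by a polynomial times the function itself. -/
theorem norm_iteratedFDeriv_cexp_le (c : ℂ) {f : E → ℝ} (hf : f.HasTemperateGrowth) (n : ℕ) :
    ∃ (k : ℕ) (C : ℝ), 0 ≤ C ∧ ∀ x, ‖iteratedFDeriv ℝ n (fun x => Complex.exp (c * f x)) x‖ ≤
      C * (1 + ‖x‖) ^ k * ‖Complex.exp (c * f x)‖ := by
  obtain ⟨k, C, hC, h⟩ := hf.norm_iteratedFDeriv_le_uniform n
  refine ⟨k * n, n.factorial * (1 + ‖c‖) ^ n * (1 + C) ^ n, by positivity, fun x => ?_⟩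
  have h1 := norm_iteratedFDeriv_comp_le (𝕜 := ℝ) (g := fun s : ℝ => Complex.exp (c * s)) (f := f)
    (n := n) (N := n) (contDiff_cexp_mul_ofReal c)
    (hf.1.of_le (mod_cast le_top)) le_rfl x
    (C := (1 + ‖c‖) ^ n * ‖Complex.exp (c * f x)‖) (D := (1 + C) * (1 + ‖x‖) ^ k) ?_ ?_
  · refine h1.trans (le_of_eq ?_)
    rw [mul_pow, ← pow_mul]
    ring
  · intro i hi
    rw [norm_iteratedFDeriv_eq_norm_iteratedDeriv, iteratedDeriv_cexp_mul_ofReal, norm_mul,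
      norm_pow]
    gcongr
    calc ‖c‖ ^ i ≤ (1 + ‖c‖) ^ i := by gcongr; linarith
      _ ≤ (1 + ‖c‖) ^ n := pow_le_pow_right₀ (by linarith [norm_nonneg c]) hi
  · intro i hi1 hi
    calc _ ≤ C * (1 + ‖x‖) ^ k := h i hi x
      _ ≤ (1 + C) * (1 + ‖x‖) ^ k := by gcongr; linarith
      _ ≤ _ := le_self_pow₀ (one_le_mul_of_one_le_of_one_le (by linarith)
          (one_le_pow₀ (by linarith [norm_nonneg x]))) (by omega)

theorem contDiff_cexp_mul (c : ℂ) {f : E → ℝ} (hf : f.HasTemperateGrowth) :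
    ContDiff ℝ (⊤ : ℕ∞) fun x => Complex.exp (c * f x) :=
  (contDiff_cexp_mul_ofReal c).comp hf.1

theorem hasTemperateGrowth_cexp_mul_I {f : E → ℝ} (hf : f.HasTemperateGrowth) :
    (fun x => Complex.exp (f x * Complex.I)).HasTemperateGrowth := by
  simp only [mul_comm _ Complex.I]
  refine ⟨contDiff_cexp_mul _ hf, fun n => ?_⟩
  obtain ⟨k, C, hC, h⟩ := norm_iteratedFDeriv_cexp_le Complex.I hf n
  refine ⟨k, C, fun x => (h x).trans (le_of_eq ?_)⟩
  rw [mul_comm Complex.I, Complex.norm_exp_ofReal_mul_I, mul_one]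

theorem exists_pow_mul_exp_neg_sq_le (M : ℕ) {b : ℝ} (hb : 0 < b) :
    ∃ C : ℝ, ∀ r : ℝ, 0 ≤ r → (1 + r) ^ M * Real.exp (-b * r ^ 2) ≤ C := by
  refine ⟨M.factorial * Real.exp (1 + 1 / (4 * b)), fun r hr => ?_⟩
  have h1 := Real.pow_div_factorial_le_exp (1 + r) (by positivity) M
  rw [div_le_iff₀ (by positivity)] at h1
  calc _ ≤ (Real.exp (1 + r) * M.factorial) * Real.exp (-b * r ^ 2) := by gcongr
    _ = M.factorial * Real.exp (1 + r + -b * r ^ 2) := by rw [Real.exp_add (1 + r)]; ring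
    _ ≤ _ := by
      refine mul_le_mul_of_nonneg_left (Real.exp_le_exp.2 ?_) (by positivity)
      have : 0 ≤ b * (r - 1 / (2 * b)) ^ 2 := by positivity
      have e : b * (r - 1 / (2 * b)) ^ 2 = b * r ^ 2 - r + 1 / (4 * b) := by field_simp; ring
      linarith

end Exponential

/-! ### The Gaussian window -/

section Window

variable {V : Type*} [NormedAddCommGroup V] [InnerProductSpace ℝ V]

/-- The Gaussian `x ↦ e^{-π‖x‖²}` as a Schwartz function. -/
def gaussianS (V : Type*) [NormedAddCommGroup V] [InnerProductSpace ℝ V] : 𝓢(V, ℂ) where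
  toFun x := Complex.exp ((-Real.pi : ℂ) * (‖x‖ ^ 2 : ℝ))
  smooth' := contDiff_cexp_mul _ (Function.hasTemperateGrowth_norm_sq V)
  decay' k n := by
    obtain ⟨N, C, hC, h⟩ := norm_iteratedFDeriv_cexp_le (-Real.pi : ℂ)
      (Function.hasTemperateGrowth_norm_sq V) n
    obtain ⟨A, hA⟩ := exists_pow_mul_exp_neg_sq_le (k + N) Real.pi_pos
    refine ⟨C * A, fun x => ?_⟩
    have e : ‖Complex.exp ((-Real.pi : ℂ) * (‖x‖ ^ 2 : ℝ))‖ = Real.exp (-Real.pi * ‖x‖ ^ 2) := by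
      rw [← Complex.ofReal_neg, ← Complex.ofReal_mul, Complex.norm_exp_ofReal]
    calc _ ≤ (1 + ‖x‖) ^ k * (C * (1 + ‖x‖) ^ N * Real.exp (-Real.pi * ‖x‖ ^ 2)) := by
          rw [← e]
          gcongr
          · linarith
          · exact h x
      _ = C * ((1 + ‖x‖) ^ (k + N) * Real.exp (-Real.pi * ‖x‖ ^ 2)) := by rw [pow_add]; ring
      _ ≤ _ := by gcongr; exact hA _ (norm_nonneg x)

theorem gaussianS_apply (x : V) :
    gaussianS V x = Complex.exp ((-Real.pi : ℂ) * (‖x‖ ^ 2 : ℝ)) := rfl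

variable {d : ℕ}

/-- The normalized Gaussian window `t ↦ 2^{d/4} e^{-π‖t‖²}`. -/
def win (d : ℕ) : 𝓢(Conf d, ℂ) := (((2 : ℝ) ^ (d / 4 : ℝ) : ℝ) : ℂ) • gaussianS (Conf d)

theorem hasTemperateGrowth_tfPhase (z : Phase d) : (fun t : Conf d =>
    Complex.exp (-(Real.pi * inner ℝ (pos z) (mom z) : ℝ) * Complex.I) *
    Complex.exp ((2 * Real.pi * inner ℝ (mom z) t : ℝ) * Complex.I)).HasTemperateGrowth := by
  refine (Function.HasTemperateGrowth.const _).mul (hasTemperateGrowth_cexp_mul_I ?_)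
  exact (Function.HasTemperateGrowth.const _).mul (Function.hasTemperateGrowth_inner_right _)

/-- The time-frequency shift of a Schwartz function, as a Schwartz function. -/
def tfS (z : Phase d) : 𝓢(Conf d, ℂ) →L[ℂ] 𝓢(Conf d, ℂ) :=
  (SchwartzMap.smulLeftCLM ℂ (fun t : Conf d =>
    Complex.exp (-(Real.pi * inner ℝ (pos z) (mom z) : ℝ) * Complex.I) *
    Complex.exp ((2 * Real.pi * inner ℝ (mom z) t : ℝ) * Complex.I))).comp
    (SchwartzMap.compSubConstCLM ℂ (pos z))

theorem tfS_apply (z : Phase d) (φ : 𝓢(Conf d, ℂ)) (t : Conf d) : tfS z φ t = tfShift z φ t := by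
  rw [tfS, ContinuousLinearMap.comp_apply,
    SchwartzMap.smulLeftCLM_apply_apply (hasTemperateGrowth_tfPhase z)]
  rfl

theorem coe_tfS (z : Phase d) (φ : 𝓢(Conf d, ℂ)) : (tfS z φ : Conf d → ℂ) = tfShift z φ :=
  funext (tfS_apply z φ)

theorem ambiguity_apply (φ ψ : 𝓢(Conf d, ℂ)) (z : Phase d) :
    ambiguity φ ψ z = ambiguityFun φ ψ z := rfl

/-- Covariance of the ambiguity function: time-frequency shifts of both arguments multiply it by a
character. -/
theorem ambiguity_tfS_tfS (z w : Phase d) (φ ψ : 𝓢(Conf d, ℂ)) :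
    ambiguity (tfS z φ) (tfS z ψ) w =
      Complex.exp ((2 * Real.pi * sympForm z w : ℝ) * Complex.I) * ambiguity φ ψ w := by
  simp only [ambiguity_apply, ambiguityFun, coe_tfS]
  rw [← integral_add_right_eq_self _ (pos z), ← integral_const_mul]
  congr 1
  funext t
  simp only [star_tfShift]
  simp only [tfShift, Complex.star_def, sympForm, phaseFactor, add_sub_cancel_right]
  rw [show t + pos z - pos w - pos z = t - pos w by abel]
  have h1 : ∀ a b c e x y : ℂ, Complex.exp a * Complex.exp b * x * (Complex.exp c *
      (Complex.exp e * y)) = Complex.exp (a + b + c + e) * x * y := by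
    intros
    simp only [Complex.exp_add]
    ring
  have h2 : ∀ a b x y : ℂ, Complex.exp a * (x * (Complex.exp b * y)) =
      Complex.exp (a + b) * x * y := by
    intros
    simp only [Complex.exp_add]
    ring
  rw [h1, h2]
  congr 3
  push_cast
  simp only [inner_add_right, inner_sub_right, real_inner_comm (mom z) (pos z),
    real_inner_comm (mom w) (pos z), real_inner_comm (mom z) (pos w)]
  push_cast
  ring

/-- The ambiguity function of the window is a Gaussian. -/
theorem ambiguity_win (z : Phase d) :
    ambiguity (win d) (win d) z = (Real.exp (-(Real.pi / 2) * ‖z‖ ^ 2) : ℝ) := by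
  have h := fourier_gaussian_innerProductSpace (V := Conf d) (b := (2 * Real.pi : ℂ))
    (by simp [Real.pi_pos]) (mom z)
  rw [Real.fourier_eq'] at h
  rw [ambiguity_apply, ambiguityFun, ← integral_add_right_eq_self _ ((1 / 2 : ℝ) • pos z)]
  have hint : ∀ s : Conf d, win d (s + (1 / 2 : ℝ) • pos z) *
      star (tfShift z (win d) (s + (1 / 2 : ℝ) • pos z)) =
      ((2 : ℝ) ^ (d / 2 : ℝ) * Real.exp (-(Real.pi / 2) * ‖pos z‖ ^ 2) : ℝ) *
      (Complex.exp ((-2 * Real.pi * inner ℝ s (mom z) : ℝ) * Complex.I) •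
        Complex.exp (-(2 * Real.pi) * ‖s‖ ^ 2)) := by
    intro s
    have e2 : (((2 : ℝ) ^ (d / 2 : ℝ) : ℝ) : ℂ) =
        (((2 : ℝ) ^ (d / 4 : ℝ) : ℝ) : ℂ) * (((2 : ℝ) ^ (d / 4 : ℝ) : ℝ) : ℂ) := by
      rw [← Complex.ofReal_mul, ← Real.rpow_add two_pos]
      congr 2
      ring
    rw [star_tfShift, Complex.ofReal_mul, e2]
    simp only [win, smul_apply, gaussianS_apply, smul_eq_mul, star_mul', Complex.star_def,
      ← Complex.exp_conj, Complex.conj_ofReal, map_mul, map_neg, Complex.ofReal_exp, phaseFactor]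
    have hc : ∀ c a b e f g h : ℂ, a + b + e = f + g + h → c * Complex.exp a * (Complex.exp b *
        (c * Complex.exp e)) = c * c * Complex.exp f * (Complex.exp g * Complex.exp h) := by
      intro c a b e f g h H
      have : Complex.exp (a + b + e) = Complex.exp (f + g + h) := by rw [H]
      simp only [Complex.exp_add] at this
      linear_combination c ^ 2 * this
    apply hc
    have n1 : ‖s + (1 / 2 : ℝ) • pos z‖ ^ 2 = ‖s‖ ^ 2 + inner ℝ s (pos z) + ‖pos z‖ ^ 2 / 4 := by
      rw [norm_add_sq_real, inner_smul_right, norm_smul]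
      norm_num
      ring
    have n2 : ‖s + (1 / 2 : ℝ) • pos z - pos z‖ ^ 2 =
        ‖s‖ ^ 2 - inner ℝ s (pos z) + ‖pos z‖ ^ 2 / 4 := by
      rw [show s + (1 / 2 : ℝ) • pos z - pos z = s - (1 / 2 : ℝ) • pos z by module,
        norm_sub_sq_real, inner_smul_right, norm_smul]
      norm_num
      ring
    rw [n1, n2]
    simp only [inner_add_right, inner_smul_right, real_inner_comm (mom z) s,
      real_inner_comm (mom z) (pos z)]
    push_cast
    ring
  simp_rw [hint]
  rw [integral_const_mul]
  refine (congrArg _ h).trans ?_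
  have hp : (Real.pi : ℂ) ≠ 0 := by simp [Real.pi_ne_zero]
  have e3 : (Real.pi / (2 * Real.pi) : ℂ) = ((1 / 2 : ℝ) : ℂ) := by
    push_cast
    field_simp
  have e4 : ((Real.pi : ℂ) / (2 * Real.pi)) ^ ((Module.finrank ℝ (Conf d) : ℂ) / 2) =
      (((1 / 2 : ℝ) ^ (d / 2 : ℝ) : ℝ) : ℂ) := by
    rw [e3, Complex.ofReal_cpow (by norm_num)]
    simp
  have e5 : Complex.exp (-(Real.pi : ℂ) ^ 2 * ‖mom z‖ ^ 2 / (2 * Real.pi)) =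
      (Real.exp (-(Real.pi / 2) * ‖mom z‖ ^ 2) : ℝ) := by
    rw [Complex.ofReal_exp]
    congr 1
    push_cast
    field_simp
  rw [e4, e5, ← Complex.ofReal_mul, ← Complex.ofReal_mul, norm_sq_phase, mul_add, Real.exp_add,
    Real.div_rpow (by norm_num) (by norm_num), Real.one_rpow]
  congr 1
  have : (2 : ℝ) ^ (d / 2 : ℝ) ≠ 0 := (Real.rpow_pos_of_pos two_pos _).ne'
  field_simp

end Window

/-! ### Moyal's identity -/

section Moyal

variable {d : ℕ}

/-- The point of phase space with given position and momentum. -/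
def mkPhase (p : Conf d × Conf d) : Phase d :=
  (PiLp.sumPiLpEquivProdLpPiLp 2 (fun _ : Fin d ⊕ Fin d => ℝ) : Phase d ≃ₗᵢ[ℝ] _).symm
    (WithLp.toLp 2 p)

theorem pos_mkPhase (p : Conf d × Conf d) : pos (mkPhase p) = p.1 := rfl

theorem mom_mkPhase (p : Conf d × Conf d) : mom (mkPhase p) = p.2 := rfl

theorem measurePreserving_mkPhase : MeasurePreserving (mkPhase (d := d)) :=
  (LinearIsometryEquiv.measurePreserving
    (PiLp.sumPiLpEquivProdLpPiLp 2 (fun _ : Fin d ⊕ Fin d => ℝ) : Phase d ≃ₗᵢ[ℝ] _).symm).comp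
    (WithLp.volume_preserving_toLp (Conf d) (Conf d))

theorem measurableEmbedding_mkPhase : MeasurableEmbedding (mkPhase (d := d)) :=
  ((PiLp.sumPiLpEquivProdLpPiLp 2 (fun _ : Fin d ⊕ Fin d => ℝ) :
    Phase d ≃ₗᵢ[ℝ] _).symm.toHomeomorph.measurableEmbedding).comp
    (MeasurableEquiv.toLp 2 (Conf d × Conf d)).measurableEmbedding

theorem integral_phase {F : Phase d → ℂ} (hF : Integrable F) :
    ∫ z, F z = ∫ x, ∫ ξ, F (mkPhase (x, ξ)) := by
  rw [← measurePreserving_mkPhase.integral_comp measurableEmbedding_mkPhase]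
  exact integral_prod _
    ((measurePreserving_mkPhase.integrable_comp_emb measurableEmbedding_mkPhase).2 hF)

/-- The product `t ↦ φ(t) conj ψ(t - x)`. -/
def ambSlice (φ ψ : 𝓢(Conf d, ℂ)) (x : Conf d) : 𝓢(Conf d, ℂ) :=
  SchwartzMap.smulLeftCLM ℂ φ (conjS (ψ.compSubConstCLM ℂ x))

theorem conjS_apply {V : Type*} [NormedAddCommGroup V] [NormedSpace ℝ V] (φ : 𝓢(V, ℂ)) (x : V) :
    conjS φ x = star (φ x) := rfl

theorem ambSlice_apply (φ ψ : 𝓢(Conf d, ℂ)) (x t : Conf d) :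
    ambSlice φ ψ x t = φ t * star (ψ (t - x)) := by
  rw [ambSlice, SchwartzMap.smulLeftCLM_apply_apply φ.hasTemperateGrowth]
  rfl

open FourierTransform in
/-- For fixed position, the ambiguity function is a Fourier transform in the momentum variable. -/
theorem ambiguity_mkPhase (φ ψ : 𝓢(Conf d, ℂ)) (x ξ : Conf d) :
    ambiguity φ ψ (mkPhase (x, ξ)) =
      Complex.exp ((Real.pi * inner ℝ x ξ : ℝ) * Complex.I) * 𝓕 (ambSlice φ ψ x) ξ := by
  rw [SchwartzMap.fourier_coe, Real.fourier_eq', ambiguity_apply, ambiguityFun,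
    ← integral_const_mul]
  congr 1
  funext t
  rw [star_tfShift, ambSlice_apply, smul_eq_mul, phaseFactor, pos_mkPhase, mom_mkPhase]
  have h : ∀ a b c x y : ℂ, a = b + c → x * (Complex.exp a * y) =
      Complex.exp b * (Complex.exp c * (x * y)) := by
    rintro _ b c x y rfl
    rw [Complex.exp_add]
    ring
  apply h
  rw [real_inner_comm t ξ]
  push_cast
  ring

theorem integrable_mul_star {V : Type*} [NormedAddCommGroup V] [NormedSpace ℝ V]
    [FiniteDimensional ℝ V] [MeasurableSpace V] [BorelSpace V]
    (μ : Measure V) [μ.HasTemperateGrowth] (f g : 𝓢(V, ℂ)) :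
    Integrable (fun x => f x * star (g x)) μ := by
  have : (fun x => f x * star (g x)) = SchwartzMap.smulLeftCLM ℂ f (conjS g) := by
    funext x
    rw [SchwartzMap.smulLeftCLM_apply_apply f.hasTemperateGrowth]
    rfl
  rw [this]
  exact SchwartzMap.integrable _

open FourierTransform in
theorem integral_ambSlice (φ ψ φ' ψ' : 𝓢(Conf d, ℂ)) (x : Conf d) :
    ∫ ξ, ambiguity φ ψ (mkPhase (x, ξ)) * star (ambiguity φ' ψ' (mkPhase (x, ξ))) =
      ∫ t, (φ t * star (φ' t)) * (ψ' (t - x) * star (ψ (t - x))) := by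
  have h := SchwartzMap.integral_inner_fourier_fourier (ambSlice φ' ψ' x) (ambSlice φ ψ x)
  simp only [RCLike.inner_apply] at h
  convert h using 3 with ξ t
  · rw [ambiguity_mkPhase, ambiguity_mkPhase, star_mul', Complex.star_def, ← Complex.exp_conj]
    have he : ∀ a b x y : ℂ, a + b = 0 →
        Complex.exp a * x * (Complex.exp b * y) = x * y := by
      intro a b x y hab
      have := Complex.exp_add a b
      rw [hab, Complex.exp_zero] at this
      linear_combination - x * y * this
    apply he
    simp
  · simp only [ambSlice_apply, map_mul, Complex.star_def, Complex.conj_conj]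
    ring

/-- Moyal's identity: the ambiguity transform is isometric on rank-one operators. It follows from
Plancherel's theorem in the momentum variable and a convolution in the position variable. -/
theorem moyal (φ ψ φ' ψ' : 𝓢(Conf d, ℂ)) :
    ∫ z, ambiguity φ ψ z * star (ambiguity φ' ψ' z) =
      (∫ t, φ t * star (φ' t)) * ∫ t, ψ' t * star (ψ t) := by
  rw [integral_phase (integrable_mul_star _ _ _)]
  simp_rw [integral_ambSlice]
  have hint := Integrable.convolution_integrand (μ := (volume : Measure (Conf d)))
    (ContinuousLinearMap.mul ℝ ℂ) (integrable_mul_star volume φ φ')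
    (integrable_mul_star volume ψ' ψ).comp_neg
  simp only [ContinuousLinearMap.mul_apply', neg_sub] at hint
  rw [integral_integral_swap hint, ← integral_mul_const]
  congr 1
  funext t
  rw [integral_const_mul, integral_sub_left_eq_self (fun y => ψ' y * star (ψ y)) volume t]

end Moyal

/-! ### The symplectic Fourier transform -/

section Symplectic

variable {d : ℕ}

/-- The reflection `z ↦ -z` on Schwartz functions. -/
def reflS (V : Type*) [NormedAddCommGroup V] [NormedSpace ℝ V] : 𝓢(V, ℂ) →L[ℂ] 𝓢(V, ℂ) :=
  SchwartzMap.compCLMOfContinuousLinearEquiv ℂ (ContinuousLinearEquiv.neg ℝ)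

theorem reflS_apply {V : Type*} [NormedAddCommGroup V] [NormedSpace ℝ V] (φ : 𝓢(V, ℂ)) (z : V) :
    reflS V φ z = φ (-z) := rfl

/-- The transpose of the symplectic Fourier transform of distributions,
`φ ↦ ∫ e^{2πiσ(·, w)} φ(w) dw`. -/
def sympFourierInv : 𝓢(Phase d, ℂ) →L[ℂ] 𝓢(Phase d, ℂ) := (reflS (Phase d)).comp sympFourier

theorem sympFourierDist_apply (τ : 𝓢'(Phase d, ℂ)) (φ : 𝓢(Phase d, ℂ)) :
    sympFourierDist τ φ = τ (sympFourierInv φ) := rfl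

theorem sympForm_neg_left (z w : Phase d) : sympForm (-z) w = -sympForm z w := by
  simp [sympForm]
  ring

theorem sympForm_neg_right (z w : Phase d) : sympForm z (-w) = -sympForm z w := by
  simp [sympForm]
  ring

theorem sympForm_swap (z w : Phase d) : sympForm w z = -sympForm z w := by
  simp [sympForm, real_inner_comm]

theorem sympFourierInv_apply (φ : 𝓢(Phase d, ℂ)) (ζ : Phase d) :
    sympFourierInv φ ζ = ∫ z, Complex.exp ((2 * Real.pi * sympForm ζ z : ℝ) * Complex.I) * φ z := by
  have : sympFourierInv φ ζ = sympFourier φ (-ζ) := rfl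
  rw [this, sympFourier_apply]
  simp only [sympForm_neg_left]
  congr 1
  funext z
  congr 3
  push_cast
  ring

theorem sympFourierInv_refl (φ : 𝓢(Phase d, ℂ)) :
    sympFourierInv (reflS (Phase d) φ) = sympFourier φ := by
  ext ζ
  rw [sympFourierInv_apply, sympFourier_apply, ← integral_neg_eq_self]
  congr 1
  funext z
  rw [sympForm_neg_right, reflS_apply, neg_neg]
  congr 3
  push_cast
  ring

/-- The symplectic matrix as an isometry. -/
def sympJₗᵢ : Phase d ≃ₗᵢ[ℝ] Phase d where
  toLinearEquiv := sympJ.toLinearEquiv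
  norm_map' z := by
    rw [← sq_eq_sq₀ (norm_nonneg _) (norm_nonneg _), EuclideanSpace.norm_sq_eq,
      EuclideanSpace.norm_sq_eq]
    simp [sympJ, add_comm]

theorem sympJₗᵢ_apply (z : Phase d) : sympJₗᵢ z = sympJ z := rfl

open FourierTransform in
/-- The symplectic Fourier transform is an involution. -/
theorem sympFourier_sympFourier (φ : 𝓢(Phase d, ℂ)) : sympFourier (sympFourier φ) = φ := by
  ext ζ
  rw [sympFourier_apply]
  have h1 : ∀ w, sympFourier φ w = 𝓕 φ (sympJ w) := fun w => rfl
  have h2 : ∫ w, Complex.exp ((-2 * Real.pi * sympForm ζ w : ℝ) * Complex.I) * sympFourier φ w =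
      ∫ v, Complex.exp ((2 * Real.pi * inner ℝ v ζ : ℝ) * Complex.I) • 𝓕 φ v := by
    rw [← (sympJₗᵢ (d := d)).measurePreserving.integral_comp
      sympJₗᵢ.toHomeomorph.measurableEmbedding
      (fun v => Complex.exp ((2 * Real.pi * inner ℝ v ζ : ℝ) * Complex.I) • 𝓕 φ v)]
    congr 1
    funext w
    rw [h1, smul_eq_mul, sympJₗᵢ_apply, real_inner_comm, inner_sympJ, sympForm_swap ζ w]
    congr 3
    push_cast
    ring
  rw [h2, ← Real.fourierInv_eq', ← SchwartzMap.fourierInv_coe, fourierInv_fourier_eq]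

theorem sympFourierInv_sympFourierInv (φ : 𝓢(Phase d, ℂ)) :
    sympFourierInv (sympFourierInv φ) = φ := by
  have : sympFourierInv φ = reflS (Phase d) (sympFourier φ) := rfl
  rw [this, sympFourierInv_refl, sympFourier_sympFourier]

theorem sympFourierDist_sympFourierDist (τ : 𝓢'(Phase d, ℂ)) :
    sympFourierDist (sympFourierDist τ) = τ := by
  ext φ
  rw [sympFourierDist_apply, sympFourierDist_apply, sympFourierInv_sympFourierInv]

theorem sympFourier_translate (φ : 𝓢(Phase d, ℂ)) (a w : Phase d) :
    sympFourier (φ.compSubConstCLM ℂ a) w =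
      Complex.exp ((-2 * Real.pi * sympForm w a : ℝ) * Complex.I) * sympFourier φ w := by
  rw [sympFourier_apply, sympFourier_apply, ← integral_add_right_eq_self _ a, ← integral_const_mul]
  congr 1
  funext z
  rw [SchwartzMap.compSubConstCLM_apply, add_sub_cancel_right, ← mul_assoc, ← Complex.exp_add]
  congr 2
  simp only [sympForm, map_add, inner_add_left, inner_add_right]
  push_cast
  ring

end Symplectic

/-! ### Coherent states -/

section Coherent

variable {d : ℕ}

/-- A Schwartz function as an element of `L²`. -/
abbrev toL2 (ψ : 𝓢(Conf d, ℂ)) : L2 d := ψ.toLp 2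

/-- The coherent state at `z`: the time-frequency shift of the Gaussian window. -/
def coh (z : Phase d) : L2 d := toL2 (tfS z (win d))

theorem tfShift_zero (f : Conf d → ℂ) : tfShift 0 f = f := by
  funext t
  simp [tfShift]

theorem inner_toLp_eq_ambiguity (φ ψ : 𝓢(Conf d, ℂ)) (z : Phase d) :
    inner ℂ (toL2 (tfS z φ)) (toL2 ψ) = ambiguity ψ φ z := by
  refine (SchwartzMap.inner_toL2_toL2_eq _ _ volume).trans ?_
  rw [ambiguity_apply, ambiguityFun]
  simp only [RCLike.inner_apply, coe_tfS]
  rfl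

theorem inner_toLp_toLp (φ ψ : 𝓢(Conf d, ℂ)) :
    inner ℂ (toL2 φ) (toL2 ψ) = ∫ t, ψ t * star (φ t) := by
  refine (SchwartzMap.inner_toL2_toL2_eq _ _ volume).trans ?_
  simp only [RCLike.inner_apply]
  rfl

theorem inner_coh (ψ : 𝓢(Conf d, ℂ)) (z : Phase d) :
    inner ℂ (coh z) (toL2 ψ) = ambiguity ψ (win d) z := inner_toLp_eq_ambiguity _ _ _

theorem inner_coh_self (z : Phase d) : inner ℂ (coh z) (coh z) = 1 := by
  have h := ambiguity_tfS_tfS z 0 (win d) (win d)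
  rw [← inner_toLp_eq_ambiguity] at h
  have e : tfS 0 (tfS z (win d)) = tfS z (win d) := by
    ext t
    rw [tfS_apply, tfShift_zero]
  rw [e, ambiguity_win] at h
  rw [coh]
  simpa [sympForm] using h

theorem norm_coh (z : Phase d) : ‖coh z‖ = 1 := by
  have h := inner_self_eq_norm_sq_to_K (𝕜 := ℂ) (coh z)
  rw [inner_coh_self] at h
  have h' : (‖coh z‖ : ℝ) ^ 2 = 1 := Complex.ofReal_injective (by
    rw [Complex.ofReal_one, h, Complex.ofReal_pow]
    rfl)
  nlinarith [norm_nonneg (coh z)]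

/-- `‖coh z - coh w‖² = 2 - 2 Re ⟨coh z, coh w⟩`, and the inner product is an ambiguity function. -/
theorem continuous_coh : Continuous (coh (d := d)) := by
  rw [continuous_iff_continuousAt]
  intro w
  have h1 : Continuous fun z : Phase d => (inner ℂ (coh z) (coh w)).re := by
    have : ∀ z : Phase d, inner ℂ (coh z) (coh w) = ambiguity (tfS w (win d)) (win d) z :=
      fun z => inner_coh _ z
    simp_rw [this]
    exact Complex.continuous_re.comp (SchwartzMap.continuous _)
  have h2 : ∀ z, ‖coh z - coh w‖ = √(2 - 2 * (inner ℂ (coh z) (coh w)).re) := by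
    intro z
    have h := norm_sub_sq (𝕜 := ℂ) (coh z) (coh w)
    rw [norm_coh, norm_coh, RCLike.re_eq_complex_re] at h
    rw [← Real.sqrt_sq (norm_nonneg (coh z - coh w)), h]
    congr 1
    ring
  rw [ContinuousAt, tendsto_iff_norm_sub_tendsto_zero]
  simp_rw [h2]
  have h3 : Continuous fun z : Phase d => √(2 - 2 * (inner ℂ (coh z) (coh w)).re) := by fun_prop
  have h4 := h3.tendsto w
  rw [inner_coh_self] at h4
  simpa using h4

theorem continuous_inner_coh (ψ : L2 d) : Continuous fun z : Phase d => inner ℂ (coh z) ψ :=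
  continuous_coh.inner continuous_const

theorem norm_inner_coh_le (ψ : L2 d) (z : Phase d) : ‖inner ℂ (coh z) ψ‖ ≤ ‖ψ‖ := by
  simpa [norm_coh] using norm_inner_le_norm (𝕜 := ℂ) (coh z) ψ

theorem integral_norm_sq_inner_coh (ψ : 𝓢(Conf d, ℂ)) :
    ∫ z : Phase d, ‖inner ℂ (coh z) (toL2 ψ)‖ ^ 2 = ‖toL2 ψ‖ ^ 2 := by
  have h := moyal ψ (win d) ψ (win d)
  rw [← inner_toLp_toLp, ← inner_toLp_toLp] at h
  have hw : inner ℂ (toL2 (win d)) (toL2 (win d)) = 1 := by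
    have := inner_coh_self (0 : Phase d)
    have e : tfS 0 (win d) = win d := by
      ext t
      rw [tfS_apply, tfShift_zero]
    rwa [coh, e] at this
  rw [hw, mul_one, inner_self_eq_norm_sq_to_K] at h
  simp_rw [← inner_coh] at h
  have h2 : ∀ z : Phase d, inner ℂ (coh z) (toL2 ψ) * star (inner ℂ (coh z) (toL2 ψ)) =
      ((‖inner ℂ (coh z) (toL2 ψ)‖ ^ 2 : ℝ) : ℂ) := by
    intro z
    rw [Complex.star_def, Complex.mul_conj, Complex.normSq_eq_norm_sq]
  simp_rw [h2] at h
  have h3 := (integral_complex_ofReal (f := fun z : Phase d =>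
    ‖inner ℂ (coh z) (toL2 ψ)‖ ^ 2) (μ := volume)).symm.trans h
  refine Complex.ofReal_injective (h3.trans ?_)
  rw [Complex.ofReal_pow]
  rfl

theorem dense_range_toLp : DenseRange (toL2 (d := d)) :=
  SchwartzMap.denseRange_toLpCLM (F := ℂ) (μ := (volume : Measure (Conf d))) (p := 2) (by simp)

/-- The coherent states form a tight frame; only the upper frame bound is needed. -/
theorem lintegral_inner_coh_le (ψ : L2 d) :
    ∫⁻ z : Phase d, ‖inner ℂ (coh z) ψ‖ₑ ^ 2 ≤ ‖ψ‖ₑ ^ 2 := by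
  obtain ⟨u, hu, hlim⟩ := mem_closure_iff_seq_limit.1 (dense_range_toLp ψ)
  choose f hf using hu
  have h1 : ∀ n, ∫⁻ z : Phase d, ‖inner ℂ (coh z) (u n)‖ₑ ^ 2 = ‖u n‖ₑ ^ 2 := by
    intro n
    have h := integral_norm_sq_inner_coh (f n)
    rw [hf] at h
    have hi : Integrable fun z : Phase d => ‖inner ℂ (coh z) (u n)‖ ^ 2 := by
      rw [← hf]
      simp_rw [inner_coh]
      refine (integrable_mul_star volume (ambiguity (f n) (win d))
        (ambiguity (f n) (win d))).norm.congr (Eventually.of_forall fun z => ?_)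
      simp [sq]
    have := ofReal_integral_eq_lintegral_ofReal hi (Eventually.of_forall fun z => by positivity)
    rw [h] at this
    simp_rw [ENNReal.ofReal_pow (norm_nonneg _), ofReal_norm] at this
    exact this.symm
  have h2 : ∀ z : Phase d, Tendsto (fun n => ‖inner ℂ (coh z) (u n)‖ₑ ^ 2) atTop
      (nhds (‖inner ℂ (coh z) ψ‖ₑ ^ 2)) := fun z =>
    ((ENNReal.continuous_pow 2).tendsto _).comp
      ((tendsto_const_nhds.inner hlim).enorm)
  calc _ = ∫⁻ z : Phase d, liminf (fun n => ‖inner ℂ (coh z) (u n)‖ₑ ^ 2) atTop := by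
        congr 1
        funext z
        exact (h2 z).liminf_eq.symm
    _ ≤ liminf (fun n => ∫⁻ z : Phase d, ‖inner ℂ (coh z) (u n)‖ₑ ^ 2) atTop :=
        lintegral_liminf_le fun n =>
          (continuous_inner_coh (u n)).enorm.measurable.pow_const 2
    _ = ‖ψ‖ₑ ^ 2 := by
        simp_rw [h1]
        exact (((ENNReal.continuous_pow 2).tendsto _).comp hlim.enorm).liminf_eq

theorem lintegral_inner_coh_mul_le (ψ φ : L2 d) :
    ∫⁻ z : Phase d, ‖inner ℂ (coh z) ψ‖ₑ * ‖inner ℂ (coh z) φ‖ₑ ≤ ‖ψ‖ₑ * ‖φ‖ₑ := by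
  have h := ENNReal.lintegral_mul_le_Lp_mul_Lq (volume : Measure (Phase d))
    (p := 2) (q := 2) Real.HolderConjugate.two_two
    (continuous_inner_coh ψ).enorm.measurable.aemeasurable
    (continuous_inner_coh φ).enorm.measurable.aemeasurable
  refine h.trans ?_
  have h2 : ∀ χ : L2 d, (∫⁻ z : Phase d, ‖inner ℂ (coh z) χ‖ₑ ^ (2 : ℝ)) ^ (1 / 2 : ℝ) ≤ ‖χ‖ₑ := by
    intro χ
    have := lintegral_inner_coh_le χ
    calc _ ≤ (‖χ‖ₑ ^ (2 : ℝ)) ^ (1 / 2 : ℝ) := by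
          gcongr
          simpa using this
      _ = _ := by rw [← ENNReal.rpow_mul]; norm_num
  exact mul_le_mul' (h2 ψ) (h2 φ)

/-- The Gaussian `G = A(γ, γ)` on phase space, for the window `γ`. -/
def gaussPhase (d : ℕ) : 𝓢(Phase d, ℂ) := ambiguity (win d) (win d)

theorem gaussPhase_apply (z : Phase d) :
    gaussPhase d z = (Real.exp (-(Real.pi / 2) * ‖z‖ ^ 2) : ℝ) := ambiguity_win z

theorem gaussPhase_ne_zero (z : Phase d) : gaussPhase d z ≠ 0 := by
  rw [gaussPhase_apply]
  exact_mod_cast (Real.exp_pos _).ne'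

/-- The symplectic Fourier transform turns the damped ambiguity function `G · conj A(φ, ψ)` into the
product of the coherent state transforms of `ψ` and `φ`. -/
theorem sympFourierInv_gaussPhase_mul (φ ψ : 𝓢(Conf d, ℂ)) (z : Phase d) :
    sympFourierInv (SchwartzMap.smulLeftCLM ℂ (gaussPhase d) (conjS (ambiguity φ ψ))) z =
      inner ℂ (coh z) (toL2 ψ) * star (inner ℂ (coh z) (toL2 φ)) := by
  have h := moyal (tfS z (win d)) (tfS z (win d)) φ ψ
  rw [← inner_toLp_toLp, ← inner_toLp_toLp] at h
  rw [sympFourierInv_apply, Complex.star_def, inner_conj_symm, mul_comm (inner ℂ (coh z) _)]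
  refine Eq.trans ?_ h
  congr 1
  funext w
  rw [SchwartzMap.smulLeftCLM_apply_apply (gaussPhase d).hasTemperateGrowth, ambiguity_tfS_tfS,
    smul_eq_mul, conjS_apply, gaussPhase]
  ring

end Coherent

/-! ### Continuity of the ambiguity function -/

section AmbiguityContinuity

open LineDeriv

theorem continuous_seminorm_of_le {E : Type*} [AddCommGroup E] [Module ℂ E] [TopologicalSpace E]
    [IsTopologicalAddGroup E] (p : Seminorm ℂ E) {F : E → ℝ} (hF : Continuous F) (h0 : F 0 = 0)
    (h : ∀ x, p x ≤ F x) : Continuous p := by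
  refine Seminorm.continuous_of_continuousAt_zero ?_
  rw [ContinuousAt, map_zero]
  have := hF.tendsto 0
  rw [h0] at this
  exact squeeze_zero (fun x => apply_nonneg p x) h this

/-- The seminorms with `n + 1` derivatives are controlled by those with `n` derivatives of the
directional derivatives. -/
theorem exists_seminorm_succ_le {V : Type*} [NormedAddCommGroup V] [NormedSpace ℝ V]
    [FiniteDimensional ℝ V] (k n : ℕ) : ∃ C : ℝ, ∀ f : 𝓢(V, ℂ),
    SchwartzMap.seminorm ℂ k (n + 1) f ≤
      C * ∑ i, SchwartzMap.seminorm ℂ k n (∂_{Module.finBasis ℝ V i} f : 𝓢(V, ℂ)) := by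
  let b := Module.finBasis ℝ V
  let ℓ : Fin (Module.finrank ℝ V) → (ℂ →L[ℝ] (V →L[ℝ] ℂ)) := fun i =>
    (ContinuousLinearMap.smulRightL ℝ V ℂ) (LinearMap.toContinuousLinearMap (b.coord i))
  refine ⟨∑ i, ‖ℓ i‖, fun f => SchwartzMap.seminorm_le_bound ℂ k (n + 1) f (by positivity)
    fun x => ?_⟩
  have hfd : fderiv ℝ f = fun z => ∑ i, (ℓ i ∘ (∂_{b i} f : 𝓢(V, ℂ))) z := by
    funext z
    ext m
    have hm := congrArg (fderiv ℝ f z) (b.sum_repr m)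
    rw [map_sum] at hm
    rw [← hm]
    simp [ℓ, SchwartzMap.lineDerivOp_apply_eq_fderiv]
  have hc : ∀ i, ContDiff ℝ n (ℓ i ∘ (∂_{b i} f : 𝓢(V, ℂ))) := fun i =>
    (ℓ i).contDiff.comp (SchwartzMap.smooth _ n)
  rw [← norm_iteratedFDeriv_fderiv, hfd, iteratedFDeriv_sum fun i _ => hc i, Finset.sum_apply]
  calc _ ≤ ‖x‖ ^ k * ∑ i, ‖iteratedFDeriv ℝ n (ℓ i ∘ (∂_{b i} f : 𝓢(V, ℂ))) x‖ := by
        gcongr; exact norm_sum_le _ _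
    _ = ∑ i, ‖x‖ ^ k * ‖iteratedFDeriv ℝ n (ℓ i ∘ (∂_{b i} f : 𝓢(V, ℂ))) x‖ :=
        Finset.mul_sum _ _ _
    _ ≤ ∑ i, ‖ℓ i‖ * SchwartzMap.seminorm ℂ k n (∂_{b i} f : 𝓢(V, ℂ)) := by
        refine Finset.sum_le_sum fun i _ => ?_
        have h1 := (ℓ i).norm_iteratedFDeriv_comp_left (x := x)
          (SchwartzMap.smooth (∂_{b i} f : 𝓢(V, ℂ)) n).contDiffAt le_rfl
        calc _ ≤ ‖x‖ ^ k * (‖ℓ i‖ * ‖iteratedFDeriv ℝ n (∂_{b i} f : 𝓢(V, ℂ)) x‖) := by gcongr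
          _ = ‖ℓ i‖ * (‖x‖ ^ k * ‖iteratedFDeriv ℝ n (∂_{b i} f : 𝓢(V, ℂ)) x‖) := by ring
          _ ≤ _ := by gcongr; exact SchwartzMap.le_seminorm ℂ k n _ x
    _ ≤ ∑ i, (∑ j, ‖ℓ j‖) * SchwartzMap.seminorm ℂ k n (∂_{b i} f : 𝓢(V, ℂ)) := by
        gcongr with i _
        exact Finset.single_le_sum (f := fun j => ‖ℓ j‖) (fun j _ =>
          (ℓ j).opNorm_nonneg)
          (Finset.mem_univ i)
    _ = _ := (Finset.mul_sum _ _ _).symm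

variable {d : ℕ}

/-- The ambiguity function as a linear map in its first argument. -/
def ambLin (ψ : 𝓢(Conf d, ℂ)) : 𝓢(Conf d, ℂ) →ₗ[ℂ] 𝓢(Phase d, ℂ) where
  toFun φ := ambiguity φ ψ
  map_add' φ φ' := by
    ext z
    simp only [add_apply, ambiguity_apply, ambiguityFun, add_mul]
    exact integral_add (integrable_amb _ _ z) (integrable_amb _ _ z)
  map_smul' c φ := by
    ext z
    simp only [smul_apply, ambiguity_apply, ambiguityFun, smul_eq_mul, RingHom.id_apply,
      mul_assoc]
    exact integral_const_mul _ _

theorem ambLin_apply (φ ψ : 𝓢(Conf d, ℂ)) : ambLin ψ φ = ambiguity φ ψ := rfl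

theorem lineDeriv_ambiguity (φ ψ : 𝓢(Conf d, ℂ)) (m : Phase d) :
    (∂_{m} (ambiguity φ ψ) : 𝓢(Phase d, ℂ)) =
      (1 / 2 : ℂ) • ambiguity (∂_{(pos m)} φ : 𝓢(Conf d, ℂ)) ψ +
      (-1 / 2 : ℂ) • ambiguity φ (∂_{(pos m)} ψ : 𝓢(Conf d, ℂ)) +
      (-Real.pi * Complex.I) • ambiguity (mulCoord (mom m) φ) ψ +
      (-Real.pi * Complex.I) • ambiguity φ (mulCoord (mom m) ψ) := by
  ext z
  rw [SchwartzMap.lineDerivOp_apply_eq_fderiv]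
  exact fderiv_amb φ ψ m z

theorem continuous_seminorm_ambLin_zero (k : ℕ) : ∀ ψ : 𝓢(Conf d, ℂ),
    Continuous ((SchwartzMap.seminorm ℂ k 0).comp (ambLin ψ)) := by
  induction k with
  | zero =>
    intro ψ
    let L := SchwartzMap.toLpCLM ℂ (E := Conf d) ℂ 1 volume
    refine continuous_seminorm_of_le _ (F := fun φ => ‖L φ‖ * SchwartzMap.seminorm ℝ 0 0 ψ)
      (L.continuous.norm.mul continuous_const) (by simp) fun φ => ?_
    refine SchwartzMap.seminorm_le_bound ℂ 0 0 _ (by positivity) fun z => ?_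
    have h1 : ‖L φ‖ = ∫ t, ‖φ t‖ := SchwartzMap.norm_toLp_one
    rw [h1, ← integral_mul_const, pow_zero, one_mul, norm_iteratedFDeriv_zero, ambLin_apply]
    refine (norm_integral_le_integral_norm _).trans
      (integral_mono (integrable_amb φ ψ z).norm (φ.integrable.norm.mul_const _) fun t => ?_)
    simp only [norm_mul, norm_star, norm_tfShift]
    gcongr
    exact SchwartzMap.norm_le_seminorm ℝ ψ _
  | succ k ih =>
    intro ψ
    let e : Fin d → Conf d := fun i => EuclideanSpace.single i (1 : ℝ)
    let p : 𝓢(Conf d, ℂ) → 𝓢(Conf d, ℂ) → ℝ := fun φ ψ =>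
      SchwartzMap.seminorm ℂ k 0 (ambiguity φ ψ)
    have hp : ∀ ψ, Continuous fun φ => p φ ψ := ih
    have hp0 : ∀ ψ, p 0 ψ = 0 := fun ψ => by
      simp only [p, ← ambLin_apply, map_zero]
    refine continuous_seminorm_of_le _ (F := fun φ => ∑ i, ((p (mulCoord (e i) φ) ψ +
      p φ (mulCoord (e i) ψ)) + (p (∂_{e i} φ) ψ + p φ (∂_{e i} ψ)))) ?_ ?_ fun φ => ?_
    · refine continuous_finsetSum _ fun i _ => ?_
      exact (((hp _).comp (mulCoord (e i)).continuous).add (hp _)).add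
        (((hp _).comp (lineDerivOpCLM ℂ 𝓢(Conf d, ℂ) (e i)).continuous).add (hp _))
    · refine Finset.sum_eq_zero fun i _ => ?_
      have : (∂_{e i} (0 : 𝓢(Conf d, ℂ)) : 𝓢(Conf d, ℂ)) = 0 :=
        map_zero (lineDerivOpCLM ℂ 𝓢(Conf d, ℂ) (e i))
      simp only [this, map_zero, hp0, add_zero]
    refine SchwartzMap.seminorm_le_bound ℂ (k + 1) 0 _
      (Finset.sum_nonneg fun i _ => by positivity) fun z => ?_
    rw [norm_iteratedFDeriv_zero, ambLin_apply, ambiguity_apply]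
    have hb : ∀ φ ψ : 𝓢(Conf d, ℂ), ‖z‖ ^ k * ‖ambiguityFun φ ψ z‖ ≤ p φ ψ := fun φ ψ => by
      have := SchwartzMap.le_seminorm ℂ k 0 (ambiguity φ ψ) z
      rwa [norm_iteratedFDeriv_zero] at this
    have hx : ∀ i, ‖z‖ ^ k * (|inner ℝ (e i) (pos z)| * ‖ambiguityFun φ ψ z‖) ≤
        p (mulCoord (e i) φ) ψ + p φ (mulCoord (e i) ψ) := by
      intro i
      have h : |inner ℝ (e i) (pos z)| * ‖ambiguityFun φ ψ z‖ =
          ‖((inner ℝ (e i) (pos z) : ℝ) : ℂ) * ambiguityFun φ ψ z‖ := by simp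
      rw [h, amb_mul_fst]
      calc _ ≤ ‖z‖ ^ k * (‖ambiguityFun (mulCoord (e i) φ) ψ z‖ +
            ‖ambiguityFun φ (mulCoord (e i) ψ) z‖) := by gcongr; exact norm_sub_le _ _
        _ ≤ _ := by rw [mul_add]; exact add_le_add (hb _ _) (hb _ _)
    have hξ : ∀ i, ‖z‖ ^ k * (|inner ℝ (e i) (mom z)| * ‖ambiguityFun φ ψ z‖) ≤
        p (∂_{e i} φ) ψ + p φ (∂_{e i} ψ) := by
      intro i
      have h : |inner ℝ (e i) (mom z)| * ‖ambiguityFun φ ψ z‖ ≤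
          ‖(2 * Real.pi * Complex.I) * ((inner ℝ (e i) (mom z) : ℝ) : ℂ) * ambiguityFun φ ψ z‖ := by
        simp only [norm_mul, Complex.norm_real, Real.norm_eq_abs, Complex.norm_I,
          Complex.norm_ofNat, abs_of_pos Real.pi_pos, mul_one]
        have : 1 ≤ 2 * Real.pi := by linarith [Real.pi_gt_three]
        rw [mul_assoc]
        exact le_mul_of_one_le_left (by positivity) this
      rw [amb_mul_snd] at h
      calc _ ≤ ‖z‖ ^ k * (‖ambiguityFun (∂_{e i} φ : 𝓢(Conf d, ℂ)) ψ z‖ +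
            ‖ambiguityFun φ (∂_{e i} ψ : 𝓢(Conf d, ℂ)) z‖) := by
              gcongr; exact h.trans (norm_add_le _ _)
        _ ≤ _ := by rw [mul_add]; exact add_le_add (hb _ _) (hb _ _)
    calc ‖z‖ ^ (k + 1) * ‖ambiguityFun φ ψ z‖
        = ‖z‖ ^ k * ‖ambiguityFun φ ψ z‖ * ‖z‖ := by ring
      _ ≤ ‖z‖ ^ k * ‖ambiguityFun φ ψ z‖ *
          ∑ i, (|inner ℝ (e i) (pos z)| + |inner ℝ (e i) (mom z)|) := by
          gcongr; exact norm_phase_le z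
      _ = ∑ i, (‖z‖ ^ k * (|inner ℝ (e i) (pos z)| * ‖ambiguityFun φ ψ z‖) +
            ‖z‖ ^ k * (|inner ℝ (e i) (mom z)| * ‖ambiguityFun φ ψ z‖)) := by
          rw [Finset.mul_sum]; congr 1; funext i; ring
      _ ≤ _ := Finset.sum_le_sum fun i _ => add_le_add (hx i) (hξ i)

theorem continuous_seminorm_ambLin (n : ℕ) : ∀ (k : ℕ) (ψ : 𝓢(Conf d, ℂ)),
    Continuous ((SchwartzMap.seminorm ℂ k n).comp (ambLin ψ)) := by
  induction n with
  | zero => exact continuous_seminorm_ambLin_zero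
  | succ n ih =>
    intro k ψ
    obtain ⟨C, hC⟩ := exists_seminorm_succ_le (V := Phase d) k n
    let b := Module.finBasis ℝ (Phase d)
    let p : 𝓢(Conf d, ℂ) → 𝓢(Conf d, ℂ) → ℝ := fun φ ψ =>
      SchwartzMap.seminorm ℂ k n (ambiguity φ ψ)
    have hp : ∀ ψ, Continuous fun φ => p φ ψ := ih k
    have hp0 : ∀ ψ, p 0 ψ = 0 := fun ψ => by
      simp only [p, ← ambLin_apply, map_zero]
    have hbound : ∀ i φ, SchwartzMap.seminorm ℂ k n
        (∂_{b i} (ambiguity φ ψ) : 𝓢(Phase d, ℂ)) ≤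
        ‖(1 / 2 : ℂ)‖ * p (∂_{(pos (b i))} φ) ψ + ‖(-1 / 2 : ℂ)‖ * p φ (∂_{(pos (b i))} ψ) +
        ‖-Real.pi * Complex.I‖ * p (mulCoord (mom (b i)) φ) ψ +
        ‖-Real.pi * Complex.I‖ * p φ (mulCoord (mom (b i)) ψ) := by
      intro i φ
      rw [lineDeriv_ambiguity]
      refine (map_add_le_add _ _ _).trans ?_
      rw [map_smul_eq_mul]
      gcongr
      refine (map_add_le_add _ _ _).trans ?_
      rw [map_smul_eq_mul]
      gcongr
      refine (map_add_le_add _ _ _).trans ?_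
      rw [map_smul_eq_mul, map_smul_eq_mul]
    have hF : ∀ φ, SchwartzMap.seminorm ℂ k (n + 1) (ambiguity φ ψ) ≤ |C| *
        ∑ i, (‖(1 / 2 : ℂ)‖ * p (∂_{(pos (b i))} φ) ψ +
          ‖(-1 / 2 : ℂ)‖ * p φ (∂_{(pos (b i))} ψ) +
        ‖-Real.pi * Complex.I‖ * p (mulCoord (mom (b i)) φ) ψ +
        ‖-Real.pi * Complex.I‖ * p φ (mulCoord (mom (b i)) ψ)) := by
      intro φ
      refine (hC _).trans ?_
      refine mul_le_mul (le_abs_self C) (Finset.sum_le_sum fun i _ => hbound i φ)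
        (Finset.sum_nonneg fun i _ => by positivity) (abs_nonneg _)
    refine continuous_seminorm_of_le _ ?_ ?_ hF
    · refine continuous_const.mul (continuous_finsetSum _ fun i _ => ?_)
      exact (((continuous_const.mul ((hp _).comp
        (lineDerivOpCLM ℂ 𝓢(Conf d, ℂ) (pos (b i))).continuous)).add
        (continuous_const.mul (hp _))).add (continuous_const.mul
        ((hp _).comp (mulCoord (mom (b i))).continuous))).add (continuous_const.mul (hp _))
    · have : ∀ v : Conf d, (∂_{v} (0 : 𝓢(Conf d, ℂ)) : 𝓢(Conf d, ℂ)) = 0 := fun v =>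
        map_zero (lineDerivOpCLM ℂ 𝓢(Conf d, ℂ) v)
      simp only [this, map_zero, hp0, add_zero, mul_zero, Finset.sum_const_zero]

/-- By induction over the Schwartz seminorms: multiplication by coordinates and differentiation turn
an ambiguity function into a combination of ambiguity functions. -/
theorem continuous_ambiguity_left (ψ : 𝓢(Conf d, ℂ)) : Continuous fun φ => ambiguity φ ψ :=
  (schwartz_withSeminorms ℂ (Phase d) ℂ).continuous_of_continuous_comp (ambLin ψ)
    fun i => continuous_seminorm_ambLin i.2 i.1 ψ

theorem conjS_ambiguity (φ ψ : 𝓢(Conf d, ℂ)) :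
    conjS (ambiguity φ ψ) = reflS (Phase d) (ambiguity ψ φ) := by
  ext z
  rw [conjS_apply, reflS_apply, ambiguity_apply, ambiguity_apply, ambiguityFun, ambiguityFun,
    Complex.star_def, ← integral_conj, ← integral_add_right_eq_self _ (pos z)]
  congr 1
  funext t
  rw [← Complex.star_def, star_tfShift, star_tfShift, Complex.star_def]
  simp only [map_mul, ← Complex.exp_conj, phaseFactor, map_neg, add_sub_cancel_right,
    Complex.conj_conj, Complex.conj_ofReal, Complex.conj_I, sub_neg_eq_add,
    inner_neg_left, inner_neg_right, neg_neg, inner_add_right, real_inner_comm (mom z) (pos z)]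
  have h : ∀ a b x y : ℂ, a = b → x * (Complex.exp a * y) = y * (Complex.exp b * x) := by
    rintro a _ x y rfl
    ring
  apply h
  push_cast
  ring

theorem conjS_conjS {V : Type*} [NormedAddCommGroup V] [NormedSpace ℝ V] (φ : 𝓢(V, ℂ)) :
    conjS (conjS φ) = φ := by
  ext x
  simp [conjS_apply]

theorem conjS_smul {V : Type*} [NormedAddCommGroup V] [NormedSpace ℝ V] (c : ℂ) (φ : 𝓢(V, ℂ)) :
    conjS (c • φ) = star c • conjS φ := by
  ext x
  simp [conjS_apply]

/-- The functional `χ ↦ τ(conj A(conj χ, ψ))`, the value at `ψ` of the operator `weylOp τ`. The two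
conjugations make it linear in `χ` and turn the bilinear pairing into the sesquilinear one. -/
def weylFunctional (τ : 𝓢'(Phase d, ℂ)) (ψ : 𝓢(Conf d, ℂ)) : 𝓢'(Conf d, ℂ) :=
  ContinuousLinearMap.toPointwiseConvergenceCLM ℂ (RingHom.id ℂ) 𝓢(Conf d, ℂ) ℂ
  { toFun := fun χ => τ (conjS (ambLin ψ (conjS χ)))
    map_add' := fun χ χ' => by simp only [map_add]
    map_smul' := fun c χ => by
      rw [conjS_smul, map_smul, conjS_smul, star_star, map_smul]
      rfl
    cont := τ.continuous.comp (conjS.continuous.comp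
      ((continuous_ambiguity_left ψ).comp conjS.continuous)) }

theorem weylFunctional_apply (τ : 𝓢'(Phase d, ℂ)) (ψ χ : 𝓢(Conf d, ℂ)) :
    weylFunctional τ ψ χ = τ (reflS (Phase d) (ambLin (conjS χ) ψ)) := by
  rw [ambLin_apply, ← conjS_ambiguity]
  rfl

/-- The operator with Fourier-Wigner transform `τ`: every tempered distribution is one. -/
def weylOp (τ : 𝓢'(Phase d, ℂ)) : SchwartzOp d :=
  ContinuousLinearMap.toPointwiseConvergenceCLM ℂ (RingHom.id ℂ) 𝓢(Conf d, ℂ) 𝓢'(Conf d, ℂ)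
  { toFun := weylFunctional τ
    map_add' := fun ψ ψ' => by
      ext χ
      simp only [weylFunctional_apply, add_apply, map_add]
    map_smul' := fun c ψ => by
      ext χ
      simp only [weylFunctional_apply, smul_apply, map_smul, RingHom.id_apply]
    cont := PointwiseConvergenceCLM.continuous_of_continuous_eval fun χ => by
      simp only [weylFunctional_apply]
      exact τ.continuous.comp ((reflS (Phase d)).continuous.comp
        (continuous_ambiguity_left (conjS χ))) }

theorem isFourierWigner_weylOp (τ : 𝓢'(Phase d, ℂ)) : IsFourierWigner (weylOp τ) τ := by
  intro ψ φ
  have : pairing (weylOp τ ψ) φ = τ (conjS (ambLin ψ (conjS (conjS φ)))) := rfl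
  rw [this, conjS_conjS]
  rfl

end AmbiguityContinuity

/-! ### Young's inequality for distributions with an `L^p` Fourier transform -/

section Young

variable {d : ℕ}

/-- The tempered distribution `u` is given by the `L^p` function `g`; `lpENorm p u` is the infimum
of the norms of such functions. -/
def Represents (p : ℝ≥0∞) (g : Phase d → ℂ) (u : 𝓢'(Phase d, ℂ)) : Prop :=
  MemLp g p volume ∧ ∀ φ : 𝓢(Phase d, ℂ), u φ = ∫ z, φ z * g z

theorem lpENorm_le {p : ℝ≥0∞} {g : Phase d → ℂ} {u : 𝓢'(Phase d, ℂ)} (h : Represents p g u) :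
    lpENorm p u ≤ eLpNorm g p volume :=
  iInf₂_le g h

theorem le_mul_lpENorm {p C a : ℝ≥0∞} (hC0 : C ≠ 0) (hC : C ≠ ∞) {u : 𝓢'(Phase d, ℂ)}
    (h : ∀ g, Represents p g u → a ≤ C * eLpNorm g p volume) : a ≤ C * lpENorm p u := by
  simp_rw [lpENorm, ENNReal.mul_iInf_of_ne hC0 hC]
  exact le_iInf₂ h

theorem Represents.congr {p : ℝ≥0∞} {g g' : Phase d → ℂ} {u : 𝓢'(Phase d, ℂ)}
    (h : Represents p g u) (hg : g =ᵐ[volume] g') : Represents p g' u :=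
  ⟨h.1.ae_eq hg, fun φ => (h.2 φ).trans (integral_congr_ae (hg.mono fun z hz => by
    simp only [hz]))⟩

/-- Jensen's inequality for the measure `k(y) dy`, followed by Tonelli's theorem. -/
theorem lintegral_lintegral_mul_translate_rpow_le {k g : Phase d → ℝ≥0∞} (hk : Measurable k)
    (hg : Measurable g) {p : ℝ} (hp : 1 ≤ p) :
    ∫⁻ z, (∫⁻ y, k y * g (y + z)) ^ p ≤ (∫⁻ y, k y) ^ p * ∫⁻ z, g z ^ p := by
  have hm : Measurable fun q : Phase d × Phase d => g (q.2 + q.1) ^ p * k q.2 := by fun_prop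
  have h1 : ∀ z, (∫⁻ y, k y * g (y + z)) ^ p ≤
      (∫⁻ y, g (y + z) ^ p * k y) * (∫⁻ y, k y) ^ (p - 1) := fun z => by
    simp_rw [mul_comm (k _)]
    exact lintegral_mul_rpow_le (by fun_prop) hk.aemeasurable hp
  calc _ ≤ ∫⁻ z, (∫⁻ y, g (y + z) ^ p * k y) * (∫⁻ y, k y) ^ (p - 1) := lintegral_mono h1
    _ = (∫⁻ z, ∫⁻ y, g (y + z) ^ p * k y) * (∫⁻ y, k y) ^ (p - 1) :=
        lintegral_mul_const _ hm.lintegral_prod_right'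
    _ = (∫⁻ y, ∫⁻ z, g (y + z) ^ p * k y) * (∫⁻ y, k y) ^ (p - 1) := by
        rw [lintegral_lintegral_swap hm.aemeasurable]
    _ = ((∫⁻ z, g z ^ p) * ∫⁻ y, k y) * (∫⁻ y, k y) ^ (p - 1) := by
        congr 1
        rw [← lintegral_const_mul _ hk]
        congr 1
        funext y
        rw [lintegral_mul_const _ (by fun_prop), lintegral_add_left_eq_self (fun z => g z ^ p) y]
    _ = _ := by
        have : (∫⁻ y, k y) ^ p = (∫⁻ y, k y) * (∫⁻ y, k y) ^ (p - 1) := by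
          conv_lhs => rw [show p = 1 + (p - 1) by ring]
          rw [ENNReal.rpow_add_of_nonneg _ _ zero_le_one (by linarith), ENNReal.rpow_one]
        rw [this]
        ring

/-- Young's inequality `‖k * g‖_p ≤ ‖k‖_1 ‖g‖_p` on the level of nonnegative functions. -/
theorem eLpNorm_lintegral_mul_translate_le {k g : Phase d → ℝ≥0∞} (hk : Measurable k)
    (hg : Measurable g) {p : ℝ≥0∞} (hp : 1 ≤ p) :
    eLpNorm (fun z => ∫⁻ y, k y * g (y + z)) p volume ≤
      (∫⁻ y, k y) * eLpNorm g p volume := by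
  by_cases hpt : p = ∞
  · subst hpt
    rw [eLpNorm_exponent_top, eLpNorm_exponent_top]
    refine eLpNormEssSup_le_of_ae_enorm_bound (Eventually.of_forall fun z => ?_)
    rw [enorm_eq_self, ← lintegral_mul_const _ hk]
    refine lintegral_mono_ae ?_
    have h1 : ∀ᵐ y : Phase d, g y ≤ eLpNormEssSup g volume :=
      ae_le_eLpNormEssSup (f := g) (μ := volume)
    filter_upwards [(measurePreserving_add_right volume z).quasiMeasurePreserving.ae h1] with y hy
    gcongr
  · have hp0 : p ≠ 0 := (zero_lt_one.trans_le hp).ne'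
    have hp1 : 1 ≤ p.toReal := one_le_toReal hp hpt
    rw [eLpNorm_eq_lintegral_rpow_enorm_toReal hp0 hpt,
      eLpNorm_eq_lintegral_rpow_enorm_toReal hp0 hpt]
    simp only [enorm_eq_self]
    calc _ ≤ ((∫⁻ y, k y) ^ p.toReal * ∫⁻ z, g z ^ p.toReal) ^ (1 / p.toReal) := by
          gcongr
          exact lintegral_lintegral_mul_translate_rpow_le hk hg hp1
      _ = _ := by
          rw [ENNReal.mul_rpow_of_nonneg _ _ (by positivity), ← ENNReal.rpow_mul,
            mul_one_div_cancel (by positivity), ENNReal.rpow_one]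

/-- Functions with finite `L^p` norm are integrable against Schwartz functions. -/
theorem lintegral_mul_lt_top {F : Phase d → ℝ≥0∞} (hF : Measurable F) {p : ℝ≥0∞} (hp : 1 ≤ p)
    (hFp : eLpNorm F p volume < ∞) (φ : 𝓢(Phase d, ℂ)) : ∫⁻ z, F z * ‖φ z‖ₑ < ∞ := by
  have hφ : ∫⁻ z, ‖φ z‖ₑ < ∞ := φ.integrable.2
  by_cases hpt : p = ∞
  · subst hpt
    rw [eLpNorm_exponent_top] at hFp
    calc _ ≤ ∫⁻ z, eLpNormEssSup F volume * ‖φ z‖ₑ := by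
          refine lintegral_mono_ae
            ((ae_le_eLpNormEssSup (f := F) (μ := volume)).mono fun z hz => ?_)
          gcongr
          exact hz
      _ = eLpNormEssSup F volume * ∫⁻ z, ‖φ z‖ₑ :=
          lintegral_const_mul _ φ.continuous.enorm.measurable
      _ < ∞ := ENNReal.mul_lt_top hFp hφ
  · have hp0 : p ≠ 0 := (zero_lt_one.trans_le hp).ne'
    have hp1 : 1 ≤ p.toReal := one_le_toReal hp hpt
    have hFi := lintegral_rpow_enorm_lt_top_of_eLpNorm_lt_top hp0 hpt hFp
    simp only [enorm_eq_self] at hFi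
    have h := lintegral_mul_rpow_le (μ := volume) (a := F) (w := fun z => ‖φ z‖ₑ)
      hF.aemeasurable φ.continuous.enorm.measurable.aemeasurable hp1
    have hb : ∀ z, ‖φ z‖ₑ ≤ ENNReal.ofReal (SchwartzMap.seminorm ℝ 0 0 φ) := fun z => by
      rw [← ofReal_norm]
      exact ENNReal.ofReal_le_ofReal (SchwartzMap.norm_le_seminorm ℝ φ z)
    have h2 : ∫⁻ z, F z ^ p.toReal * ‖φ z‖ₑ < ∞ := by
      calc _ ≤ ∫⁻ z, F z ^ p.toReal * ENNReal.ofReal (SchwartzMap.seminorm ℝ 0 0 φ) := by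
            gcongr with z
            exact hb z
        _ = (∫⁻ z, F z ^ p.toReal) * ENNReal.ofReal (SchwartzMap.seminorm ℝ 0 0 φ) :=
            lintegral_mul_const _ (hF.pow_const _)
        _ < ∞ := ENNReal.mul_lt_top hFi ENNReal.ofReal_lt_top
    have h3 := h.trans_lt (ENNReal.mul_lt_top h2
      (ENNReal.rpow_lt_top_of_nonneg (by linarith) hφ.ne))
    rwa [ENNReal.rpow_lt_top_iff_of_pos (by linarith)] at h3

theorem sympForm_sub_left (z w v : Phase d) : sympForm (z - w) v = sympForm z v - sympForm w v := by
  simp [sympForm, inner_sub_left, inner_sub_right]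
  ring

/-- Multiplication by `m` becomes convolution under the symplectic Fourier transform. -/
theorem sympFourierInv_mul_sympFourierInv (m φ : 𝓢(Phase d, ℂ)) (x : Phase d) :
    sympFourierInv (SchwartzMap.smulLeftCLM ℂ m (sympFourierInv φ)) x =
      ∫ z, φ z * sympFourierInv m (x - z) := by
  have hint : Integrable (fun q : Phase d × Phase d =>
      Complex.exp ((2 * Real.pi * sympForm (x - q.2) q.1 : ℝ) * Complex.I) * (m q.1 * φ q.2))
      (volume.prod volume) := by
    refine (m.integrable.mul_prod φ.integrable).bdd_mul (c := 1) ?_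
      (Eventually.of_forall fun q => (Complex.norm_exp_ofReal_mul_I _).le)
    refine Continuous.aestronglyMeasurable ?_
    unfold sympForm
    fun_prop
  calc _ = ∫ w, ∫ z, Complex.exp ((2 * Real.pi * sympForm (x - z) w : ℝ) * Complex.I) *
        (m w * φ z) := by
        rw [sympFourierInv_apply]
        congr 1
        funext w
        rw [SchwartzMap.smulLeftCLM_apply_apply m.hasTemperateGrowth, sympFourierInv_apply,
          smul_eq_mul, ← integral_const_mul, ← integral_const_mul]
        congr 1
        funext z
        rw [sympForm_sub_left, sympForm_swap z w, mul_left_comm (m w), ← mul_assoc,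
          ← Complex.exp_add]
        congr 2
        push_cast
        ring
    _ = ∫ z, ∫ w, Complex.exp ((2 * Real.pi * sympForm (x - z) w : ℝ) * Complex.I) *
        (m w * φ z) := integral_integral_swap hint
    _ = _ := by
        congr 1
        funext z
        rw [sympFourierInv_apply, ← integral_const_mul]
        congr 1
        funext w
        ring

/-- The Fourier transform of `m v` is the convolution of `g` with `F_σ m`, written here as an
integral over translations of `g`. -/
theorem represents_convolution (m : 𝓢(Phase d, ℂ)) {p : ℝ≥0∞} (hp : 1 ≤ p) {g : Phase d → ℂ}
    (hgm : Measurable g) {v : 𝓢'(Phase d, ℂ)} (hg : Represents p g (sympFourierDist v)) :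
    Represents p (fun z => ∫ y, sympFourierInv m y * g (y + z))
        (sympFourierDist (TemperedDistribution.smulLeftCLM ℂ m v)) ∧
      eLpNorm (fun z => ∫ y, sympFourierInv m y * g (y + z)) p volume ≤
        (∫⁻ y, ‖sympFourierInv m y‖ₑ) * eLpNorm g p volume := by
  set k := sympFourierInv m with hk
  let N : Phase d → ℝ≥0∞ := fun z => ∫⁻ y, ‖k y‖ₑ * ‖g (y + z)‖ₑ
  have hkm : Measurable k := k.continuous.measurable
  have hNm : Measurable N := by
    have : Measurable fun q : Phase d × Phase d => ‖k q.2‖ₑ * ‖g (q.2 + q.1)‖ₑ := by fun_prop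
    exact this.lintegral_prod_right'
  have hN : eLpNorm N p volume ≤ (∫⁻ y, ‖k y‖ₑ) * eLpNorm g p volume := by
    have := eLpNorm_lintegral_mul_translate_le (k := fun y => ‖k y‖ₑ) (g := fun y => ‖g y‖ₑ)
      (by fun_prop) (by fun_prop) hp
    rwa [eLpNorm_enorm] at this
  have hNt : eLpNorm N p volume < ∞ :=
    hN.trans_lt (ENNReal.mul_lt_top k.integrable.2 hg.1.2)
  have hle : eLpNorm (fun z => ∫ y, k y * g (y + z)) p volume ≤ eLpNorm N p volume := by
    refine eLpNorm_mono_enorm fun z => ?_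
    rw [enorm_eq_self]
    refine (enorm_integral_le_lintegral_enorm _).trans (le_of_eq ?_)
    simp only [N, enorm_mul]
  have hmeas : AEStronglyMeasurable (fun z => ∫ y, k y * g (y + z)) volume := by
    have : StronglyMeasurable fun q : Phase d × Phase d => k q.2 * g (q.2 + q.1) :=
      Measurable.stronglyMeasurable (by fun_prop)
    exact this.integral_prod_right'.aestronglyMeasurable
  refine ⟨⟨⟨hmeas, hle.trans_lt hNt⟩, fun φ => ?_⟩, hle.trans hN⟩
  have hint : Integrable (fun q : Phase d × Phase d => φ q.1 * (k (q.2 - q.1) * g q.2))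
      (volume.prod volume) := by
    refine ⟨Measurable.aestronglyMeasurable ?_, ?_⟩
    · have := φ.continuous.measurable
      fun_prop
    · rw [HasFiniteIntegral, lintegral_prod _ (by
        have := φ.continuous.measurable
        exact Measurable.aemeasurable (by fun_prop))]
      refine lt_of_le_of_lt (le_of_eq ?_) (lintegral_mul_lt_top hNm hp hNt φ)
      congr 1
      funext z
      simp only [enorm_mul, N]
      rw [lintegral_const_mul _ (by fun_prop), mul_comm]
      congr 1
      rw [← lintegral_add_right_eq_self _ z]
      simp only [add_sub_cancel_right]
  have hv : v = sympFourierDist (sympFourierDist v) := (sympFourierDist_sympFourierDist v).symm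
  rw [sympFourierDist_apply, TemperedDistribution.smulLeftCLM_apply_apply, hv,
    sympFourierDist_apply, hg.2]
  simp_rw [sympFourierInv_mul_sympFourierInv, ← integral_mul_const, mul_assoc]
  rw [← integral_integral_swap hint]
  congr 1
  funext z
  rw [integral_const_mul, ← integral_add_right_eq_self _ z]
  simp only [add_sub_cancel_right, hk]

/-- Multiplying the Fourier transform by a Schwartz function `m` costs at most the `L¹` norm of the
Fourier transform of `m`. -/
theorem lpENorm_sympFourierDist_mul_le (m : 𝓢(Phase d, ℂ)) {C : ℝ≥0} (hC1 : 1 ≤ C)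
    (hC : ∫⁻ y, ‖sympFourierInv m y‖ₑ ≤ C) {p : ℝ≥0∞} (hp : 1 ≤ p) (v : 𝓢'(Phase d, ℂ)) :
    lpENorm p (sympFourierDist (TemperedDistribution.smulLeftCLM ℂ m v)) ≤
      C * lpENorm p (sympFourierDist v) := by
  refine le_mul_lpENorm (by simpa using (zero_lt_one.trans_le hC1).ne') ENNReal.coe_ne_top
    fun g hg => ?_
  have hae := hg.1.1.ae_eq_mk
  obtain ⟨h1, h2⟩ := represents_convolution m hp hg.1.1.stronglyMeasurable_mk.measurable
    (hg.congr hae)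
  rw [← eLpNorm_congr_ae hae] at h2
  exact (lpENorm_le h1).trans (h2.trans (by gcongr))

end Young

/-! ### Singular value decompositions and Bessel's inequality -/

section Bessel

variable {H : Type*} [NormedAddCommGroup H] [InnerProductSpace ℂ H]

/-- A sequence that satisfies Bessel's inequality, such as an orthonormal sequence in which some
vectors are replaced by zero. -/
def IsBessel (a : ℕ → H) : Prop := ∀ x, ∑' n, ‖inner ℂ x (a n)‖ₑ ^ 2 ≤ ‖x‖ₑ ^ 2

theorem IsBessel.enorm_le_one {a : ℕ → H} (ha : IsBessel a) (n : ℕ) : ‖a n‖ₑ ≤ 1 := by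
  have h := (ENNReal.le_tsum n).trans (ha (a n))
  rw [← ofReal_norm, ← ofReal_norm, inner_self_eq_norm_sq_to_K,
    ← ENNReal.ofReal_pow (norm_nonneg _),
    ← ENNReal.ofReal_pow (norm_nonneg _), ENNReal.ofReal_le_ofReal_iff (by positivity)] at h
  rw [← ofReal_norm, ← ENNReal.ofReal_one]
  refine ENNReal.ofReal_le_ofReal ?_
  simp only [norm_pow, Complex.coe_algebraMap, Complex.norm_real, norm_norm] at h
  by_contra! h1
  have : 1 < ‖a n‖ ^ 2 := one_lt_pow₀ h1 two_ne_zero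
  nlinarith

theorem isBessel_of_orthonormal {s : ℕ → ℝ} {e : ℕ → H}
    (he : Orthonormal ℂ fun n : {n // s n ≠ 0} => e n) :
    IsBessel fun n => if s n = 0 then 0 else e n := by
  intro x
  have hsupp : Function.support (fun n => ‖inner ℂ x (if s n = 0 then 0 else e n)‖ₑ ^ 2) ⊆
      {n | s n ≠ 0} := by
    intro n hn h
    exact hn (by simp [h])
  rw [← tsum_subtype_eq_of_support_subset hsupp]
  rw [ENNReal.tsum_eq_iSup_sum]
  refine iSup_le fun t => ?_
  have h := he.sum_inner_products_le (x := x) (s := t)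
  have h2 : ∀ i : {n | s n ≠ 0}, ‖inner ℂ x (if s i = 0 then 0 else e i)‖ₑ ^ 2 =
      ENNReal.ofReal (‖inner ℂ (e i) x‖ ^ 2) := fun i => by
    have hi : s i ≠ 0 := i.2
    rw [if_neg hi, ENNReal.ofReal_pow (norm_nonneg _), ofReal_norm, ← inner_conj_symm,
      RCLike.enorm_conj]
  simp_rw [h2]
  rw [← ENNReal.ofReal_sum_of_nonneg fun i _ => by positivity, ← ofReal_norm,
    ← ENNReal.ofReal_pow (norm_nonneg _)]
  exact ENNReal.ofReal_le_ofReal h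

/-- The products `|⟨x, aₙ⟩ ⟨x, bₙ⟩|` are the weights for Jensen's inequality. -/
theorem IsBessel.tsum_mul_le {a b : ℕ → H} (ha : IsBessel a) (hb : IsBessel b) {x : H}
    (hx : ‖x‖ₑ = 1) : ∑' n, ‖inner ℂ x (a n)‖ₑ * ‖inner ℂ x (b n)‖ₑ ≤ 1 := by
  have h1 := ha x
  have h2 := hb x
  rw [hx, one_pow] at h1 h2
  have h : ∀ u v : ℝ≥0∞, 2 * (u * v) ≤ u ^ 2 + v ^ 2 := fun u v => by
    by_cases hu : u = ∞
    · simp [hu]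
    by_cases hv : v = ∞
    · simp [hv]
    lift u to ℝ≥0 using hu
    lift v to ℝ≥0 using hv
    norm_cast
    rw [← NNReal.coe_le_coe]
    push_cast
    nlinarith [sq_nonneg ((u : ℝ) - v)]
  have h3 : 2 * ∑' n, ‖inner ℂ x (a n)‖ₑ * ‖inner ℂ x (b n)‖ₑ ≤ 2 := by
    rw [← ENNReal.tsum_mul_left]
    refine (ENNReal.tsum_le_tsum fun n => h _ _).trans ?_
    rw [ENNReal.tsum_add]
    exact (add_le_add h1 h2).trans (by norm_num)
  by_contra! h4
  have := ENNReal.mul_lt_mul_right two_ne_zero ENNReal.ofNat_ne_top h4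
  rw [mul_one] at this
  exact absurd h3 (not_le.2 this)

/-- A singular value decomposition, with the vectors that belong to vanishing singular values
replaced by zero. -/
theorem IsSVD.exists_isBessel {T : H →L[ℂ] H} {s : ℕ → ℝ} {e η : ℕ → H} (h : IsSVD T s e η) :
    ∃ a b : ℕ → H, IsBessel a ∧ IsBessel b ∧
      (∀ f, HasSum (fun n => ((s n : ℂ) * inner ℂ (b n) f) • a n) (T f)) ∧
      ∀ n, ENNReal.ofReal (s n) = ‖inner ℂ (a n) (T (b n))‖ₑ := by
  refine ⟨fun n => if s n = 0 then 0 else e n, fun n => if s n = 0 then 0 else η n,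
    isBessel_of_orthonormal h.orthonormal_left, isBessel_of_orthonormal h.orthonormal_right,
    fun f => ?_, fun n => ?_⟩
  · convert h.hasSum f using 2 with n
    by_cases hn : s n = 0 <;> simp [hn]
  · by_cases hn : s n = 0
    · simp [hn]
    · simp only [hn, if_false]
      have h1 := (h.hasSum (η n)).mapL (innerSL ℂ (e n))
      have h2 : HasSum (fun m => innerSL ℂ (e n) (((s m : ℂ) * inner ℂ (η m) (η n)) • e m))
          (s n : ℂ) := by
        convert hasSum_single (f := fun m => innerSL ℂ (e n)
          (((s m : ℂ) * inner ℂ (η m) (η n)) • e m)) n ?_ using 1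
        · have he := h.orthonormal_left.1 ⟨n, hn⟩
          have hη := h.orthonormal_right.1 ⟨n, hn⟩
          simp only at he hη
          simp [inner_self_eq_norm_sq_to_K, he, hη]
        · intro m hm
          by_cases hsm : s m = 0
          · simp [hsm]
          · have := h.orthonormal_right.2 (i := ⟨m, hsm⟩) (j := ⟨n, hn⟩)
              (fun h => hm (congrArg Subtype.val h))
            simp only at this
            simp [this]
      have h3 := h2.unique h1
      rw [innerSL_apply_apply] at h3
      rw [← h3, ← ofReal_norm, Complex.norm_real, Real.norm_of_nonneg (h.nonneg n)]

theorem enorm_le_tsum_enorm {f : ℕ → ℂ} {a : ℂ} (h : HasSum f a) : ‖a‖ₑ ≤ ∑' n, ‖f n‖ₑ := by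
  rw [← h.tsum_eq]
  exact enorm_tsum_le_tsum_enorm

end Bessel

/-! ### The Berezin symbol of an operator -/

section Berezin

variable {d : ℕ}

/-- The Berezin symbol of an operator: its expectation values in the coherent states. -/
def berezin (B : L2 d →L[ℂ] L2 d) (z : Phase d) : ℂ := inner ℂ (coh z) (B (coh z))

theorem continuous_berezin (B : L2 d →L[ℂ] L2 d) : Continuous (berezin B) :=
  continuous_coh.inner (B.continuous.comp continuous_coh)

theorem norm_berezin_le (B : L2 d →L[ℂ] L2 d) (z : Phase d) : ‖berezin B z‖ ≤ ‖B‖ := by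
  refine (norm_inner_le_norm _ _).trans ?_
  have := B.le_opNorm (coh z)
  simpa [norm_coh] using this

/-- The Berezin symbol is a superposition of the singular values with weights `w n z`, which sum to
at most `1` over `n` by Bessel's inequality and integrate to at most `1` over `z` by the frame bound
of the coherent states. Jensen's inequality then gives the claim. -/
theorem lintegral_enorm_berezin_rpow_le {B : L2 d →L[ℂ] L2 d} {s : ℕ → ℝ} {e η : ℕ → L2 d}
    (h : IsSVD B s e η) {p : ℝ} (hp : 1 ≤ p) :
    ∫⁻ z, ‖berezin B z‖ₑ ^ p ≤ ∑' n, ENNReal.ofReal (s n) ^ p := by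
  obtain ⟨a, b, ha, hb, hsum, -⟩ := h.exists_isBessel
  let w : ℕ → Phase d → ℝ≥0∞ := fun n z => ‖inner ℂ (coh z) (a n)‖ₑ * ‖inner ℂ (coh z) (b n)‖ₑ
  have hwm : ∀ n, Measurable (w n) := fun n =>
    (continuous_inner_coh (a n)).enorm.measurable.mul (continuous_inner_coh (b n)).enorm.measurable
  have hw1 : ∀ z, ∑' n, w n z ≤ 1 := fun z => ha.tsum_mul_le hb (by
    rw [← ofReal_norm, norm_coh, ENNReal.ofReal_one])
  have hwi : ∀ n, ∫⁻ z, w n z ≤ 1 := fun n =>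
    (lintegral_inner_coh_mul_le _ _).trans (mul_le_one' (ha.enorm_le_one n) (hb.enorm_le_one n))
  have h1 : ∀ z, ‖berezin B z‖ₑ ≤ ∑' n, ENNReal.ofReal (s n) * w n z := by
    intro z
    have h2 := enorm_le_tsum_enorm ((hsum (coh z)).mapL (innerSL ℂ (coh z)))
    refine h2.trans (le_of_eq (tsum_congr fun n => ?_))
    simp only [innerSL_apply_apply, inner_smul_right, enorm_mul, w]
    rw [← inner_conj_symm (b n), RCLike.enorm_conj]
    have : ‖(s n : ℂ)‖ₑ = ENNReal.ofReal (s n) := by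
      rw [← ofReal_norm, Complex.norm_real, Real.norm_of_nonneg (h.nonneg n)]
    rw [this]
    ring
  have h3 : ∀ z, ‖berezin B z‖ₑ ^ p ≤ ∑' n, ENNReal.ofReal (s n) ^ p * w n z := fun z =>
    calc ‖berezin B z‖ₑ ^ p ≤ (∑' n, ENNReal.ofReal (s n) * w n z) ^ p := by
          gcongr
          exact h1 z
      _ ≤ (∑' n, ENNReal.ofReal (s n) ^ p * w n z) * (∑' n, w n z) ^ (p - 1) :=
          tsum_mul_rpow_le _ _ hp
      _ ≤ (∑' n, ENNReal.ofReal (s n) ^ p * w n z) * 1 := by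
          gcongr
          exact ENNReal.rpow_le_one (hw1 z) (by linarith)
      _ = _ := mul_one _
  calc _ ≤ ∫⁻ z, ∑' n, ENNReal.ofReal (s n) ^ p * w n z := lintegral_mono h3
    _ = ∑' n, ∫⁻ z, ENNReal.ofReal (s n) ^ p * w n z :=
        lintegral_tsum fun n => ((hwm n).const_mul _).aemeasurable
    _ ≤ _ := ENNReal.tsum_le_tsum fun n => by
        rw [lintegral_const_mul _ (hwm n)]
        exact mul_le_of_le_one_right' (hwi n)

/-- Taking the Berezin symbol is a contraction from the Schatten class to `L^p`. -/
theorem eLpNorm_berezin_le (B : L2 d →L[ℂ] L2 d) {p : ℝ≥0∞} (hp : 1 ≤ p) :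
    eLpNorm (berezin B) p volume ≤ schattenENorm p B := by
  by_cases hpt : p = ∞
  · subst hpt
    rw [schattenENorm, if_pos rfl, eLpNorm_exponent_top]
    refine eLpNormEssSup_le_of_ae_enorm_bound (Eventually.of_forall fun z => ?_)
    rw [← ofReal_norm, ← ofReal_norm]
    exact ENNReal.ofReal_le_ofReal (norm_berezin_le B z)
  · have hp0 : p ≠ 0 := (zero_lt_one.trans_le hp).ne'
    have hp1 : 1 ≤ p.toReal := one_le_toReal hp hpt
    rw [schattenENorm, if_neg hpt]
    refine le_iInf fun s => le_iInf fun e => le_iInf fun η => le_iInf fun h => ?_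
    rw [eLpNorm_eq_lintegral_rpow_enorm_toReal hp0 hpt, lqENorm, if_neg hpt]
    gcongr
    exact lintegral_enorm_berezin_rpow_le h hp1

theorem integrable_norm_mul_seminorm_translate {E F : Type*} [NormedAddCommGroup E]
    [NormedSpace ℝ E] [FiniteDimensional ℝ E] [MeasurableSpace E] [BorelSpace E]
    {μ : Measure E} [μ.HasTemperateGrowth]
    [NormedAddCommGroup F] [NormedSpace ℝ F] (L : 𝓢(E, ℂ) →L[ℂ] 𝓢(F, ℂ)) (h φ : 𝓢(E, ℂ))
    (k n : ℕ) :
    Integrable (fun z => ‖φ z‖ * SchwartzMap.seminorm ℂ k n (L (h.compSubConstCLM ℂ (-z)))) μ := by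
  have hcont : Continuous fun f : 𝓢(F, ℂ) => SchwartzMap.seminorm ℂ k n f :=
    (schwartz_withSeminorms ℂ F ℂ).continuous_seminorm (k, n)
  let q : Seminorm ℂ 𝓢(E, ℂ) := (SchwartzMap.seminorm ℂ k n).comp (L : 𝓢(E, ℂ) →ₗ[ℂ] 𝓢(F, ℂ))
  have hq : Continuous q := hcont.comp L.continuous
  obtain ⟨s, C, -, hC⟩ := Seminorm.bound_of_continuous (schwartz_withSeminorms ℂ E ℂ) q hq
  have hb : ∀ f, SchwartzMap.seminorm ℂ k n (L f) ≤
      C * ∑ i ∈ s, SchwartzMap.seminorm ℂ i.1 i.2 f := fun f => by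
    refine (hC f).trans ?_
    have := Seminorm.finset_sup_le_sum (schwartzSeminormFamily ℂ E ℂ) s f
    rw [sum_apply] at this
    exact mul_le_mul_of_nonneg_left this C.2
  let bound : E → ℝ := fun z => C * ∑ i ∈ s, (2 ^ (i.1 - 1) *
    (SchwartzMap.seminorm ℂ 0 i.2 h * (‖z‖ ^ i.1 * ‖φ z‖) +
      SchwartzMap.seminorm ℂ i.1 i.2 h * ‖φ z‖))
  have hbi : Integrable bound μ := by
    refine (integrable_finsetSum _ fun i _ => ?_).const_mul _
    exact (((φ.integrable_pow_mul μ i.1).const_mul _).add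
      (φ.integrable.norm.const_mul _)).const_mul _
  refine hbi.mono' (Continuous.aestronglyMeasurable ?_) (Eventually.of_forall fun z => ?_)
  · exact φ.continuous.norm.mul (hcont.comp (L.continuous.comp
      ((continuous_translate h).comp continuous_neg)))
  · rw [Real.norm_of_nonneg (by positivity)]
    calc _ ≤ ‖φ z‖ * (C * ∑ i ∈ s, (2 ^ (i.1 - 1) * (‖-z‖ ^ i.1 * SchwartzMap.seminorm ℂ 0 i.2 h +
          SchwartzMap.seminorm ℂ i.1 i.2 h))) := by
          gcongr
          refine (hb _).trans ?_
          gcongr with i _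
          exact seminorm_translate_le h i.1 i.2 (-z)
      _ = bound z := by
          simp only [bound, norm_neg, Finset.mul_sum]
          refine Finset.sum_congr rfl fun i _ => ?_
          ring

/-- Damping the Fourier-Wigner transform of an operator by the Gaussian gives the symplectic Fourier
transform of the Berezin symbol. -/
theorem sympFourierDist_gaussPhase_mul_apply {T : SchwartzOp d} {τ : 𝓢'(Phase d, ℂ)}
    (hτ : IsFourierWigner T τ) {B : L2 d →L[ℂ] L2 d} (hB : IsRestriction T B)
    (φ : 𝓢(Phase d, ℂ)) :
    sympFourierDist (TemperedDistribution.smulLeftCLM ℂ (gaussPhase d) τ) φ =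
      ∫ z, φ z * berezin B z := by
  -- `Φ z` is the modulated Gaussian `w ↦ e^{2πiσ(w, z)} G(w)`. Written as the transform of a
  -- translate, its continuity in `z` and the bounds on its seminorms follow from those of
  -- translations.
  let Φ : Phase d → 𝓢(Phase d, ℂ) := fun z =>
    sympFourier ((sympFourier (gaussPhase d)).compSubConstCLM ℂ (-z))
  have hΦ : ∀ z w, Φ z w =
      Complex.exp ((2 * Real.pi * sympForm w z : ℝ) * Complex.I) * gaussPhase d w := by
    intro z w
    simp only [Φ]
    rw [sympFourier_translate, sympFourier_sympFourier, sympForm_neg_right]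
    congr 3
    push_cast
    ring
  have hΦ2 : ∀ z, Φ z = conjS (ambiguity (tfS z (win d)) (tfS z (win d))) := by
    intro z
    ext w
    rw [hΦ, conjS_apply, ambiguity_tfS_tfS, star_mul', Complex.star_def, ← Complex.exp_conj]
    have hg : star (ambiguity (win d) (win d) w) = gaussPhase d w := by
      rw [gaussPhase_apply, ambiguity_win, Complex.star_def, Complex.conj_ofReal]
    rw [← Complex.star_def, hg, sympForm_swap z w]
    congr 2
    simp
  have hval : ∀ z, τ (Φ z) = berezin B z := by
    intro z
    have h1 := hτ (tfS z (win d)) (tfS z (win d))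
    rw [hB] at h1
    rw [hΦ2]
    exact h1.symm
  rw [sympFourierDist_apply, TemperedDistribution.smulLeftCLM_apply_apply]
  simp_rw [← hval]
  refine apply_eq_integral (Φ := Φ) τ φ.continuous.aestronglyMeasurable
    (sympFourier.continuous.comp ((continuous_translate _).comp continuous_neg))
    (fun k n => integrable_norm_mul_seminorm_translate sympFourier _ φ k n) fun w => ?_
  rw [SchwartzMap.smulLeftCLM_apply_apply (gaussPhase d).hasTemperateGrowth, sympFourierInv_apply,
    smul_eq_mul, ← integral_const_mul]
  congr 1
  funext z
  rw [hΦ]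
  ring

theorem represents_berezin {T : SchwartzOp d} {τ : 𝓢'(Phase d, ℂ)}
    (hτ : IsFourierWigner T τ) {B : L2 d →L[ℂ] L2 d} (hB : IsRestriction T B) {p : ℝ≥0∞}
    (hp : eLpNorm (berezin B) p volume < ∞) : Represents p (berezin B)
      (sympFourierDist (TemperedDistribution.smulLeftCLM ℂ (gaussPhase d) τ)) :=
  ⟨⟨(continuous_berezin B).aestronglyMeasurable, hp⟩,
    sympFourierDist_gaussPhase_mul_apply hτ hB⟩

/-- Damping the Fourier-Wigner transform of an operator by the Gaussian gives a function on phase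
space whose norm is at most that of the operator. -/
theorem lpENorm_gaussPhase_mul_le {T : SchwartzOp d} {τ : 𝓢'(Phase d, ℂ)}
    (hτ : IsFourierWigner T τ) {p : ℝ≥0∞} (hp : 1 ≤ p) :
    lpENorm p (sympFourierDist (TemperedDistribution.smulLeftCLM ℂ (gaussPhase d) τ)) ≤
      opENorm p T := by
  refine le_iInf₂ fun B hB => ?_
  by_cases h : schattenENorm p B = ∞
  · rw [h]
    exact le_top
  · have h1 := eLpNorm_berezin_le B hp
    exact (lpENorm_le (represents_berezin hτ hB (h1.trans_lt (lt_top_iff_ne_top.2 h)))).trans h1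

end Berezin

/-! ### Toeplitz operators -/

section Toeplitz

variable {d : ℕ}

/-- Interpolation between the bounds for `p = 1` and `p = ∞`: the weight `w` is bounded by `c` in
`L¹` and in `L^∞`. -/
theorem lintegral_mul_le_of_weight {f w : Phase d → ℝ≥0∞} (hf : AEMeasurable f) (hw : Measurable w)
    {c : ℝ≥0∞} (hc : c ≠ ∞) (hwi : ∫⁻ z, w z ≤ c) (hwc : ∀ z, w z ≤ c) {p : ℝ≥0∞} (hp : 1 ≤ p) :
    ∫⁻ z, f z * w z ≤ eLpNorm f p volume * c := by
  by_cases hpt : p = ∞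
  · subst hpt
    rw [eLpNorm_exponent_top]
    calc _ ≤ ∫⁻ z, eLpNormEssSup f volume * w z := by
          refine lintegral_mono_ae
            ((ae_le_eLpNormEssSup (f := f) (μ := volume)).mono fun z hz => ?_)
          gcongr
          exact hz
      _ = eLpNormEssSup f volume * ∫⁻ z, w z := lintegral_const_mul _ hw
      _ ≤ _ := by gcongr
  · have hp0 : p ≠ 0 := (zero_lt_one.trans_le hp).ne'
    have hp1 : 1 ≤ p.toReal := one_le_toReal hp hpt
    have hpos : 0 < p.toReal := by linarith
    have h := lintegral_mul_rpow_le hf hw.aemeasurable hp1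
    rw [eLpNorm_eq_lintegral_rpow_enorm_toReal hp0 hpt]
    simp only [enorm_eq_self]
    rw [← ENNReal.rpow_le_rpow_iff hpos, ENNReal.mul_rpow_of_nonneg _ _ hpos.le, ← ENNReal.rpow_mul,
      one_div_mul_cancel hpos.ne', ENNReal.rpow_one]
    calc _ ≤ (∫⁻ z, f z ^ p.toReal * w z) * (∫⁻ z, w z) ^ (p.toReal - 1) := h
      _ ≤ (∫⁻ z, f z ^ p.toReal * c) * c ^ (p.toReal - 1) := by
          gcongr with z
          exact hwc z
      _ = (∫⁻ z, f z ^ p.toReal) * c ^ p.toReal := by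
          rw [lintegral_mul_const' _ _ hc, mul_assoc]
          congr 1
          conv_rhs => rw [show p.toReal = 1 + (p.toReal - 1) by ring]
          rw [ENNReal.rpow_add_of_nonneg _ _ zero_le_one (by linarith), ENNReal.rpow_one]

theorem enorm_inner_coh_le (ψ : L2 d) (z : Phase d) : ‖inner ℂ (coh z) ψ‖ₑ ≤ ‖ψ‖ₑ := by
  rw [← ofReal_norm, ← ofReal_norm]
  exact ENNReal.ofReal_le_ofReal (norm_inner_coh_le ψ z)

theorem lintegral_toeplitz_le {f : Phase d → ℂ} (hf : AEStronglyMeasurable f) {p : ℝ≥0∞}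
    (hp : 1 ≤ p) (ψ φ : L2 d) :
    ∫⁻ z, ‖f z * (inner ℂ (coh z) ψ * star (inner ℂ (coh z) φ))‖ₑ ≤
      eLpNorm f p volume * (‖ψ‖ₑ * ‖φ‖ₑ) := by
  have h := lintegral_mul_le_of_weight (f := fun z => ‖f z‖ₑ)
    (w := fun z => ‖inner ℂ (coh z) ψ‖ₑ * ‖inner ℂ (coh z) φ‖ₑ) hf.enorm
    ((continuous_inner_coh ψ).enorm.measurable.mul (continuous_inner_coh φ).enorm.measurable)
    (ENNReal.mul_ne_top enorm_ne_top enorm_ne_top) (lintegral_inner_coh_mul_le ψ φ)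
    (fun z => mul_le_mul' (enorm_inner_coh_le ψ z) (enorm_inner_coh_le φ z)) hp
  rw [eLpNorm_enorm] at h
  refine le_trans (le_of_eq ?_) h
  congr 1
  funext z
  rw [enorm_mul, enorm_mul, ← ofReal_norm (star _), norm_star, ofReal_norm]

theorem integrable_toeplitz {f : Phase d → ℂ} {p : ℝ≥0∞} (hf : MemLp f p volume)
    (hp : 1 ≤ p) (ψ φ : L2 d) :
    Integrable fun z => f z * (inner ℂ (coh z) ψ * star (inner ℂ (coh z) φ)) := by
  refine ⟨hf.1.mul ((continuous_inner_coh ψ).mul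
    (continuous_inner_coh φ).star).aestronglyMeasurable, ?_⟩
  exact (lintegral_toeplitz_le hf.1 hp ψ φ).trans_lt
    (ENNReal.mul_lt_top hf.2 (ENNReal.mul_lt_top enorm_lt_top enorm_lt_top))

/-- `B` is the Toeplitz operator with symbol `f`, the superposition of the projections onto the
coherent states with density `f`. -/
def IsToeplitz (f : Phase d → ℂ) (B : L2 d →L[ℂ] L2 d) : Prop :=
  ∀ ψ φ, inner ℂ φ (B ψ) = ∫ z, f z * (inner ℂ (coh z) ψ * star (inner ℂ (coh z) φ))

theorem IsToeplitz.enorm_inner_le {f : Phase d → ℂ} {B : L2 d →L[ℂ] L2 d} (hB : IsToeplitz f B)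
    (hf : AEStronglyMeasurable f) {p : ℝ≥0∞} (hp : 1 ≤ p) (ψ φ : L2 d) :
    ‖inner ℂ φ (B ψ)‖ₑ ≤ eLpNorm f p volume * (‖ψ‖ₑ * ‖φ‖ₑ) := by
  rw [hB]
  exact (enorm_integral_le_lintegral_enorm _).trans (lintegral_toeplitz_le hf hp ψ φ)

theorem IsToeplitz.enorm_le {f : Phase d → ℂ} {B : L2 d →L[ℂ] L2 d} (hB : IsToeplitz f B)
    (hf : AEStronglyMeasurable f) {p : ℝ≥0∞} (hp : 1 ≤ p) : ‖B‖ₑ ≤ eLpNorm f p volume := by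
  by_cases hfin : eLpNorm f p volume = ∞
  · rw [hfin]; exact le_top
  have h : ‖B‖ ≤ (eLpNorm f p volume).toReal := by
    refine ContinuousLinearMap.opNorm_le_bound _ ENNReal.toReal_nonneg fun ψ => ?_
    have h1 := hB.enorm_inner_le hf hp ψ (B ψ)
    have h2 := ENNReal.toReal_mono (by finiteness) h1
    rw [ENNReal.toReal_mul, ENNReal.toReal_mul, toReal_enorm, toReal_enorm, toReal_enorm,
      inner_self_eq_norm_sq_to_K, norm_pow, RCLike.norm_ofReal, abs_norm] at h2
    by_cases h0 : ‖B ψ‖ = 0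
    · rw [h0]; positivity
    · have hpos : 0 < ‖B ψ‖ := lt_of_le_of_ne (norm_nonneg _) (Ne.symm h0)
      nlinarith
  rw [← ofReal_norm, ← ENNReal.ofReal_toReal hfin]
  exact ENNReal.ofReal_le_ofReal h

theorem exists_isToeplitz {f : Phase d → ℂ} {p : ℝ≥0∞} (hf : MemLp f p volume) (hp : 1 ≤ p) :
    ∃ B, IsToeplitz f B := by
  have hi := fun ψ φ => integrable_toeplitz hf hp ψ φ
  let S : L2 d →ₗ⋆[ℂ] L2 d →ₗ[ℂ] ℂ := LinearMap.mk₂'ₛₗ (starRingEnd ℂ) (RingHom.id ℂ)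
    (fun φ ψ => ∫ z, f z * (inner ℂ (coh z) ψ * star (inner ℂ (coh z) φ)))
    (fun φ φ' ψ => by
      rw [← integral_add (hi ψ φ) (hi ψ φ')]
      congr 1
      funext z
      rw [inner_add_right, star_add]
      ring)
    (fun c φ ψ => by
      rw [smul_eq_mul, ← integral_const_mul]
      congr 1
      funext z
      rw [inner_smul_right, star_mul', Complex.star_def]
      ring)
    (fun φ ψ ψ' => by
      rw [← integral_add (hi ψ φ) (hi ψ' φ)]
      congr 1
      funext z
      rw [inner_add_right]
      ring)
    (fun c φ ψ => by
      rw [smul_eq_mul, ← integral_const_mul]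
      congr 1
      funext z
      rw [inner_smul_right, RingHom.id_apply]
      ring)
  have hS : ∀ φ ψ, ‖S φ ψ‖ ≤ (eLpNorm f p volume).toReal * ‖φ‖ * ‖ψ‖ := by
    intro φ ψ
    have h1 := (enorm_integral_le_lintegral_enorm _).trans (lintegral_toeplitz_le hf.1 hp ψ φ)
    have hfin := hf.2.ne
    have h2 := ENNReal.toReal_mono (by finiteness) h1
    rw [ENNReal.toReal_mul, ENNReal.toReal_mul, toReal_enorm, toReal_enorm, toReal_enorm] at h2
    refine le_trans h2 (le_of_eq ?_)
    ring
  refine ⟨ContinuousLinearMap.adjoint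
    (InnerProductSpace.continuousLinearMapOfBilin (LinearMap.mkContinuous₂ S _ hS)), fun ψ φ => ?_⟩
  rw [ContinuousLinearMap.adjoint_inner_right,
    InnerProductSpace.continuousLinearMapOfBilin_apply]
  rfl

theorem IsToeplitz.sub {f g : Phase d → ℂ} {A B : L2 d →L[ℂ] L2 d} (hA : IsToeplitz f A)
    (hB : IsToeplitz g B) {p : ℝ≥0∞} (hf : MemLp f p volume) (hg : MemLp g p volume) (hp : 1 ≤ p) :
    IsToeplitz (f - g) (A - B) := by
  intro ψ φ
  rw [sub_apply, inner_sub_right, hA, hB, ← integral_sub (integrable_toeplitz hf hp ψ φ)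
    (integrable_toeplitz hg hp ψ φ)]
  congr 1
  funext z
  rw [Pi.sub_apply]
  ring

theorem isCompactOperator_rankOne {H : Type*} [NormedAddCommGroup H] [InnerProductSpace ℂ H]
    (x y : H) : IsCompactOperator (InnerProductSpace.rankOne ℂ x y) := by
  have h : IsCompactOperator (ContinuousLinearMap.toSpanSingleton ℂ x) :=
    isCompactOperator_of_locallyCompactSpace_rng (ContinuousLinearMap.toSpanSingleton ℂ x)
  exact h.comp_clm (innerSL ℂ y)

/-- The operator is a Bochner integral of rank-one operators in the closed space of compact
operators. -/
theorem exists_isToeplitz_compact {g : Phase d → ℂ} (hg : Continuous g)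
    (hgc : HasCompactSupport g) : ∃ B, IsToeplitz g B ∧ IsCompactOperator B := by
  let K : Submodule ℂ (L2 d →L[ℂ] L2 d) := compactOperator (RingHom.id ℂ) (L2 d) (L2 d)
  have hK : IsClosed (K : Set (L2 d →L[ℂ] L2 d)) := isClosed_setOfPred_isCompactOperator
  have : CompleteSpace K := hK.completeSpace_coe
  let R : Phase d → L2 d →L[ℂ] L2 d := fun z => g z • InnerProductSpace.rankOne ℂ (coh z) (coh z)
  have hR : Continuous R := by
    have h1 := continuous_coh (d := d)
    exact hg.smul ((((ContinuousLinearMap.smulRightL ℂ (L2 d) (L2 d)).continuous.comp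
      ((innerSL ℂ).continuous.comp h1))).clm_apply h1)
  let F : Phase d → K := fun z => ⟨R z, K.smul_mem _ (isCompactOperator_rankOne _ _)⟩
  have hF : Continuous F := hR.subtype_mk _
  have hFc : HasCompactSupport F := hgc.mono fun z hz h => hz (Subtype.ext (by simp [F, R, h]))
  have hFi : Integrable F := hF.integrable_of_hasCompactSupport hFc
  refine ⟨((∫ z, F z : K) : L2 d →L[ℂ] L2 d), fun ψ φ => ?_, (∫ z, F z : K).2⟩
  let L : K →L[ℂ] ℂ := (innerSL ℂ φ).comp
    ((ContinuousLinearMap.apply ℂ (L2 d) ψ).comp K.subtypeL)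
  have h := ContinuousLinearMap.integral_comp_comm (𝕜 := ℂ) L hFi
  have h2 : inner ℂ φ (((∫ z, F z : K) : L2 d →L[ℂ] L2 d) ψ) = L (∫ z, F z) := rfl
  rw [h2]
  refine h.symm.trans ?_
  congr 1
  funext z
  have h3 : L (F z) = inner ℂ φ (g z • inner ℂ (coh z) ψ • coh z) := rfl
  rw [h3, inner_smul_right, inner_smul_right, Complex.star_def, inner_conj_symm]

/-- For `p < ∞` the symbol is a limit of continuous functions with compact support, and the operator
norm is at most the `L^p` norm of the symbol. -/
theorem IsToeplitz.isCompactOperator {f : Phase d → ℂ} {B : L2 d →L[ℂ] L2 d} (hB : IsToeplitz f B)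
    {p : ℝ≥0∞} (hf : MemLp f p volume) (hp : 1 ≤ p) (hpt : p ≠ ∞) : IsCompactOperator B := by
  have h : ∀ n : ℕ, ∃ A : L2 d →L[ℂ] L2 d, IsCompactOperator A ∧
      ‖B - A‖ₑ ≤ ENNReal.ofReal (1 / (n + 1)) := by
    intro n
    obtain ⟨g, hgc, hgn, hg, hgp⟩ := hf.exists_hasCompactSupport_eLpNorm_sub_le hpt
      (ε := ENNReal.ofReal (1 / (n + 1))) (by simp; positivity)
    obtain ⟨A, hA, hAc⟩ := exists_isToeplitz_compact hg hgc
    exact ⟨A, hAc, ((hB.sub hA hf hgp hp).enorm_le (hf.1.sub hgp.1) hp).trans hgn⟩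
  choose A hAc hA using h
  refine isCompactOperator_of_tendsto (l := atTop) (F := A) ?_ (Eventually.of_forall hAc)
  rw [tendsto_iff_norm_sub_tendsto_zero]
  refine squeeze_zero (fun n => norm_nonneg _) (fun n => ?_) tendsto_one_div_add_atTop_nhds_zero_nat
  have := hA n
  rw [← ofReal_norm, ENNReal.ofReal_le_ofReal_iff (by positivity)] at this
  rwa [norm_sub_rev]

/-- Dual to `lintegral_enorm_berezin_rpow_le`: the singular value `sₙ = ⟨aₙ, B bₙ⟩` is an average of
the symbol with the same weights, which now integrate to at most `1` over `z`. -/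
theorem IsToeplitz.tsum_rpow_le {f : Phase d → ℂ} {B : L2 d →L[ℂ] L2 d} (hB : IsToeplitz f B)
    (hf : AEStronglyMeasurable f) {s : ℕ → ℝ} {e η : ℕ → L2 d} (h : IsSVD B s e η) {p : ℝ}
    (hp : 1 ≤ p) : ∑' n, ENNReal.ofReal (s n) ^ p ≤ ∫⁻ z, ‖f z‖ₑ ^ p := by
  obtain ⟨a, b, ha, hb, -, hs⟩ := h.exists_isBessel
  let w : ℕ → Phase d → ℝ≥0∞ := fun n z => ‖inner ℂ (coh z) (a n)‖ₑ * ‖inner ℂ (coh z) (b n)‖ₑ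
  have hwm : ∀ n, Measurable (w n) := fun n =>
    (continuous_inner_coh (a n)).enorm.measurable.mul (continuous_inner_coh (b n)).enorm.measurable
  have hw1 : ∀ z, ∑' n, w n z ≤ 1 := fun z => ha.tsum_mul_le hb (by
    rw [← ofReal_norm, norm_coh, ENNReal.ofReal_one])
  have hwi : ∀ n, ∫⁻ z, w n z ≤ 1 := fun n =>
    (lintegral_inner_coh_mul_le _ _).trans (mul_le_one' (ha.enorm_le_one n) (hb.enorm_le_one n))
  have h1 : ∀ n, ENNReal.ofReal (s n) ≤ ∫⁻ z, ‖f z‖ₑ * w n z := by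
    intro n
    rw [hs, hB]
    refine (enorm_integral_le_lintegral_enorm _).trans (le_of_eq ?_)
    congr 1
    funext z
    rw [enorm_mul, enorm_mul, ← ofReal_norm (star _), norm_star, ofReal_norm,
      mul_comm ‖inner ℂ (coh z) (b n)‖ₑ]
  have h2 : ∀ n, ENNReal.ofReal (s n) ^ p ≤ ∫⁻ z, ‖f z‖ₑ ^ p * w n z := fun n =>
    calc _ ≤ (∫⁻ z, ‖f z‖ₑ * w n z) ^ p := by
          gcongr
          exact h1 n
      _ ≤ (∫⁻ z, ‖f z‖ₑ ^ p * w n z) * (∫⁻ z, w n z) ^ (p - 1) :=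
          lintegral_mul_rpow_le hf.enorm (hwm n).aemeasurable hp
      _ ≤ (∫⁻ z, ‖f z‖ₑ ^ p * w n z) * 1 := by
          gcongr
          exact ENNReal.rpow_le_one (hwi n) (by linarith)
      _ = _ := mul_one _
  calc _ ≤ ∑' n, ∫⁻ z, ‖f z‖ₑ ^ p * w n z := ENNReal.tsum_le_tsum h2
    _ = ∫⁻ z, ∑' n, ‖f z‖ₑ ^ p * w n z :=
        (lintegral_tsum fun n => (hf.enorm.pow_const p).mul (hwm n).aemeasurable).symm
    _ ≤ _ := lintegral_mono fun z => by
        rw [ENNReal.tsum_mul_left]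
        exact mul_le_of_le_one_right' (hw1 z)

/-- The map from symbols to Toeplitz operators is a contraction from `L^p` to the Schatten class. -/
theorem IsToeplitz.schattenENorm_le {f : Phase d → ℂ} {B : L2 d →L[ℂ] L2 d} (hB : IsToeplitz f B)
    {p : ℝ≥0∞} (hf : MemLp f p volume) (hp : 1 ≤ p) :
    schattenENorm p B ≤ eLpNorm f p volume := by
  by_cases hpt : p = ∞
  · subst hpt
    rw [schattenENorm, if_pos rfl]
    exact hB.enorm_le hf.1 hp
  · have hp0 : p ≠ 0 := (zero_lt_one.trans_le hp).ne'
    have hp1 : 1 ≤ p.toReal := one_le_toReal hp hpt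
    obtain ⟨s, e, η, h⟩ := exists_isSVD (hB.isCompactOperator hf hp hpt)
    rw [schattenENorm, if_neg hpt]
    refine iInf_le_of_le s (iInf_le_of_le e (iInf_le_of_le η (iInf_le_of_le h ?_)))
    rw [eLpNorm_eq_lintegral_rpow_enorm_toReal hp0 hpt, lqENorm, if_neg hpt]
    gcongr
    exact hB.tsum_rpow_le hf.1 h hp1

/-- An operator whose Fourier-Wigner transform is damped by the Gaussian is a Toeplitz operator. -/
theorem IsToeplitz.isRestriction {T : SchwartzOp d} {τ : 𝓢'(Phase d, ℂ)}
    (hT : IsFourierWigner T (TemperedDistribution.smulLeftCLM ℂ (gaussPhase d) τ))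
    {f : Phase d → ℂ} {p : ℝ≥0∞} (hf : Represents p f (sympFourierDist τ))
    {B : L2 d →L[ℂ] L2 d} (hB : IsToeplitz f B) : IsRestriction T B := by
  intro ψ φ
  rw [hT, hB (toL2 ψ) (toL2 φ), pairing, TemperedDistribution.smulLeftCLM_apply_apply,
    ← sympFourierDist_sympFourierDist τ, sympFourierDist_apply, hf.2]
  congr 1
  funext z
  rw [sympFourierInv_gaussPhase_mul, mul_comm]

theorem opENorm_le_of_represents {T : SchwartzOp d} {τ : 𝓢'(Phase d, ℂ)}
    (hT : IsFourierWigner T (TemperedDistribution.smulLeftCLM ℂ (gaussPhase d) τ))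
    {f : Phase d → ℂ} {p : ℝ≥0∞} (hp : 1 ≤ p) (hf : Represents p f (sympFourierDist τ)) :
    opENorm p T ≤ eLpNorm f p volume := by
  obtain ⟨B, hB⟩ := exists_isToeplitz hf.1 hp
  exact (iInf₂_le B (hB.isRestriction hT hf)).trans (hB.schattenENorm_le hf.1 hp)

/-- Conversely to `lpENorm_gaussPhase_mul_le`: damping the Fourier transform of a function by the
Gaussian gives the Fourier-Wigner transform of an operator whose norm is at most that of the
function. -/
theorem opENorm_le_lpENorm {T : SchwartzOp d} {τ : 𝓢'(Phase d, ℂ)}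
    (hT : IsFourierWigner T (TemperedDistribution.smulLeftCLM ℂ (gaussPhase d) τ))
    {p : ℝ≥0∞} (hp : 1 ≤ p) : opENorm p T ≤ lpENorm p (sympFourierDist τ) :=
  le_iInf₂ fun _ hf => opENorm_le_of_represents hT hp hf

end Toeplitz

/-! ### Inverting the Gaussian on a bounded set -/

section Multiplier

variable {d : ℕ}

/-- Multiplication of tempered distributions by the Gaussian `gaussPhase`. -/
abbrev gaussMul (τ : 𝓢'(Phase d, ℂ)) : 𝓢'(Phase d, ℂ) :=
  TemperedDistribution.smulLeftCLM ℂ (gaussPhase d) τ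

/-- The Schwartz function `m` inverts the square of the Gaussian on `Ω`: multiplication by
`gaussPhase · m · gaussPhase` fixes the distributions supported in `Ω`. -/
def InvertsGaussOn (m : 𝓢(Phase d, ℂ)) (Ω : Set (Phase d)) : Prop :=
  ∀ τ : 𝓢'(Phase d, ℂ), Distribution.dsupport τ ⊆ Ω →
    gaussMul (TemperedDistribution.smulLeftCLM ℂ m (gaussMul τ)) = τ

open scoped ContDiff in
/-- The function is `m = χ / gaussPhase²` with a smooth cutoff `χ` that is `1` near `Ω`. -/
theorem exists_invertsGaussOn {Ω : Set (Phase d)} (hΩ : Bornology.IsBounded Ω) :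
    ∃ m, InvertsGaussOn m Ω := by
  obtain ⟨R, hR0, hR⟩ := hΩ.subset_ball_lt 0 0
  let χ : ContDiffBump (0 : Phase d) := ⟨R, R + 1, hR0, by linarith⟩
  let f : Phase d → ℂ := fun z => (χ z : ℂ) * (gaussPhase d z ^ 2)⁻¹
  have hf : ContDiff ℝ ∞ f :=
    (Complex.ofRealCLM.contDiff.comp χ.contDiff).mul ((((gaussPhase d).smooth ⊤).pow 2).inv
      fun z => pow_ne_zero 2 (gaussPhase_ne_zero z))
  have hfc : HasCompactSupport f := by
    refine χ.hasCompactSupport.mono fun z hz h => hz ?_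
    simp [f, h]
  have hG := (gaussPhase d).hasTemperateGrowth
  have hm := (hfc.toSchwartzMap hf).hasTemperateGrowth
  refine ⟨hfc.toSchwartzMap hf, fun τ hτ => ?_⟩
  rw [gaussMul, gaussMul, TemperedDistribution.smulLeftCLM_smulLeftCLM_apply hG hm,
    TemperedDistribution.smulLeftCLM_smulLeftCLM_apply (hG.mul hm) hG]
  refine smulLeftCLM_eq_self_of_dsupport_subset τ ((hG.mul hm).mul hG)
    (Metric.isOpen_ball (x := 0) (ε := R)) (fun z hz => ?_) (hτ.trans hR)
  have h1 : hfc.toSchwartzMap hf z = (χ z : ℂ) * (gaussPhase d z ^ 2)⁻¹ := rfl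
  have h2 := gaussPhase_ne_zero z
  rw [Pi.mul_apply, Pi.mul_apply, h1, χ.one_of_mem_closedBall (Metric.ball_subset_closedBall hz)]
  field_simp
  simp

end Multiplier

/-! ### Limits of operators -/

section Limits

variable {d : ℕ}

/-- A function in `L^p` is determined almost everywhere by the distribution that it represents. -/
theorem Represents.ae_eq {p : ℝ≥0∞} (hp : 1 ≤ p) {g g' : Phase d → ℂ} {u : 𝓢'(Phase d, ℂ)}
    (h : Represents p g u) (hg' : LocallyIntegrable g')
    (h' : ∀ φ : 𝓢(Phase d, ℂ), u φ = ∫ z, φ z * g' z) : g =ᵐ[volume] g' := by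
  refine ae_eq_of_integral_contDiff_smul_eq (h.1.locallyIntegrable hp) hg' fun f hf hfc => ?_
  have hfc' : HasCompactSupport fun z => (f z : ℂ) :=
    hfc.comp_left (g := fun x : ℝ => (x : ℂ)) Complex.ofReal_zero
  exact (h.2 (hfc'.toSchwartzMap (Complex.ofRealCLM.contDiff.comp hf))).symm.trans
    (h' (hfc'.toSchwartzMap (Complex.ofRealCLM.contDiff.comp hf)))

theorem eLpNorm_le_lpENorm {p : ℝ≥0∞} (hp : 1 ≤ p) {g : Phase d → ℂ} {u : 𝓢'(Phase d, ℂ)}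
    (hg : LocallyIntegrable g) (h : ∀ φ : 𝓢(Phase d, ℂ), u φ = ∫ z, φ z * g z) :
    eLpNorm g p volume ≤ lpENorm p u :=
  le_iInf₂ fun _ hf => (eLpNorm_congr_ae (Represents.ae_eq hp hf hg h)).ge

theorem exists_represents {p : ℝ≥0∞} (hp : 1 ≤ p) {g : Phase d → ℂ} (hg : MemLp g p volume) :
    ∃ u, Represents p g u := by
  have : Fact (1 ≤ p) := ⟨hp⟩
  refine ⟨Lp.toTemperedDistribution (hg.toLp g), hg, fun φ => ?_⟩
  rw [Lp.toTemperedDistribution_apply]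
  refine integral_congr_ae (hg.coeFn_toLp.mono fun z hz => ?_)
  simp only [hz, smul_eq_mul]

theorem represents_of_lpENorm_lt {p a : ℝ≥0∞} {u : 𝓢'(Phase d, ℂ)} (h : lpENorm p u < a) :
    ∃ g, Represents p g u ∧ eLpNorm g p volume < a := by
  simp only [lpENorm, iInf_lt_iff] at h
  obtain ⟨g, hg, h⟩ := h
  exact ⟨g, hg, h⟩

/-- From an equicontinuous family that converges pointwise along a filter, one can extract a
pointwise convergent sequence, even if the filter is not countably generated. In addition, one
family of numbers can be made to converge. -/
theorem exists_seq_tendsto_of_equicontinuous {ι X : Type*} [TopologicalSpace X]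
    [TopologicalSpace.SeparableSpace X] [Nonempty X] {l : Filter ι} [l.NeBot] {b : ι → X → ℂ}
    (hb : Equicontinuous b) {b₀ : X → ℂ} (h : ∀ x, Tendsto (fun i => b i x) l (nhds (b₀ x)))
    {a : ι → ℂ} {a₀ : ℂ} (ha : Tendsto a l (nhds a₀)) :
    ∃ u : ℕ → ι, (∀ x, Tendsto (fun n => b (u n) x) atTop (nhds (b₀ x))) ∧
      Tendsto (fun n => a (u n)) atTop (nhds a₀) := by
  let D := TopologicalSpace.denseSeq X
  let f : ι → ℂ × (ℕ → ℂ) := fun i => (a i, fun n => b i (D n))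
  let f₀ : ℂ × (ℕ → ℂ) := (a₀, fun n => b₀ (D n))
  have hf : Tendsto f l (nhds f₀) := ha.prodMk_nhds (tendsto_pi_nhds.2 fun n => h (D n))
  have : (comap f (nhds f₀)).NeBot := NeBot.mono ‹_› (tendsto_iff_comap.1 hf)
  obtain ⟨u, hu⟩ := exists_seq_tendsto (comap f (nhds f₀))
  have hfu : Tendsto (f ∘ u) atTop (nhds f₀) := tendsto_comap_iff.1 hu
  refine ⟨u, fun x => ?_, hfu.fst_nhds⟩
  have hc : Continuous b₀ := (tendsto_pi_nhds.2 h).continuous_of_equicontinuous hb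
  have hcl := Equicontinuous.isClosed_setOfPred_tendsto (l := atTop) (hb.comp u) hc
  have hd : Set.range D ⊆ {x | Tendsto (fun n => (b ∘ u) n x) atTop (nhds (b₀ x))} := by
    rintro _ ⟨n, rfl⟩
    exact tendsto_pi_nhds.1 hfu.snd_nhds n
  exact hcl.closure_subset_iff.2 hd (TopologicalSpace.denseRange_denseSeq X x)

theorem equicontinuous_berezin {ι : Type*} {B : ι → L2 d →L[ℂ] L2 d} {K : ℝ}
    (hB : ∀ i, ‖B i‖ ≤ K) : Equicontinuous fun i => berezin (B i) := by
  intro z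
  have hc : Continuous fun w : Phase d => ‖coh z - coh w‖ := by
    simpa only [dist_eq_norm] using continuous_const.dist (continuous_coh (d := d))
  refine Metric.equicontinuousAt_of_continuity_modulus (fun w => 2 * K * ‖coh z - coh w‖) ?_ _
    (Eventually.of_forall fun w i => ?_)
  · simpa using (hc.tendsto z).const_mul (2 * K)
  · have h : berezin (B i) z - berezin (B i) w =
        inner ℂ (coh z - coh w) (B i (coh z)) + inner ℂ (coh w) (B i (coh z - coh w)) := by
      simp only [berezin, map_sub, inner_sub_left, inner_sub_right]
      ring
    have h1 : ‖inner ℂ (coh z - coh w) (B i (coh z))‖ ≤ ‖coh z - coh w‖ * K := by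
      refine (norm_inner_le_norm _ _).trans ?_
      gcongr
      simpa [norm_coh] using (B i).le_of_opNorm_le (hB i) (coh z)
    have h2 : ‖inner ℂ (coh w) (B i (coh z - coh w))‖ ≤ K * ‖coh z - coh w‖ := by
      refine (norm_inner_le_norm _ _).trans ?_
      rw [norm_coh, one_mul]
      exact (B i).le_of_opNorm_le (hB i) _
    rw [dist_eq_norm, h]
    refine (norm_add_le _ _).trans ((add_le_add h1 h2).trans (le_of_eq ?_))
    ring

variable {m : 𝓢(Phase d, ℂ)} {C : ℝ≥0}

theorem gaussMul_mul_apply (u : 𝓢'(Phase d, ℂ)) (φ : 𝓢(Phase d, ℂ)) :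
    gaussMul (TemperedDistribution.smulLeftCLM ℂ m (sympFourierDist u)) φ =
      u (sympFourierInv (SchwartzMap.smulLeftCLM ℂ m
        (SchwartzMap.smulLeftCLM ℂ (gaussPhase d) φ))) := rfl

/-- An operator with Fourier-Wigner transform `G m v` is a Toeplitz operator whose symbol has the
symplectic Fourier transform `m v`. -/
theorem opENorm_le_of_gaussMul_eq (hC1 : 1 ≤ C) (hC : ∫⁻ y, ‖sympFourierInv m y‖ₑ ≤ C)
    {p : ℝ≥0∞} (hp : 1 ≤ p) {S : SchwartzOp d} {v : 𝓢'(Phase d, ℂ)}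
    (hS : IsFourierWigner S (gaussMul (TemperedDistribution.smulLeftCLM ℂ m v))) :
    opENorm p S ≤ C * lpENorm p (sympFourierDist v) :=
  (opENorm_le_lpENorm hS hp).trans (lpENorm_sympFourierDist_mul_le m hC1 hC hp v)

/-- A lower semicontinuity property of the Schatten norms: the Berezin symbols of the operators
converge pointwise, so Fatou's lemma bounds the `L^p` norm of the limit, from which the limit
operator is recovered. -/
theorem opENorm_le_of_tendsto (hC1 : 1 ≤ C) (hC : ∫⁻ y, ‖sympFourierInv m y‖ₑ ≤ C)
    {p : ℝ≥0∞} (hp : 1 ≤ p) {ι : Type*} {l : Filter ι} [l.NeBot] {S : ι → SchwartzOp d}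
    {τ : ι → 𝓢'(Phase d, ℂ)} (hτ : ∀ i, IsFourierWigner (S i) (τ i))
    (hm : ∀ i, gaussMul (TemperedDistribution.smulLeftCLM ℂ m (gaussMul (τ i))) = τ i)
    {M : ℝ≥0∞} (hM : ∀ i, lpENorm p (sympFourierDist (gaussMul (τ i))) ≤ M) {S₀ : SchwartzOp d}
    (hS : ∀ ψ φ, Tendsto (fun i => pairing (S i ψ) φ) l (nhds (pairing (S₀ ψ) φ))) :
    opENorm p S₀ ≤ C * M := by
  by_cases hMt : M = ∞
  · rw [hMt, ENNReal.mul_top (by simpa using (zero_lt_one.trans_le hC1).ne')]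
    exact le_top
  -- The operators are Toeplitz operators with symbols in `L^p`, so they are uniformly bounded; the
  -- summand `1` makes room for a symbol with norm strictly below `K`.
  let K : ℝ≥0∞ := C * M + 1
  have hCM : C * M ≠ ∞ := ENNReal.mul_ne_top ENNReal.coe_ne_top hMt
  have hK : K ≠ ∞ := ENNReal.add_ne_top.2 ⟨hCM, ENNReal.one_ne_top⟩
  have hB : ∀ i, ∃ B, IsRestriction (S i) B ∧ ‖B‖ ≤ K.toReal := by
    intro i
    have h1 : lpENorm p (sympFourierDist (TemperedDistribution.smulLeftCLM ℂ m
        (gaussMul (τ i)))) < K := by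
      refine ((lpENorm_sympFourierDist_mul_le m hC1 hC hp _).trans ?_).trans_lt
        (ENNReal.lt_add_right hCM one_ne_zero)
      gcongr
      exact hM i
    obtain ⟨g, hg, hgK⟩ := represents_of_lpENorm_lt h1
    obtain ⟨B, hB⟩ := exists_isToeplitz hg.1 hp
    refine ⟨B, hB.isRestriction (by rw [← gaussMul, hm]; exact hτ i) hg, ?_⟩
    rw [← toReal_enorm]
    exact ENNReal.toReal_mono hK ((hB.enorm_le hg.1.1 hp).trans hgK.le)
  choose B hSB hBK using hB
  -- The Berezin symbol of the limit, defined before the limit is known to be bounded.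
  let b₀ : Phase d → ℂ := fun z => pairing (S₀ (tfS z (win d))) (tfS z (win d))
  have hb : ∀ z, Tendsto (fun i => berezin (B i) z) l (nhds (b₀ z)) := fun z =>
    (hS _ _).congr fun i => hSB i _ _
  have hEq := equicontinuous_berezin hBK
  have hb₀ : Continuous b₀ := (tendsto_pi_nhds.2 hb).continuous_of_equicontinuous hEq
  have hbM : ∀ i, eLpNorm (berezin (B i)) p volume ≤ M := fun i =>
    (eLpNorm_le_lpENorm hp (continuous_berezin _).locallyIntegrable
      (sympFourierDist_gaussPhase_mul_apply (hτ i) (hSB i))).trans (hM i)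
  have hb₀M : eLpNorm b₀ p volume ≤ M := by
    obtain ⟨n, hn, -⟩ := exists_seq_tendsto_of_equicontinuous hEq hb
      (tendsto_const_nhds (x := (0 : ℂ)))
    refine (Lp.eLpNorm_lim_le_liminf_eLpNorm
      (fun k => (continuous_berezin (B (n k))).aestronglyMeasurable) b₀
      (Eventually.of_forall hn)).trans ?_
    exact (liminf_le_liminf (Eventually.of_forall fun k => hbM (n k))).trans_eq (liminf_const M)
  obtain ⟨u, hu⟩ := exists_represents hp
    (⟨hb₀.aestronglyMeasurable, hb₀M.trans_lt (lt_top_iff_ne_top.2 hMt)⟩ : MemLp b₀ p volume)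
  -- The Fourier-Wigner transform of the limit is recovered from `b₀`, by passing to the limit in
  -- the same formula for the operators `S i`.
  have hFW : IsFourierWigner S₀
      (gaussMul (TemperedDistribution.smulLeftCLM ℂ m (sympFourierDist u))) := by
    intro ψ φ
    obtain ⟨n, hn, hn'⟩ := exists_seq_tendsto_of_equicontinuous hEq hb (hS ψ φ)
    rw [pairing, pairing, gaussMul_mul_apply, hu.2]
    set κ := sympFourierInv (SchwartzMap.smulLeftCLM ℂ m
      (SchwartzMap.smulLeftCLM ℂ (gaussPhase d) (conjS (ambiguity φ ψ)))) with hκ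
    have h1 : ∀ i, pairing (S i ψ) φ = ∫ z, κ z * berezin (B i) z := by
      intro i
      rw [← sympFourierDist_gaussPhase_mul_apply (hτ i) (hSB i), hτ i, hκ, ← gaussMul_mul_apply,
        sympFourierDist_sympFourierDist, ← gaussMul, hm i, pairing]
    refine tendsto_nhds_unique hn' ?_
    simp_rw [h1]
    refine tendsto_integral_of_dominated_convergence (fun z => ‖κ z‖ * K.toReal)
      (fun k => (κ.continuous.mul (continuous_berezin _)).aestronglyMeasurable)
      (κ.integrable.norm.mul_const _) (fun k => Eventually.of_forall fun z => ?_)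
      (Eventually.of_forall fun z => (hn z).const_mul _)
    rw [norm_mul]
    gcongr
    exact (norm_berezin_le _ z).trans (hBK _)
  refine (opENorm_le_of_gaussMul_eq hC1 hC hp hFW).trans ?_
  rw [sympFourierDist_sympFourierDist]
  gcongr
  exact (lpENorm_le hu).trans hb₀M

end Limits

/-! ### Comparison of the decoupling constants -/

section Comparison

variable {d : ℕ}

theorem lqENorm_mono {ι : Type*} (q : ℝ≥0∞) {a b : ι → ℝ≥0∞} (h : ∀ i, a i ≤ b i) :
    lqENorm q a ≤ lqENorm q b := by
  unfold lqENorm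
  split_ifs
  · exact iSup_mono h
  · gcongr with i
    exact h i

theorem lpENorm_zero (p : ℝ≥0∞) : lpENorm p (0 : 𝓢'(Phase d, ℂ)) = 0 := by
  have h : Represents p (0 : Phase d → ℂ) 0 := ⟨MemLp.zero, fun φ => by simp⟩
  exact le_antisymm ((lpENorm_le h).trans_eq eLpNorm_zero) bot_le

theorem dsupport_zero (d : ℕ) : Distribution.dsupport (0 : 𝓢'(Phase d, ℂ)) = ∅ :=
  Set.eq_empty_of_forall_notMem fun x hx =>
    (Distribution.mem_dsupport_iff x).1 hx ∅ (fun _ _ => rfl) isClosed_empty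

theorem hasSum_weylOp {ι : Type*} {τ : ι → 𝓢'(Phase d, ℂ)} {τ₀ : 𝓢'(Phase d, ℂ)}
    (h : HasSum τ τ₀) : HasSum (fun i => weylOp (τ i)) (weylOp τ₀) := by
  refine PointwiseConvergenceCLM.tendsto_iff_forall_tendsto.2 fun ψ =>
    PointwiseConvergenceCLM.tendsto_iff_forall_tendsto.2 fun χ => ?_
  have hW : ∀ τ : 𝓢'(Phase d, ℂ), weylOp τ ψ χ = τ (reflS (Phase d) (ambLin (conjS χ) ψ)) :=
    fun τ => weylFunctional_apply τ ψ χ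
  have h1 := PointwiseConvergenceCLM.tendsto_iff_forall_tendsto.1 h
    (reflS (Phase d) (ambLin (conjS χ) ψ))
  simp only [sum_apply, hW] at h1 ⊢
  exact h1

/-- Convergence in the operators from Schwartz functions to tempered distributions is tested against
two Schwartz functions. -/
theorem tendsto_pairing_of_hasSum {ι : Type*} {T : ι → SchwartzOp d} {S : SchwartzOp d}
    (h : HasSum T S) (ψ φ : 𝓢(Conf d, ℂ)) :
    Tendsto (fun s : Finset ι => pairing ((∑ i ∈ s, T i) ψ) φ) atTop
      (nhds (pairing (S ψ) φ)) :=
  PointwiseConvergenceCLM.tendsto_iff_forall_tendsto.1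
    (PointwiseConvergenceCLM.tendsto_iff_forall_tendsto.1 h ψ) (conjS φ)

theorem isFourierWigner_sum {ι : Type*} (s : Finset ι) {T : ι → SchwartzOp d}
    {τ : ι → 𝓢'(Phase d, ℂ)} (h : ∀ i, IsFourierWigner (T i) (τ i)) :
    IsFourierWigner (∑ i ∈ s, T i) (∑ i ∈ s, τ i) := by
  intro ψ φ
  simp only [pairing, sum_apply]
  exact Finset.sum_congr rfl fun i _ => h i ψ φ

theorem sInf_le_mul_sInf {A B : Set ℝ≥0∞} {C : ℝ≥0} (hC : 1 ≤ C) (h : ∀ D ∈ B, C * D ∈ A) :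
    sInf A ≤ C * sInf B := by
  rw [sInf_eq_iInf' B, ENNReal.mul_iInf_of_ne (by simpa using (zero_lt_one.trans_le hC).ne')
    ENNReal.coe_ne_top]
  exact le_iInf fun D => sInf_le (h D D.2)

theorem gaussMul_mul_gaussMul (m : 𝓢(Phase d, ℂ)) (τ : 𝓢'(Phase d, ℂ)) :
    gaussMul (TemperedDistribution.smulLeftCLM ℂ m τ) =
      TemperedDistribution.smulLeftCLM ℂ m (gaussMul τ) := by
  have hG := (gaussPhase d).hasTemperateGrowth
  rw [gaussMul, gaussMul,
    TemperedDistribution.smulLeftCLM_smulLeftCLM_apply m.hasTemperateGrowth hG,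
    TemperedDistribution.smulLeftCLM_smulLeftCLM_apply hG m.hasTemperateGrowth, mul_comm]

variable {Ω : Set (Phase d)} {m : 𝓢(Phase d, ℂ)} {C : ℝ≥0} (P : Partition Ω) {p : ℝ≥0∞}

/-- Given functions `f_θ`, the quantum inequality is applied to the Toeplitz operators with these
symbols; the symbol is recovered from the Berezin symbol of the Toeplitz operator, as the two
differ by a multiplier that is invertible on `Ω`. -/
theorem classicalConst_le (hm : InvertsGaussOn m Ω) (hC1 : 1 ≤ C)
    (hC : ∫⁻ y, ‖sympFourierInv m y‖ₑ ≤ C) (hp : 1 ≤ p) (q : ℝ≥0∞) :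
    classicalConst P p q ≤ C * quantumConst P p q := by
  refine sInf_le_mul_sInf hC1 fun D hD f u hf hu => ?_
  let L : 𝓢'(Phase d, ℂ) →L[ℂ] 𝓢'(Phase d, ℂ) :=
    (TemperedDistribution.smulLeftCLM ℂ (gaussPhase d)).comp sympFourierDist
  have hG := (gaussPhase d).hasTemperateGrowth
  have hS := hD (fun θ => weylOp (L (f θ))) (weylOp (L u)) (fun θ =>
    ⟨L (f θ), isFourierWigner_weylOp _,
      (Distribution.TemperedDistribution.dsupport_smulLeftCLM_subset hG).trans (hf θ)⟩)
    (hasSum_weylOp (L.hasSum hu))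
  have hle : ∀ θ, opENorm p (weylOp (L (f θ))) ≤ lpENorm p (f θ) := fun θ => by
    conv_rhs => rw [← sympFourierDist_sympFourierDist (f θ)]
    exact opENorm_le_lpENorm (isFourierWigner_weylOp (L (f θ))) hp
  -- The Fourier transforms of the `f θ` are fixed by the multiplier. The support of the limit need
  -- not be contained in `Ω`, but being fixed passes to the limit.
  have hfix : gaussMul (TemperedDistribution.smulLeftCLM ℂ m (gaussMul (sympFourierDist u))) =
      sympFourierDist u := by
    have h1 := sympFourierDist.hasSum hu
    have h2 := ((TemperedDistribution.smulLeftCLM ℂ (gaussPhase d)).comp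
      ((TemperedDistribution.smulLeftCLM ℂ m).comp
        (TemperedDistribution.smulLeftCLM ℂ (gaussPhase d)))).hasSum h1
    refine h2.unique ?_
    convert h1 using 2 with θ
    exact hm _ ((hf θ).trans (P.le_of_mem θ.2))
  calc lpENorm p u = lpENorm p (sympFourierDist (TemperedDistribution.smulLeftCLM ℂ m
        (gaussMul (L u)))) := by
        rw [← gaussMul_mul_gaussMul]
        exact congrArg (lpENorm p) ((sympFourierDist_sympFourierDist u).symm.trans
          (congrArg sympFourierDist hfix.symm))
    _ ≤ C * lpENorm p (sympFourierDist (gaussMul (L u))) :=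
        lpENorm_sympFourierDist_mul_le m hC1 hC hp _
    _ ≤ C * opENorm p (weylOp (L u)) := by
        gcongr
        exact lpENorm_gaussPhase_mul_le (isFourierWigner_weylOp _) hp
    _ ≤ C * (D * lqENorm q fun θ => lpENorm p (f θ)) := by
        gcongr
        exact hS.trans (mul_le_mul_right (lqENorm_mono q hle) D)
    _ = _ := (mul_assoc _ _ _).symm

/-- Given operators `T_θ`, the classical inequality is applied to the Berezin symbols of the finite
partial sums, from which the partial sums are recovered as Toeplitz operators. -/
theorem quantumConst_le (hm : InvertsGaussOn m Ω) (hC1 : 1 ≤ C)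
    (hC : ∫⁻ y, ‖sympFourierInv m y‖ₑ ≤ C) (hp : 1 ≤ p) (q : ℝ≥0∞) :
    quantumConst P p q ≤ C * classicalConst P p q := by
  classical
  refine sInf_le_mul_sInf hC1 fun D hD T S hT hS => ?_
  choose τ hτ hτs using hT
  have hG := (gaussPhase d).hasTemperateGrowth
  let v : P.parts → 𝓢'(Phase d, ℂ) := fun θ => sympFourierDist (gaussMul (τ θ))
  have hM : ∀ F : Finset P.parts, lpENorm p (sympFourierDist (gaussMul (∑ θ ∈ F, τ θ))) ≤
      D * lqENorm q fun θ => opENorm p (T θ) := by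
    intro F
    have hsum : HasSum (fun θ => if θ ∈ F then v θ else 0)
        (sympFourierDist (gaussMul (∑ θ ∈ F, τ θ))) := by
      have : sympFourierDist (gaussMul (∑ θ ∈ F, τ θ)) =
          ∑ θ ∈ F, if θ ∈ F then v θ else 0 := by
        rw [gaussMul, map_sum, map_sum]
        exact Finset.sum_congr rfl fun θ hθ => (if_pos hθ).symm
      rw [this]
      exact hasSum_sum_of_ne_finset_zero fun θ hθ => if_neg hθ
    refine (hD _ _ (fun θ => ?_) hsum).trans (mul_le_mul_right (lqENorm_mono q fun θ => ?_) D)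
    · split_ifs
      · rw [sympFourierDist_sympFourierDist]
        exact (Distribution.TemperedDistribution.dsupport_smulLeftCLM_subset hG).trans (hτs θ)
      · rw [map_zero]
        exact (dsupport_zero d).trans_subset (Set.empty_subset _)
    · split_ifs
      · exact lpENorm_gaussPhase_mul_le (hτ θ) hp
      · exact (lpENorm_zero p).trans_le bot_le
  rw [mul_assoc]
  refine opENorm_le_of_tendsto hC1 hC hp (fun F => isFourierWigner_sum F hτ) (fun F => ?_) hM
    (tendsto_pairing_of_hasSum hS)
  simp only [gaussMul, map_sum]
  exact Finset.sum_congr rfl fun θ _ => hm _ ((hτs θ).trans (P.le_of_mem θ.2))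

end Comparison

end QuantumDecoupling
end

theorem theorem1 (d : ℕ) (Ω : Set (QuantumDecoupling.Phase d)) (hΩ : Bornology.IsBounded Ω) :
    ∃ C : ℝ≥0, 1 ≤ C ∧
      ∀ (P : Partition Ω) (p q : ℝ≥0∞), 1 ≤ p → 1 ≤ q →
        (C : ℝ≥0∞)⁻¹ * QuantumDecoupling.classicalConst P p q ≤
            QuantumDecoupling.quantumConst P p q ∧
          QuantumDecoupling.quantumConst P p q ≤
            (C : ℝ≥0∞) * QuantumDecoupling.classicalConst P p q := by
  obtain ⟨m, hm⟩ := QuantumDecoupling.exists_invertsGaussOn hΩ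
  let I : ℝ≥0∞ := ∫⁻ y, ‖QuantumDecoupling.sympFourierInv m y‖ₑ
  have hI : I ≠ ∞ := (QuantumDecoupling.sympFourierInv m).integrable.2.ne
  have hC1 : 1 ≤ max 1 I.toNNReal := le_max_left _ _
  have hC : I ≤ (max 1 I.toNNReal : ℝ≥0) := by
    conv_lhs => rw [← ENNReal.coe_toNNReal hI]
    exact ENNReal.coe_le_coe.2 (le_max_right _ _)
  refine ⟨max 1 I.toNNReal, hC1, fun P p q hp _ => ⟨?_, ?_⟩⟩
  · rw [ENNReal.inv_mul_le_iff (by simp) ENNReal.coe_ne_top]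
    exact QuantumDecoupling.classicalConst_le P hm hC1 hC hp q
  · exact QuantumDecoupling.quantumConst_le P hm hC1 hC hp q
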